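/- **Setting.** Let $K$ be a division ring, $Q=(Q_0,Q_1,h,t)$ a finite quiver and $\sigma_a$ ($a\in Q_1$) automorphisms of $K$. Fix a set of loops of $Q$, called special loops (the other arrows are ordinary), for each special loop $s$ a quadratic $q_s(x)=x^2-\beta_s x+\gamma_s$ in the skew polynomial ring $K[x;\sigma_s]$, and a set $Z$ of paths of length at least $2$, none of which starts or ends with a special loop or contains the same special loop twice consecutively. Let $R=K_{\boldsymbol\sigma}Q/I$, where $K_{\boldsymbol\sigma}Q$ is the semilinear path algebra (so $a\lambda=\sigma_a(\lambda)a$) and $I$ is generated by $Z$ and the elements $s^2-\beta_s s+\gamma_s e_{h(s)}$. Assume that $R$ is a semilinear clannish algebra: at most two arrows have any given tail, at most two have any given head, and for any ordinary arrow $a$ there is at most one arrow $c$ with $ca$ a path not in $Z$ and at most one arrow $c$ with $ac$ a path not in $Z$. Assume that $R$ is normally bound ($q_s$ generates the same left and right ideal in $K[x;\sigma_s]$ for each $s$) and of non-singular type ($\gamma_s\neq0$ for each $s$). **Words.** Letters are $a,a^{-1}$ ($a$ ordinary) and $s^*=(s^*)^{-1}$ ($s$ special). A sign $\pm1$ is chosen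 for each letter so that distinct letters with the same head and sign form a set $\{a^{-1},b\}$ with $ab\in Z$. Let $I$ be $\{0,\dots,n\}$, $\mathbb N$, $-\mathbb N$ or $\mathbb Z$. An $I$-indexed word $w$ consists of vertices $v_i(w)$ ($i\in I$), letters $w_i$ ($i\in I'=\{i\in I: i-1\in I\}$) with head $v_{i-1}(w)$ and tail $v_i(w)$, such that $w_i^{-1}$ and $w_{i+1}$ have opposite signs, and a sign $\epsilon$, equal to the sign of $w_1$ if $1\in I'$ and to minus the sign of $w_0^{-1}$ if $0\in I'$. The trivial word at $\ell$ with sign $\epsilon$ is $1_{\ell,\epsilon}$. The word $w$ is finite if $I=\{0,\dots,n\}$, periodic if $I=\mathbb Z$ and $w$ equals one of its shifts by $n>0$, and end-admissible if no $*$-letter can be appended to $w$ or to $w^{-1}$ at an upper end of its index set so as to give a word. For $i\in I$ there are words $w_{>i}=w_{i+1}w_{i+2}\cdots$ and $(w_{\le i})^{-1}=w_i^{-1}w_{i-1}^{-1}\cdots$. The right-end-admissible (no $*$-letter can be appended at an upper end) finite or $\mathbb N$-indexed words with a given head and sign are totally ordered: $u<u'$ if, after a common finite initial part, $u$ continues with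 an ordinary direct letter and $u'$ with an ordinary inverse letter, or $u$ continues with an ordinary direct letter and $u'$ ends, or $u$ ends and $u'$ continues with an ordinary inverse letter. If $w_i$ is a $*$-letter, then $i$ is a symmetry, naturally direct or naturally inverse according as $(w_{\le i-1})^{-1}$ is equal to, greater than or less than $w_{>i}$. **Walks.** A walk $C$ over $w$ (so $C^*=w$) is obtained by replacing each $*$-letter $s^*$ of $w$ by $s$ or by $s^{-1}$. In the special-direct walk $D_w$ all become $s$, in the special-inverse walk $D'_w$ all become $s^{-1}$, and in the canonical walk $C_w$ the letter $w_i=s^*$ becomes $s$ if $i$ is naturally direct or $i\le 0$ is a symmetry, and $s^{-1}$ if $i$ is naturally inverse or $i>0$ is a symmetry. The quiver $Q_C$ has vertex set $I$ and an arrow $i\to i-1$ labelled $a$ if $C_i=a$, and $i-1\to i$ labelled $a$ if $C_i=a^{-1}$. **Functors.** $M(C)$ is the left $R$-module with generators $b_i$ ($i\in I$) and relations $e_{v_i(w)}b_i=b_i$; $ab_i=b_j$ for each arrow $i\to j$ of $Q_C$ labelled $a$; and $ab_i=0$ for $a$ ordinary with tail $v_i(w)$ if no arrow of $Q_C$ with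 tail $i$ is labelled $a$. Choose automorphisms $\pi_i$ of $K$ with $\pi_j=\sigma_a\pi_i$ for each arrow $i\to j$ of $Q_C$ labelled $a$; then $M(C)$ is an $R$-$K$-bimodule with $b_i\lambda=\pi_i(\lambda)b_i$. For a left $R$-module $M$ let $T_C(M)=\operatorname{Hom}_R(M(C),M)$, a left $K$-module by $(\lambda\theta)(x)=\theta(x\lambda)$. Let $1^+_{\ell,\epsilon}(M)$ be $\{m\in e_\ell M: am=0\}$ if there is an arrow $a$ with tail $\ell$ such that $a^{-1}$ (read as $a^*$ if $a$ is special) has sign $\epsilon$, and $e_\ell M$ otherwise; let $1^-_{\ell,\epsilon}(M)$ be $bM$ if there is an arrow $b$ with head $\ell$ such that $b$ (read as $b^*$ if $b$ is special) has sign $\epsilon$, and $0$ otherwise. Let $B_C^+(M)\subseteq T_C(M)$ consist of the $\theta$ with $\theta(b_i)=0$ for $i\ll0$ if $I$ is not bounded below, and with $\theta(b_0)\in 1^-_{\ell,-\epsilon}(M)$ if $I$ is bounded below and $C$ has head $\ell$ and sign $\epsilon$. Let $B_C^-(M)$ consist of the $\theta$ with $\theta(b_i)=0$ for $i\gg0$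 if $I$ is not bounded above, and with $\theta(b_n)\in 1^-_{\ell,-\epsilon}(M)$ if $n=\max I$ and $C^{-1}$ has head $\ell$ and sign $\epsilon$. Put $B_C=B_C^++B_C^-$ and $F_C=T_C/B_C$, a functor from left $R$-modules to left $K$-modules. For a finite or $\mathbb N$-indexed walk $E$ let $E^{+}(M)$ be the set of $m_0$ that occur in families $(m_i)_i$, indexed by the index set of $E$, with $m_i\in e_{v_i}M$, with $m_{i-1}=am_i$ if $E_i=a$ and $am_{i-1}=m_i$ if $E_i=a^{-1}$, and, if $E$ has finite length $n$, with $m_n\in 1^{+}_{\ell,\delta}(M)$, where $E^{-1}$ has head $\ell$ and sign $-\delta$. Define $E^-(M)$ in the same way, but with $m_n\in1^-_{\ell,\delta}(M)$ if $E$ is finite, and with $m_i=0$ for $i\gg0$ if $E$ is infinite. For $i\in I$, with $E=C_{>i}$ and $E'=(C_{\le i})^{-1}$, put $T_{C,i}=E^+\cap E'^+$ and $B_{C,i}=(E^+\cap E'^-)+(E^-\cap E'^+)$. For walks $C,D$ over the same word write $C\sim_i D$ if $T_{C,i}(M)=T_{D,i}(M)$ and $B_{C,i}(M)=B_{D,i}(M)$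 for all $R$-modules $M$. For an automorphism $\sigma$ of $K$, let ${}_\sigma F$ denote the functor $F$ followed by restriction along $\sigma$. **Theorem.** Let $w$ be an $I$-indexed end-admissible word which is finite or periodic. Then the functors $F_{D_w}$, $F_{C_w}$ and $F_{D'_w}$ from left $R$-modules to left $K$-modules are isomorphic up to twist: whatever the choices of the $\pi_i$ for the three walks, there are automorphisms $\sigma,\sigma'$ of $K$ with $$ {}_\sigma F_{D_w}\cong F_{C_w}\cong {}_{\sigma'}F_{D'_w}. $$ Moreover there exists $j\in I$ such that $D_w\sim_j C_w$ or $D'_w\sim_j C_w$. -/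

import Mathlib

open CategoryTheory

universe v u₁ u₂ u₃

noncomputable section

/-! ## Skew polynomial rings and normal quadratics -/

/-- The action of `ℕ` on `K` by powers of `σ`.  With it, Mathlib's `SkewPolynomial K` is the
skew polynomial ring `K[x; σ]`, in which `x λ = σ(λ) x`. -/
@[reducible] def skewAction {K : Type*} [DivisionRing K] (σ : RingAut K) :
    MulSemiringAction (Multiplicative ℕ) K :=
  MulSemiringAction.compHom K (powersHom (RingAut K) σ)

/-- The quadratic `x² - β x + γ` is normal in `K[x; σ]`: the right ideal and the left ideal that
it generates are equal. -/
def IsNormalQuadratic {K : Type*} [DivisionRing K] (σ : RingAut K) (β γ : K) : Prop :=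
  letI := skewAction σ
  let q : SkewPolynomial K :=
    SkewPolynomial.X ^ 2 - SkewPolynomial.C β * SkewPolynomial.X + SkewPolynomial.C γ
  Set.range (fun r : SkewPolynomial K => q * r) = Set.range (fun r : SkewPolynomial K => r * q)

/-! ## Semilinear clannish algebras -/

/-- The data defining a semilinear clannish algebra over the division ring `K`, for a quiver with
vertex set `V` and arrow set `A`.  A path `a₁ a₂ ⋯ aₙ` of positive length is the list of its
arrows, where the tail of each arrow is the head of the next one. -/
structure SemilinearClannishData (K V A : Type*) [DivisionRing K] where
  /-- the head of an arrow -/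
  hd : A → V
  /-- the tail of an arrow -/
  tl : A → V
  /-- the automorphisms `σ_a` -/
  σ : A → RingAut K
  /-- the set of special loops; the other arrows are called ordinary -/
  Sp : Set A
  special_loop : ∀ s ∈ Sp, hd s = tl s
  /-- the quadratic of a special loop `s` is `q_s(x) = x² - β_s x + γ_s` in `K[x; σ_s]` -/
  β : Sp → K
  γ : Sp → K
  /-- the zero-relations -/
  Z : Set (List A)
  Z_path : ∀ p ∈ Z, p.IsChain (fun a b => tl a = hd b)
  Z_length : ∀ p ∈ Z, 2 ≤ p.length
  Z_head : ∀ p ∈ Z, ∀ a ∈ p.head?, a ∉ Sp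
  Z_last : ∀ p ∈ Z, ∀ a ∈ p.getLast?, a ∉ Sp
  Z_no_square : ∀ p ∈ Z, p.IsChain (fun a b => ¬ (a ∈ Sp ∧ a = b))
  /-- at most two arrows have a given tail -/
  two_tail : ∀ v, {a | tl a = v}.encard ≤ 2
  /-- at most two arrows have a given head -/
  two_head : ∀ v, {a | hd a = v}.encard ≤ 2
  /-- for `a` ordinary there is at most one arrow `c` with `c a` a path not in `Z` -/
  unique_left : ∀ a, a ∉ Sp → {c | tl c = hd a ∧ [c, a] ∉ Z}.Subsingleton
  /-- for `a` ordinary there is at most one arrow `c` with `a c` a path not in `Z` -/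
  unique_right : ∀ a, a ∉ Sp → {c | tl a = hd c ∧ [a, c] ∉ Z}.Subsingleton

/-- Generators of the semilinear path algebra: scalars, trivial paths and arrows. -/
inductive PathGen (K V A : Type*)
  | scalar (l : K)
  | vertex (v : V)
  | arrow (a : A)

namespace SemilinearClannishData

variable {K V A : Type*} [DivisionRing K] [Fintype V]

/-- All quadratics `q_s` are normal. -/
def NormallyBound (D : SemilinearClannishData K V A) : Prop :=
  ∀ s : D.Sp, IsNormalQuadratic (D.σ s) (D.β s) (D.γ s)

/-- All quadratics `q_s` have a non-zero constant term. -/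
def NonSingularType (D : SemilinearClannishData K V A) : Prop :=
  ∀ s : D.Sp, D.γ s ≠ 0

section Generators
open FreeAlgebra PathGen

/-- The defining relations of the semilinear path algebra.  The first three say that
`K` maps to it by a ring homomorphism. -/
inductive PathRel (D : SemilinearClannishData K V A) :
    FreeAlgebra ℤ (PathGen K V A) → FreeAlgebra ℤ (PathGen K V A) → Prop
  | scalar_one : PathRel D (ι ℤ (scalar 1)) 1
  | scalar_add (l m : K) :
      PathRel D (ι ℤ (scalar (l + m))) (ι ℤ (scalar l) + ι ℤ (scalar m))
  | scalar_mul (l m : K) :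
      PathRel D (ι ℤ (scalar (l * m))) (ι ℤ (scalar l) * ι ℤ (scalar m))
  | idem (v : V) : PathRel D (ι ℤ (vertex v) * ι ℤ (vertex v)) (ι ℤ (vertex v))
  | orth (v v' : V) (h : v ≠ v') : PathRel D (ι ℤ (vertex v) * ι ℤ (vertex v')) 0
  | sum_vertex : PathRel D (∑ v : V, ι ℤ (vertex v)) 1
  | head_arrow (a : A) : PathRel D (ι ℤ (vertex (D.hd a)) * ι ℤ (arrow a)) (ι ℤ (arrow a))
  | arrow_tail (a : A) : PathRel D (ι ℤ (arrow a) * ι ℤ (vertex (D.tl a))) (ι ℤ (arrow a))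
  | vertex_scalar (v : V) (l : K) :
      PathRel D (ι ℤ (vertex v) * ι ℤ (scalar l)) (ι ℤ (scalar l) * ι ℤ (vertex v))
  | arrow_scalar (a : A) (l : K) :
      PathRel D (ι ℤ (arrow a) * ι ℤ (scalar l)) (ι ℤ (scalar (D.σ a l)) * ι ℤ (arrow a))

end Generators

/-- The semilinear path algebra `K_σ Q`. -/
def PathAlgebra (D : SemilinearClannishData K V A) : Type _ := RingQuot (PathRel D)

instance (D : SemilinearClannishData K V A) : Ring D.PathAlgebra :=
  inferInstanceAs (Ring (RingQuot (PathRel D)))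

/-- The quotient map from the free ring on the generators. -/
def toPathAlgebra (D : SemilinearClannishData K V A) :
    FreeAlgebra ℤ (PathGen K V A) →+* D.PathAlgebra :=
  RingQuot.mkRingHom (PathRel D)

theorem toPathAlgebra_rel (D : SemilinearClannishData K V A) {x y : FreeAlgebra ℤ (PathGen K V A)}
    (h : PathRel D x y) : D.toPathAlgebra x = D.toPathAlgebra y :=
  RingQuot.mkRingHom_rel h

/-- The image of a generator in the path algebra. -/
def pathGen (D : SemilinearClannishData K V A) (x : PathGen K V A) : D.PathAlgebra :=
  D.toPathAlgebra (FreeAlgebra.ι ℤ x)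

/-- The relations of the semilinear clannish algebra: the zero-relations, and
`s² - β_s s + γ_s e_i` for each special loop `s`, where `i` is the vertex of `s`. -/
inductive ClannishRel (D : SemilinearClannishData K V A) : D.PathAlgebra → D.PathAlgebra → Prop
  | zero (p : List A) (hp : p ∈ D.Z) :
      ClannishRel D (p.map (fun a => D.pathGen (.arrow a))).prod 0
  | quadratic (s : D.Sp) :
      ClannishRel D
        (D.pathGen (.arrow s) ^ 2 - D.pathGen (.scalar (D.β s)) * D.pathGen (.arrow s)
          + D.pathGen (.scalar (D.γ s)) * D.pathGen (.vertex (D.hd s))) 0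

/-- The semilinear clannish algebra `R = K_σ Q / I`. -/
def Alg (D : SemilinearClannishData K V A) : Type _ := RingQuot (ClannishRel D)

instance (D : SemilinearClannishData K V A) : Ring D.Alg :=
  inferInstanceAs (Ring (RingQuot (ClannishRel D)))

/-- The quotient map from the semilinear path algebra. -/
def toAlg (D : SemilinearClannishData K V A) : D.PathAlgebra →+* D.Alg :=
  RingQuot.mkRingHom (ClannishRel D)

theorem toAlg_rel (D : SemilinearClannishData K V A) {x y : D.PathAlgebra}
    (h : ClannishRel D x y) : D.toAlg x = D.toAlg y :=
  RingQuot.mkRingHom_rel h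

/-- The image of a generator in `R`. -/
def gen (D : SemilinearClannishData K V A) (x : PathGen K V A) : D.Alg :=
  D.toAlg (D.pathGen x)

/-- The idempotent `e_v` in `R`. -/
def e (D : SemilinearClannishData K V A) (v : V) : D.Alg := D.gen (.vertex v)

/-- An arrow as an element of `R`. -/
def arr (D : SemilinearClannishData K V A) (a : A) : D.Alg := D.gen (.arrow a)

/-- The structure map `K → R`. -/
def scal (D : SemilinearClannishData K V A) : K →+* D.Alg where
  toFun l := D.gen (.scalar l)
  map_one' := by
    simp only [gen, pathGen, D.toPathAlgebra_rel (PathRel.scalar_one (D := D)), map_one]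
  map_mul' l m := by
    simp only [gen, pathGen, D.toPathAlgebra_rel (PathRel.scalar_mul (D := D) l m), map_mul]
  map_add' l m := by
    simp only [gen, pathGen, D.toPathAlgebra_rel (PathRel.scalar_add (D := D) l m), map_add]
  map_zero' := by
    have h := D.toPathAlgebra_rel (PathRel.scalar_add (D := D) 0 0)
    rw [add_zero, map_add] at h
    have h' : D.pathGen (.scalar 0) = 0 := by
      simpa only [pathGen, left_eq_add] using h
    simp only [gen, h', map_zero]

theorem arr_mul_scal (D : SemilinearClannishData K V A) (a : A) (l : K) :
    D.arr a * D.scal l = D.scal (D.σ a l) * D.arr a := by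
  have h := congrArg D.toAlg
    (D.toPathAlgebra_rel (PathRel.arrow_scalar (D := D) a l))
  simp only [map_mul] at h
  exact h

theorem e_mul_scal (D : SemilinearClannishData K V A) (v : V) (l : K) :
    D.e v * D.scal l = D.scal l * D.e v := by
  have h := congrArg D.toAlg
    (D.toPathAlgebra_rel (PathRel.vertex_scalar (D := D) v l))
  simp only [map_mul] at h
  exact h

end SemilinearClannishData

open SemilinearClannishData

/-! ## Letters, words and walks -/

/-- Letters of words: ordinary direct letters `a`, ordinary inverse letters `a⁻¹`, and
`*`-letters `s^*`. -/
inductive Letter {K V A : Type*} [DivisionRing K] (D : SemilinearClannishData K V A)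
  | dir (a : A) (h : a ∉ D.Sp)
  | inv (a : A) (h : a ∉ D.Sp)
  | star (s : A) (h : s ∈ D.Sp)

namespace Letter

variable {K V A : Type*} [DivisionRing K] {D : SemilinearClannishData K V A}

/-- The head of a letter. -/
def head : Letter D → V
  | dir a _ => D.hd a
  | inv a _ => D.tl a
  | star s _ => D.hd s

/-- The tail of a letter. -/
def tail : Letter D → V
  | dir a _ => D.tl a
  | inv a _ => D.hd a
  | star s _ => D.tl s

/-- The inverse of a letter. -/
def inverse : Letter D → Letter D
  | dir a h => inv a h
  | inv a h => dir a h
  | star s h => star s h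

theorem head_inverse (x : Letter D) : x.inverse.head = x.tail := by
  cases x with
  | dir a h => rfl
  | inv a h => rfl
  | star s h => exact D.special_loop s h

theorem tail_inverse (x : Letter D) : x.inverse.tail = x.head := by
  cases x with
  | dir a h => rfl
  | inv a h => rfl
  | star s h => exact (D.special_loop s h).symm

theorem inverse_inverse (x : Letter D) : x.inverse.inverse = x := by
  cases x <;> rfl

end Letter

/-- A choice of a sign `±1` for each letter, such that if distinct letters `x`, `y` have the same
head and sign then `{x, y} = {a⁻¹, b}` for some zero-relation `a b`. -/
structure SignChoice {K V A : Type*} [DivisionRing K] (D : SemilinearClannishData K V A) where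
  sgn : Letter D → ℤˣ
  compat : ∀ x y : Letter D, x ≠ y → x.head = y.head → sgn x = sgn y →
    ∃ (a b : A) (ha : a ∉ D.Sp) (hb : b ∉ D.Sp), [a, b] ∈ D.Z ∧
      ((x = .inv a ha ∧ y = .dir b hb) ∨ (x = .dir b hb ∧ y = .inv a ha))

/-- The allowed index sets `{0, …, n}`, `ℕ`, `-ℕ` and `ℤ`. -/
def IsIndexSet (I : Set ℤ) : Prop :=
  (∃ n : ℕ, I = Set.Icc 0 (n : ℤ)) ∨ I = Set.Ici 0 ∨ I = Set.Iic 0 ∨ I = Set.univ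

/-- The index set of `w_{>i}`. -/
theorem IsIndexSet.right {I : Set ℤ} (hI : IsIndexSet I) {i : ℤ} (hi : i ∈ I) :
    IsIndexSet {k | 0 ≤ k ∧ i + k ∈ I} := by
  rcases hI with ⟨n, rfl⟩ | rfl | rfl | rfl
  · simp only [Set.mem_Icc] at hi
    refine Or.inl ⟨(n - i).toNat, ?_⟩
    ext k
    simp only [Set.mem_Icc, Set.mem_ofPred_eq]
    omega
  · simp only [Set.mem_Ici] at hi
    refine Or.inr (Or.inl ?_)
    ext k
    simp only [Set.mem_Ici, Set.mem_ofPred_eq]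
    omega
  · simp only [Set.mem_Iic] at hi
    refine Or.inl ⟨(-i).toNat, ?_⟩
    ext k
    simp only [Set.mem_Icc, Set.mem_Iic, Set.mem_ofPred_eq]
    omega
  · refine Or.inr (Or.inl ?_)
    ext k
    simp

/-- The index set of `(w_{≤ i})⁻¹`. -/
theorem IsIndexSet.left {I : Set ℤ} (hI : IsIndexSet I) {i : ℤ} (hi : i ∈ I) :
    IsIndexSet {k | 0 ≤ k ∧ i - k ∈ I} := by
  rcases hI with ⟨n, rfl⟩ | rfl | rfl | rfl
  · simp only [Set.mem_Icc] at hi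
    refine Or.inl ⟨i.toNat, ?_⟩
    ext k
    simp only [Set.mem_Icc, Set.mem_ofPred_eq]
    omega
  · simp only [Set.mem_Ici] at hi
    refine Or.inl ⟨i.toNat, ?_⟩
    ext k
    simp only [Set.mem_Icc, Set.mem_Ici, Set.mem_ofPred_eq]
    omega
  · simp only [Set.mem_Iic] at hi
    refine Or.inr (Or.inl ?_)
    ext k
    simp only [Set.mem_Iic, Set.mem_Ici, Set.mem_ofPred_eq]
    omega
  · refine Or.inr (Or.inl ?_)
    ext k
    simp

/-- A word indexed by `I`: letters `w_i` for `i ∈ I' = {i ∈ I | i - 1 ∈ I}`, vertices `v_i(w)` for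
`i ∈ I`, and a sign.  Vertices and letters are functions on `ℤ` with the value `none` exactly
outside `I` and `I'`, so that two words are equal as terms if and only if they are equal as words. -/
@[ext] structure Word {K V A : Type*} [DivisionRing K] {D : SemilinearClannishData K V A}
    (S : SignChoice D) where
  I : Set ℤ
  isIndexSet : IsIndexSet I
  vertex : ℤ → Option V
  letter : ℤ → Option (Letter D)
  sign : ℤˣ
  vertex_isSome : ∀ i, (vertex i).isSome ↔ i ∈ I
  letter_isSome : ∀ i, (letter i).isSome ↔ i ∈ I ∧ i - 1 ∈ I
  head_letter : ∀ i x, letter i = some x → vertex (i - 1) = some x.head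
  tail_letter : ∀ i x, letter i = some x → vertex i = some x.tail
  opposite : ∀ i x y, letter i = some x → letter (i + 1) = some y →
    S.sgn x.inverse = - S.sgn y
  sign_one : ∀ x, letter 1 = some x → S.sgn x = sign
  sign_zero : ∀ x, letter 0 = some x → S.sgn x.inverse = - sign

namespace Word

variable {K V A : Type*} [DivisionRing K] {D : SemilinearClannishData K V A} {S : SignChoice D}

/-- The sign of the word `w_{>i}`: the sign of `w_{i+1}` if there is such a letter, otherwise minus
the sign of `w_i⁻¹` if there is such a letter, and otherwise (`w` is trivial) the sign of `w`. -/
def signAt (w : Word S) (i : ℤ) : ℤˣ :=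
  match w.letter (i + 1), w.letter i with
  | some y, _ => S.sgn y
  | none, some x => - S.sgn x.inverse
  | none, none => w.sign

theorem signAt_of_succ (w : Word S) {i : ℤ} {y : Letter D} (h : w.letter (i + 1) = some y) :
    w.signAt i = S.sgn y := by
  simp [signAt, h]

theorem sgn_inverse_eq (w : Word S) {i : ℤ} {x : Letter D} (h : w.letter i = some x) :
    S.sgn x.inverse = - w.signAt i := by
  unfold signAt
  rcases hy : w.letter (i + 1) with _ | y
  · simp [h]
  · simpa using w.opposite i x y h hy

/-- The word `w_{>i} = w_{i+1} w_{i+2} ⋯`. -/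
def right (w : Word S) (i : ℤ) (hi : i ∈ w.I) : Word S where
  I := {k | 0 ≤ k ∧ i + k ∈ w.I}
  isIndexSet := w.isIndexSet.right hi
  vertex k := if 0 ≤ k then w.vertex (i + k) else none
  letter k := if 0 < k then w.letter (i + k) else none
  sign := w.signAt i
  vertex_isSome k := by
    by_cases hk : 0 ≤ k <;> simp [hk, w.vertex_isSome]
  letter_isSome k := by
    by_cases hk : 0 < k
    · have h1 : 0 ≤ k := hk.le
      have h2 : 1 ≤ k := hk
      have h3 : i + k - 1 = i + (k - 1) := by ring
      simp [hk, h1, h2, h3, w.letter_isSome]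
    · have h2 : ¬ 1 ≤ k := hk
      simp [hk, h2]
  head_letter k x h := by
    by_cases hk : 0 < k
    · have h1 : 0 ≤ k - 1 := by omega
      have h3 : i + (k - 1) = i + k - 1 := by ring
      simp only [hk, if_true] at h
      simp only [h1, if_true, h3]
      exact w.head_letter _ _ h
    · simp [hk] at h
  tail_letter k x h := by
    by_cases hk : 0 < k
    · simp only [hk, if_true] at h
      simp only [hk.le, if_true]
      exact w.tail_letter _ _ h
    · simp [hk] at h
  opposite k x y hx hy := by
    by_cases hk : 0 < k
    · have h1 : 0 < k + 1 := by omega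
      simp only [hk, if_true] at hx
      simp only [h1, if_true, ← add_assoc] at hy
      exact w.opposite _ _ _ hx hy
    · simp [hk] at hx
  sign_one x h := by
    simp only [zero_lt_one, if_true] at h
    exact (w.signAt_of_succ h).symm
  sign_zero x h := by simp at h

/-- The word `(w_{≤ i})⁻¹ = w_i⁻¹ w_{i-1}⁻¹ ⋯`. -/
def leftInv (w : Word S) (i : ℤ) (hi : i ∈ w.I) : Word S where
  I := {k | 0 ≤ k ∧ i - k ∈ w.I}
  isIndexSet := w.isIndexSet.left hi
  vertex k := if 0 ≤ k then w.vertex (i - k) else none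
  letter k := if 0 < k then (w.letter (i + 1 - k)).map Letter.inverse else none
  sign := - w.signAt i
  vertex_isSome k := by
    by_cases hk : 0 ≤ k <;> simp [hk, w.vertex_isSome]
  letter_isSome k := by
    by_cases hk : 0 < k
    · have h1 : 0 ≤ k := hk.le
      have h2 : 1 ≤ k := hk
      have h3 : i + 1 - k - 1 = i - k := by ring
      have h4 : i + 1 - k = i - (k - 1) := by ring
      simp only [hk, if_true, Option.isSome_map, w.letter_isSome, h3, Set.mem_ofPred_eq, h1, h2,
        true_and, sub_nonneg]
      rw [h4, and_comm]
    · have h2 : ¬ 1 ≤ k := hk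
      simp [hk, h2]
  head_letter k x h := by
    by_cases hk : 0 < k
    · have h1 : 0 ≤ k - 1 := by omega
      have h3 : i - (k - 1) = i + 1 - k := by ring
      simp only [hk, if_true, Option.map_eq_some_iff] at h
      obtain ⟨y, hy, rfl⟩ := h
      simp only [h1, if_true, h3, Letter.head_inverse]
      exact w.tail_letter _ _ hy
    · simp [hk] at h
  tail_letter k x h := by
    by_cases hk : 0 < k
    · have h3 : i - k = i + 1 - k - 1 := by ring
      simp only [hk, if_true, Option.map_eq_some_iff] at h
      obtain ⟨y, hy, rfl⟩ := h
      simp only [hk.le, if_true, h3, Letter.tail_inverse]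
      exact w.head_letter _ _ hy
    · simp [hk] at h
  opposite k x y hx hy := by
    by_cases hk : 0 < k
    · have h1 : 0 < k + 1 := by omega
      simp only [hk, if_true, Option.map_eq_some_iff] at hx
      simp only [h1, if_true, Option.map_eq_some_iff] at hy
      obtain ⟨x', hx', rfl⟩ := hx
      obtain ⟨y', hy', rfl⟩ := hy
      have h3 : i + 1 - (k + 1) + 1 = i + 1 - k := by ring
      have h := w.opposite (i + 1 - (k + 1)) y' x' hy' (by rw [h3]; exact hx')
      rw [Letter.inverse_inverse, h, neg_neg]
    · simp [hk] at hx
  sign_one x h := by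
    simp only [zero_lt_one, if_true, Option.map_eq_some_iff, add_sub_cancel_right] at h
    obtain ⟨y, hy, rfl⟩ := h
    exact w.sgn_inverse_eq hy
  sign_zero x h := by simp at h

/-- `w` is indexed by `{0, …, n}` for some `n`. -/
def IsFinite (w : Word S) : Prop := ∃ n : ℕ, w.I = Set.Icc 0 (n : ℤ)

/-- `w` is `ℤ`-indexed and equal to its `n`th shift for some `n > 0`. -/
def IsPeriodic (w : Word S) : Prop :=
  w.I = Set.univ ∧ ∃ n : ℤ, 0 < n ∧ ∀ i, w.letter (n + i) = w.letter i

/-- There is no special loop `s` with `w s^*` a word: if `n` is the largest element of the index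
set, this means that no `*`-letter has head `v_n(w)` and the sign required for the next letter. -/
def RightEndAdmissible (w : Word S) : Prop :=
  ∀ n, IsGreatest w.I n → ∀ (s : A) (hs : s ∈ D.Sp),
    ¬ (w.vertex n = some (Letter.star s hs).head ∧ S.sgn (.star s hs) = w.signAt n)

/-- There is no special loop `s` with `w⁻¹ s^*` a word, that is, with `s^* w` a word. -/
def LeftEndAdmissible (w : Word S) : Prop :=
  ∀ n, IsLeast w.I n → ∀ (s : A) (hs : s ∈ D.Sp),
    ¬ (w.vertex n = some (Letter.star s hs).head ∧ S.sgn (.star s hs) = - w.signAt n)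

/-- `w` and `w⁻¹` are right-end-admissible. -/
def EndAdmissible (w : Word S) : Prop := w.RightEndAdmissible ∧ w.LeftEndAdmissible

/-- The order `u < w` on the set `H(ℓ, ε)` of right-end-admissible finite or `ℕ`-indexed words with
head `ℓ` and sign `ε`: the words agree up to some point, after which `u` has an ordinary direct
letter and `w` an ordinary inverse letter, or `u` has an ordinary direct letter and `w` ends, or
`u` ends and `w` has an ordinary inverse letter. -/
def Less (u w : Word S) : Prop :=
  ∃ n : ℕ, (∀ k : ℤ, 1 ≤ k → k ≤ n → u.letter k = w.letter k) ∧
    ((∃ y hy x hx, u.letter (n + 1) = some (.dir y hy) ∧ w.letter (n + 1) = some (.inv x hx)) ∨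
     (∃ y hy, u.letter (n + 1) = some (.dir y hy) ∧ w.letter (n + 1) = none) ∨
     (∃ x hx, u.letter (n + 1) = none ∧ w.letter (n + 1) = some (.inv x hx)))

/-- `i` is a symmetry for `w`: `w_i` is a `*`-letter and `(w_{≤ i-1})⁻¹ = w_{>i}`. -/
def IsSymmetry (w : Word S) (i : ℤ) : Prop :=
  ∃ (h : i ∈ w.I) (h' : i - 1 ∈ w.I) (s : A) (hs : s ∈ D.Sp), w.letter i = some (.star s hs) ∧
    w.leftInv (i - 1) h' = w.right i h

/-- `i` is naturally direct for `w`: `w_i` is a `*`-letter and `(w_{≤ i-1})⁻¹ > w_{>i}`. -/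
def IsNaturallyDirect (w : Word S) (i : ℤ) : Prop :=
  ∃ (h : i ∈ w.I) (h' : i - 1 ∈ w.I) (s : A) (hs : s ∈ D.Sp), w.letter i = some (.star s hs) ∧
    (w.right i h).Less (w.leftInv (i - 1) h')

end Word

/-- Letters of walks: direct letters `a` and inverse letters `a⁻¹`, for `a` any arrow. -/
inductive WalkLetter (A : Type*)
  | dir (a : A)
  | inv (a : A)

namespace WalkLetter

/-- The inverse of a letter. -/
def inverse {A : Type*} : WalkLetter A → WalkLetter A
  | dir a => inv a
  | inv a => dir a

variable {K V A : Type*} [DivisionRing K]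

open Classical in
/-- Replace `s` and `s⁻¹`, for `s` a special loop, by the `*`-letter `s^*`. -/
def star (D : SemilinearClannishData K V A) : WalkLetter A → Letter D
  | dir a => if h : a ∈ D.Sp then .star a h else .dir a h
  | inv a => if h : a ∈ D.Sp then .star a h else .inv a h

theorem star_inverse (D : SemilinearClannishData K V A) (x : WalkLetter A) :
    star D x.inverse = (star D x).inverse := by
  cases x <;> · simp only [inverse, star]; split_ifs <;> rfl

end WalkLetter

/-- A walk `C`: a word `C^*` with a letter of a walk over each of its letters. -/
structure Walk {K V A : Type*} [DivisionRing K] {D : SemilinearClannishData K V A}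
    (S : SignChoice D) where
  /-- the word `C^*` -/
  word : Word S
  letter : ℤ → Option (WalkLetter A)
  star_letter : ∀ i, (letter i).map (WalkLetter.star D) = word.letter i

namespace Walk

variable {K V A : Type*} [DivisionRing K] {D : SemilinearClannishData K V A} {S : SignChoice D}

/-- The walk `C_{>i}`. -/
def right (C : Walk S) (i : ℤ) (hi : i ∈ C.word.I) : Walk S where
  word := C.word.right i hi
  letter k := if 0 < k then C.letter (i + k) else none
  star_letter k := by
    by_cases hk : 0 < k <;> simp [hk, Word.right, C.star_letter]

/-- The walk `(C_{≤ i})⁻¹`. -/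
def leftInv (C : Walk S) (i : ℤ) (hi : i ∈ C.word.I) : Walk S where
  word := C.word.leftInv i hi
  letter k := if 0 < k then (C.letter (i + 1 - k)).map WalkLetter.inverse else none
  star_letter k := by
    by_cases hk : 0 < k
    · simp only [hk, if_true, Word.leftInv, ← C.star_letter, Option.map_map]
      congr 1
      funext x
      exact WalkLetter.star_inverse D x
    · simp [hk, Word.leftInv]

/-- There is an arrow `i → j` in the quiver `Q_C` which is sent to `a`: for `C_i = a` a direct
letter there is an arrow `i → i - 1`, and for `C_j = a⁻¹` an inverse letter there is an arrow
`j - 1 → j`. -/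
def Arrow (C : Walk S) (i j : ℤ) (a : A) : Prop :=
  (C.letter i = some (.dir a) ∧ j = i - 1) ∨ (C.letter j = some (.inv a) ∧ i = j - 1)

theorem Arrow.mem_left {C : Walk S} {i j : ℤ} {a : A} (h : C.Arrow i j a) : i ∈ C.word.I := by
  rcases h with ⟨h, rfl⟩ | ⟨h, rfl⟩
  · have := C.star_letter i
    rw [h] at this
    exact ((C.word.letter_isSome i).1 (by rw [← this]; rfl)).1
  · have := C.star_letter j
    rw [h] at this
    exact ((C.word.letter_isSome j).1 (by rw [← this]; rfl)).2

theorem Arrow.mem_right {C : Walk S} {i j : ℤ} {a : A} (h : C.Arrow i j a) : j ∈ C.word.I := by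
  rcases h with ⟨h, rfl⟩ | ⟨h, rfl⟩
  · have := C.star_letter i
    rw [h] at this
    exact ((C.word.letter_isSome i).1 (by rw [← this]; rfl)).2
  · have := C.star_letter j
    rw [h] at this
    exact ((C.word.letter_isSome j).1 (by rw [← this]; rfl)).1

/-- A choice of automorphisms `π_i` of `K` (only those with `i ∈ I` matter), such that
`π_j = σ_a π_i` for any arrow `i → j` in `Q_C` sent to `a`. -/
structure Twisting (C : Walk S) where
  π : ℤ → RingAut K
  compat : ∀ i j a, C.Arrow i j a → π j = D.σ a * π i

/-- Such a choice exists. -/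
theorem exists_twisting (C : Walk S) : ∃ T : C.Twisting, T.π 0 = 1 := by
  let g : ℤ → RingAut K := fun i => match C.letter i with
    | some (.dir a) => D.σ a
    | some (.inv a) => (D.σ a)⁻¹
    | none => 1
  let P : ℕ → RingAut K := fun n => Nat.rec 1 (fun k p => (g (k + 1))⁻¹ * p) n
  let N : ℕ → RingAut K := fun n => Nat.rec 1 (fun k p => g (-(k : ℤ)) * p) n
  let π : ℤ → RingAut K := fun i => if 0 ≤ i then P i.toNat else N (-i).toNat
  have hP : ∀ n : ℕ, P (n + 1) = (g (n + 1))⁻¹ * P n := fun n => rfl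
  have hN : ∀ n : ℕ, N (n + 1) = g (-(n : ℤ)) * N n := fun n => rfl
  have hπ : ∀ i, π (i - 1) = g i * π i := by
    intro i
    rcases lt_trichotomy i 0 with h | h | h
    · obtain ⟨n, rfl⟩ : ∃ n : ℕ, i = -(n : ℤ) := ⟨(-i).toNat, by omega⟩
      have h1 : ¬ (0 : ℤ) ≤ -(n : ℤ) - 1 := by omega
      have h2 : ¬ (0 : ℤ) ≤ -(n : ℤ) := by omega
      have h3 : (-(-(n : ℤ) - 1)).toNat = n + 1 := by omega
      have h4 : (- -(n : ℤ)).toNat = n := by omega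
      simp only [π, h1, h2, if_false, h3, h4, hN]
    · subst h
      have h1 : ¬ (0 : ℤ) ≤ 0 - 1 := by omega
      have h3 : (-((0 : ℤ) - 1)).toNat = 0 + 1 := by omega
      simp only [π, h1, if_false, h3, hN, le_refl, if_true]
      rfl
    · obtain ⟨n, rfl⟩ : ∃ n : ℕ, i = (n : ℤ) + 1 := ⟨(i - 1).toNat, by omega⟩
      have h1 : (0 : ℤ) ≤ (n : ℤ) + 1 - 1 := by omega
      have h2 : (0 : ℤ) ≤ (n : ℤ) + 1 := by omega
      have h3 : ((n : ℤ) + 1 - 1).toNat = n := by omega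
      have h4 : ((n : ℤ) + 1).toNat = n + 1 := by omega
      simp only [π, h1, h2, if_true, h3, h4, hP, mul_inv_cancel_left]
  refine ⟨⟨π, ?_⟩, rfl⟩
  rintro i j a (⟨h, rfl⟩ | ⟨h, rfl⟩)
  · rw [hπ i]
    simp [g, h]
  · rw [hπ j]
    simp [g, h]

end Walk

namespace Word

variable {K V A : Type*} [DivisionRing K] {D : SemilinearClannishData K V A} {S : SignChoice D}

open Classical in
/-- The walk `C` with `C^* = w` in which the letters `w_i = s^*` are replaced by `s` if `i` satisfies
`p`, and by `s⁻¹` otherwise. -/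
def orient (w : Word S) (p : ℤ → Prop) : Walk S where
  word := w
  letter i := (w.letter i).map fun
    | .dir a _ => .dir a
    | .inv a _ => .inv a
    | .star s _ => if p i then .dir s else .inv s
  star_letter i := by
    rw [Option.map_map]
    refine Eq.trans ?_ (Option.map_id_fun' ▸ rfl : (w.letter i).map (fun x => x) = w.letter i)
    congr 1
    funext x
    cases x with
    | dir a h => simp [WalkLetter.star, h]
    | inv a h => simp [WalkLetter.star, h]
    | star s h => by_cases hp : p i <;> simp [WalkLetter.star, h, hp]

/-- The special-direct walk `D_w`. -/
def specialDirect (w : Word S) : Walk S := w.orient fun _ => True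

/-- The special-inverse walk `D'_w`. -/
def specialInverse (w : Word S) : Walk S := w.orient fun _ => False

/-- The canonically associated walk `C_w`: the letter `s^*` at `i` becomes `s` if `i` is naturally
direct or if `i ≤ 0` is a symmetry, and it becomes `s⁻¹` otherwise, that is (the order being total),
if `i` is naturally inverse or if `i > 0` is a symmetry. -/
def canonical (w : Word S) : Walk S :=
  w.orient fun i => w.IsNaturallyDirect i ∨ (w.IsSymmetry i ∧ i ≤ 0)

end Word

/-! ## Submodules defined by walks -/

/-- An `R`-module `M`, considered as a `K`-module by restriction via `K → R`. -/
def Res {K V A : Type*} [DivisionRing K] (_D : SemilinearClannishData K V A) (M : Type*) :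
    Type _ := M

section Modules

variable {K V A : Type*} [DivisionRing K] [Fintype V] (D : SemilinearClannishData K V A)
  (M : Type*) [AddCommGroup M] [Module D.Alg M]

instance : AddCommGroup (Res D M) := inferInstanceAs (AddCommGroup M)

instance : Module D.Alg (Res D M) := inferInstanceAs (Module D.Alg M)

instance : Module K (Res D M) := Module.compHom M D.scal

variable {M}

theorem Res.smul_def (l : K) (m : Res D M) : l • m = D.scal l • m := rfl

theorem Res.arr_smul (a : A) (l : K) (m : Res D M) : D.arr a • l • m = D.σ a l • D.arr a • m := by
  simp only [Res.smul_def, smul_smul, D.arr_mul_scal]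

theorem Res.e_smul (v : V) (l : K) (m : Res D M) : D.e v • l • m = l • D.e v • m := by
  simp only [Res.smul_def, smul_smul, D.e_mul_scal]

variable (M)

/-- The `K`-submodule `e_v M`. -/
def vertexSpace (v : V) : Submodule K (Res D M) where
  carrier := {m | D.e v • m = m}
  zero_mem' := smul_zero _
  add_mem' {m n} hm hn := by
    simp only [Set.mem_ofPred_eq] at hm hn ⊢
    rw [smul_add, hm, hn]
  smul_mem' l m hm := by
    simp only [Set.mem_ofPred_eq] at hm ⊢
    rw [Res.e_smul, hm]

/-- The `K`-submodule `a e_{t(a)} M`. -/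
def arrowImage (a : A) : Submodule K (Res D M) where
  carrier := {m | ∃ n ∈ vertexSpace D M (D.tl a), m = D.arr a • n}
  zero_mem' := ⟨0, zero_mem _, (smul_zero _).symm⟩
  add_mem' := by
    rintro _ _ ⟨m, hm, rfl⟩ ⟨n, hn, rfl⟩
    exact ⟨m + n, add_mem hm hn, (smul_add _ _ _).symm⟩
  smul_mem' := by
    rintro l _ ⟨m, hm, rfl⟩
    refine ⟨(D.σ a).symm l • m, Submodule.smul_mem _ _ hm, ?_⟩
    rw [Res.arr_smul, RingEquiv.apply_symm_apply]

/-- The `K`-submodule `a⁻¹ 0` of `e_{t(a)} M`. -/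
def arrowKernel (a : A) : Submodule K (Res D M) where
  carrier := {m | m ∈ vertexSpace D M (D.tl a) ∧ D.arr a • m = 0}
  zero_mem' := ⟨zero_mem _, smul_zero _⟩
  add_mem' {m n} hm hn := ⟨add_mem hm.1 hn.1, by rw [smul_add, hm.2, hn.2, add_zero]⟩
  smul_mem' l m hm := ⟨Submodule.smul_mem _ _ hm.1, by rw [Res.arr_smul, hm.2, smul_zero]⟩

variable {D} (S : SignChoice D)

/-- `1_{ℓ,ε}^+(M)`: it is `a⁻¹ 0` if there is an arrow `a` with `1_{ℓ,ε} a⁻¹ = a⁻¹` a walk (by the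
condition on signs there is at most one such arrow), and otherwise `e_ℓ M`. -/
def trivialPlus (v : V) (ε : ℤˣ) : Submodule K (Res D M) :=
  vertexSpace D M v ⊓
    ⨅ (a : A) (_ : D.tl a = v ∧ S.sgn (WalkLetter.star D (.inv a)) = ε), arrowKernel D M a

/-- `1_{ℓ,ε}^-(M)`: it is `b e_{t(b)} M` if there is an arrow `b` with `1_{ℓ,ε} b = b` a walk (by the
condition on signs there is at most one such arrow), and otherwise `0`. -/
def trivialMinus (v : V) (ε : ℤˣ) : Submodule K (Res D M) :=
  ⨆ (b : A) (_ : D.hd b = v ∧ S.sgn (WalkLetter.star D (.dir b)) = ε), arrowImage D M b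

variable {M}

/-- The relation `m' ∈ x m` given by a letter `x`.  A direct letter `a` gives the graph of the
map `a : e_{t(a)} M → e_{h(a)} M` and `a⁻¹` gives the inverse relation. -/
def LetterRel (m' m : Res D M) : WalkLetter A → Prop
  | .dir a => m ∈ vertexSpace D M (D.tl a) ∧ m' = D.arr a • m
  | .inv a => m' ∈ vertexSpace D M (D.tl a) ∧ m = D.arr a • m'

variable {S}

namespace Walk

/-- Elements `m_i ∈ e_{v_i(C)} M` for `i ∈ I` with `m_{i-1} ∈ C_i m_i` for all `i ∈ I'`. -/
def IsChain (C : Walk S) (m : ℤ → Res D M) : Prop :=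
  (∀ i v, C.word.vertex i = some v → m i ∈ vertexSpace D M v) ∧
    ∀ i x, C.letter i = some x → LetterRel (m (i - 1)) (m i) x

variable (M) in
theorem IsChain.zero (C : Walk S) : C.IsChain (fun _ => (0 : Res D M)) := by
  refine ⟨fun i v _ => zero_mem _, fun i x _ => ?_⟩
  cases x <;> exact ⟨zero_mem _, (smul_zero _).symm⟩

theorem IsChain.add {C : Walk S} {m n : ℤ → Res D M} (hm : C.IsChain m) (hn : C.IsChain n) :
    C.IsChain (fun i => m i + n i) := by
  refine ⟨fun i v h => add_mem (hm.1 i v h) (hn.1 i v h), fun i x h => ?_⟩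
  have h1 := hm.2 i x h
  have h2 := hn.2 i x h
  cases x <;>
  · refine ⟨add_mem h1.1 h2.1, ?_⟩
    rw [smul_add, ← h1.2, ← h2.2]

theorem IsChain.smul {C : Walk S} {m : ℤ → Res D M} (hm : C.IsChain m) (T : C.Twisting) (l : K) :
    C.IsChain (fun i => T.π i l • m i) := by
  refine ⟨fun i v h => Submodule.smul_mem _ _ (hm.1 i v h), fun i x h => ?_⟩
  have h1 := hm.2 i x h
  cases x with
  | dir a =>
    refine ⟨Submodule.smul_mem _ _ h1.1, ?_⟩
    change T.π (i - 1) l • m (i - 1) = _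
    rw [Res.arr_smul, ← h1.2, T.compat i (i - 1) a (Or.inl ⟨h, rfl⟩)]
    rfl
  | inv a =>
    refine ⟨Submodule.smul_mem _ _ h1.1, ?_⟩
    change T.π i l • m i = _
    rw [Res.arr_smul, ← h1.2, T.compat (i - 1) i a (Or.inr ⟨h, rfl⟩)]
    rfl

variable (M)

/-- `C^+(M)` for a finite or `ℕ`-indexed walk `C`.  If `C` is finite of length `n`, then
`C a⁻¹ 0 = C (1_{ℓ,ε}^+(M))` or `C e_ℓ M = C (1_{ℓ,ε}^+(M))`, where `ℓ = v_n(C)` and `ε` is the sign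
that a letter following `C` must have. -/
def plus (C : Walk S) : Submodule K (Res D M) where
  carrier := {x | ∃ m : ℤ → Res D M, C.IsChain m ∧ m 0 = x ∧
    ∀ n v, IsGreatest C.word.I n → C.word.vertex n = some v →
      m n ∈ trivialPlus M S v (C.word.signAt n)}
  zero_mem' := ⟨_, IsChain.zero M C, rfl, fun _ _ _ _ => zero_mem _⟩
  add_mem' := by
    rintro _ _ ⟨m, hm, rfl, hm'⟩ ⟨n, hn, rfl, hn'⟩
    exact ⟨_, hm.add hn, rfl, fun k v h h' => add_mem (hm' k v h h') (hn' k v h h')⟩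
  smul_mem' := by
    rintro l _ ⟨m, hm, rfl, hm'⟩
    obtain ⟨T, hT⟩ := C.exists_twisting
    exact ⟨_, hm.smul T l, by simp [hT], fun k v h h' => Submodule.smul_mem _ _ (hm' k v h h')⟩

/-- `C^-(M)` for a finite or `ℕ`-indexed walk `C`.  If `C` is finite of length `n`, then
`C b e_{t(b)} M = C (1_{ℓ,ε}^-(M))` or `C 0 = C (1_{ℓ,ε}^-(M))`, where `ℓ = v_n(C)` and `ε` is the
sign that a letter following `C` must have. -/
def minus (C : Walk S) : Submodule K (Res D M) where
  carrier := {x | ∃ m : ℤ → Res D M, C.IsChain m ∧ m 0 = x ∧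
    (∀ n v, IsGreatest C.word.I n → C.word.vertex n = some v →
      m n ∈ trivialMinus M S v (C.word.signAt n)) ∧
    (¬ BddAbove C.word.I → ∃ n, ∀ i, n ≤ i → m i = 0)}
  zero_mem' := ⟨_, IsChain.zero M C, rfl, fun _ _ _ _ => zero_mem _, fun _ => ⟨0, fun _ _ => rfl⟩⟩
  add_mem' := by
    rintro _ _ ⟨m, hm, rfl, hm', hm''⟩ ⟨n, hn, rfl, hn', hn''⟩
    refine ⟨_, hm.add hn, rfl, fun k v h h' => add_mem (hm' k v h h') (hn' k v h h'), fun h => ?_⟩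
    obtain ⟨k, hk⟩ := hm'' h
    obtain ⟨k', hk'⟩ := hn'' h
    refine ⟨max k k', fun i hi => ?_⟩
    rw [hk i (le_trans (le_max_left _ _) hi), hk' i (le_trans (le_max_right _ _) hi), add_zero]
  smul_mem' := by
    rintro l _ ⟨m, hm, rfl, hm', hm''⟩
    obtain ⟨T, hT⟩ := C.exists_twisting
    refine ⟨_, hm.smul T l, by simp [hT],
      fun k v h h' => Submodule.smul_mem _ _ (hm' k v h h'), fun h => ?_⟩
    obtain ⟨k, hk⟩ := hm'' h
    exact ⟨k, fun i hi => by rw [hk i hi, smul_zero]⟩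

/-- `T_{C,i}(M) = (C_{>i})^+(M) ∩ ((C_{≤ i})⁻¹)^+(M)`. -/
def topAt (C : Walk S) (i : ℤ) (hi : i ∈ C.word.I) : Submodule K (Res D M) :=
  (C.right i hi).plus M ⊓ (C.leftInv i hi).plus M

/-- `B_{C,i}(M) = (C_{>i})^+(M) ∩ ((C_{≤ i})⁻¹)^-(M) + (C_{>i})^-(M) ∩ ((C_{≤ i})⁻¹)^+(M)`. -/
def botAt (C : Walk S) (i : ℤ) (hi : i ∈ C.word.I) : Submodule K (Res D M) :=
  ((C.right i hi).plus M ⊓ (C.leftInv i hi).minus M) ⊔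
    ((C.right i hi).minus M ⊓ (C.leftInv i hi).plus M)

end Walk

end Modules

/-- `C ∼_i C'` for walks with the same underlying word: the functors `T_{C,i}` and `T_{C',i}` are
equal, and so are `B_{C,i}` and `B_{C',i}`.  All four are subfunctors of the functor sending an
`R`-module to its underlying `K`-module. -/
def Walk.SimAt {K : Type u₁} {V : Type u₂} {A : Type u₃} [DivisionRing K]
    [Fintype V] {D : SemilinearClannishData K V A} {S : SignChoice D} (C C' : Walk S) (i : ℤ) :
    Prop :=
  C.word = C'.word ∧ ∃ (h : i ∈ C.word.I) (h' : i ∈ C'.word.I),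
    ∀ (M : Type v) [AddCommGroup M] [Module D.Alg M],
      C.topAt M i h = C'.topAt M i h' ∧ C.botAt M i h = C'.botAt M i h'

/-! ## The modules `M(C)` and the functors `F_C` -/

namespace Walk

variable {K V A : Type*} [DivisionRing K] [Fintype V] {D : SemilinearClannishData K V A}
  {S : SignChoice D}

/-- The defining relations of `M(C)`, as elements of the free module on the `b_i`. -/
inductive ModuleRel (C : Walk S) : (C.word.I →₀ D.Alg) → Prop
  | vertex (i : C.word.I) (v : V) (h : C.word.vertex i = some v) :
      ModuleRel C (Finsupp.single i (D.e v) - Finsupp.single i 1)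
  | arrow (i j : C.word.I) (a : A) (h : C.Arrow i j a) :
      ModuleRel C (Finsupp.single i (D.arr a) - Finsupp.single j 1)
  | zero (i : C.word.I) (a : A) (ha : a ∉ D.Sp) (hv : C.word.vertex i = some (D.tl a))
      (h : ¬ ∃ j, C.Arrow i j a) : ModuleRel C (Finsupp.single i (D.arr a))

/-- The submodule generated by the relations. -/
def relations (C : Walk S) : Submodule D.Alg (C.word.I →₀ D.Alg) :=
  Submodule.span D.Alg {x | ModuleRel C x}

/-- The `R`-module `M(C)`. -/
abbrev Mod (C : Walk S) : Type _ := (C.word.I →₀ D.Alg) ⧸ C.relations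

/-- The generators `b_i` of `M(C)`. -/
def b (C : Walk S) (i : C.word.I) : C.Mod := C.relations.mkQ (Finsupp.single i 1)

theorem mod_hom_ext {C : Walk S} {N : Type*} [AddCommGroup N] [Module D.Alg N]
    {f g : C.Mod →ₗ[D.Alg] N} (h : ∀ i, f (C.b i) = g (C.b i)) : f = g := by
  apply Submodule.linearMap_qext
  apply Finsupp.lhom_ext
  intro i r
  have : (Finsupp.single i r : C.word.I →₀ D.Alg) = r • Finsupp.single i 1 := by simp
  rw [this, map_smul, map_smul]
  exact congrArg (r • ·) (h i)

/-- The `R`-linear endomorphism of the free module with `b_i ↦ π_i(l) b_i`. -/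
def freeRightMul (C : Walk S) (T : C.Twisting) (l : K) :
    (C.word.I →₀ D.Alg) →ₗ[D.Alg] (C.word.I →₀ D.Alg) :=
  Finsupp.linearCombination D.Alg fun i : C.word.I => Finsupp.single i (D.scal (T.π i l))

theorem freeRightMul_single (C : Walk S) (T : C.Twisting) (l : K) (i : C.word.I) (r : D.Alg) :
    C.freeRightMul T l (Finsupp.single i r) = Finsupp.single i (r * D.scal (T.π i l)) := by
  simp [freeRightMul]

theorem freeRightMul_mem (C : Walk S) (T : C.Twisting) (l : K) :
    C.relations ≤ C.relations.comap (C.freeRightMul T l) := by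
  refine Submodule.span_le.2 ?_
  intro x hx
  have key : ∃ k : K, C.freeRightMul T l x = D.scal k • x := by
    cases hx with
    | vertex i v h =>
      refine ⟨T.π i l, ?_⟩
      simp [freeRightMul_single, smul_sub, D.e_mul_scal]
    | arrow i j a h =>
      refine ⟨T.π j l, ?_⟩
      simp [freeRightMul_single, smul_sub, D.arr_mul_scal, T.compat i j a h]
    | zero i a ha hv h =>
      refine ⟨D.σ a (T.π i l), ?_⟩
      simp [freeRightMul_single, D.arr_mul_scal]
  obtain ⟨k, hk⟩ := key
  simp only [Submodule.comap_coe, Set.mem_preimage, SetLike.mem_coe]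
  rw [hk]
  exact Submodule.smul_mem _ _ (Submodule.subset_span hx)

/-- The right action of `l ∈ K` on `M(C)`, given by `b_i l = π_i(l) b_i`. -/
def rightMul (C : Walk S) (T : C.Twisting) (l : K) : C.Mod →ₗ[D.Alg] C.Mod :=
  Submodule.mapQ _ _ (C.freeRightMul T l) (C.freeRightMul_mem T l)

theorem rightMul_b (C : Walk S) (T : C.Twisting) (l : K) (i : C.word.I) :
    C.rightMul T l (C.b i) = D.scal (T.π i l) • C.b i := by
  have h : C.rightMul T l (C.b i) =
      C.relations.mkQ (C.freeRightMul T l (Finsupp.single i 1)) := rfl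
  rw [h, freeRightMul_single, b, ← map_smul]
  simp

namespace Twisting

variable {C : Walk S} (T : C.Twisting)

/-- `T_C(M) = Hom_R(M(C), M)`. -/
def Top (_T : C.Twisting) (M : Type*) [AddCommGroup M] [Module D.Alg M] : Type _ :=
  C.Mod →ₗ[D.Alg] M

variable (M : Type*) [AddCommGroup M] [Module D.Alg M]

instance : AddCommGroup (T.Top M) := inferInstanceAs (AddCommGroup (C.Mod →ₗ[D.Alg] M))

/-- `Hom_R(M(C), M)` is a left `K`-module by `(l θ)(x) = θ(x l)`. -/
instance : Module K (T.Top M) where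
  smul l θ := LinearMap.comp (show C.Mod →ₗ[D.Alg] M from θ) (C.rightMul T l)
  one_smul θ := by
    apply mod_hom_ext
    intro i
    change (show C.Mod →ₗ[D.Alg] M from θ) (C.rightMul T 1 (C.b i)) = _
    rw [rightMul_b, map_one, map_one, one_smul]
  mul_smul l m θ := by
    apply mod_hom_ext
    intro i
    change (show C.Mod →ₗ[D.Alg] M from θ) (C.rightMul T (l * m) (C.b i)) =
      (show C.Mod →ₗ[D.Alg] M from θ) (C.rightMul T m (C.rightMul T l (C.b i)))
    rw [rightMul_b, rightMul_b, map_smul (C.rightMul T m), rightMul_b, smul_smul, map_mul, map_mul]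
  smul_zero l := by
    apply mod_hom_ext
    intro i
    rfl
  smul_add l θ θ' := by
    apply mod_hom_ext
    intro i
    rfl
  add_smul l m θ := by
    apply mod_hom_ext
    intro i
    change (show C.Mod →ₗ[D.Alg] M from θ) (C.rightMul T (l + m) (C.b i)) =
      (show C.Mod →ₗ[D.Alg] M from θ) (C.rightMul T l (C.b i)) +
      (show C.Mod →ₗ[D.Alg] M from θ) (C.rightMul T m (C.b i))
    rw [rightMul_b, rightMul_b, rightMul_b, map_add, map_add, add_smul, map_add]
  zero_smul θ := by
    apply mod_hom_ext
    intro i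
    change (show C.Mod →ₗ[D.Alg] M from θ) (C.rightMul T 0 (C.b i)) = 0
    rw [rightMul_b, map_zero, map_zero, zero_smul, map_zero]

variable {M}

/-- The element `θ(b_i)` of `M`, for `θ ∈ Hom_R(M(C), M)`. -/
def ev (θ : T.Top M) (i : C.word.I) : Res D M := (show C.Mod →ₗ[D.Alg] M from θ) (C.b i)

theorem ev_add (θ θ' : T.Top M) (i : C.word.I) : T.ev (θ + θ') i = T.ev θ i + T.ev θ' i := rfl

theorem ev_zero (i : C.word.I) : T.ev (0 : T.Top M) i = 0 := rfl

theorem ev_smul (l : K) (θ : T.Top M) (i : C.word.I) : T.ev (l • θ) i = T.π i l • T.ev θ i := by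
  change (show C.Mod →ₗ[D.Alg] M from θ) (C.rightMul T l (C.b i)) = _
  rw [rightMul_b, map_smul]
  rfl

variable (M)

/-- `B_C^+(M)`: the condition is `θ(b_i) = 0` for `i ≪ 0` if `I` is not bounded below, and
`θ(b_0) ∈ 1_{ℓ,-ε}^-(M)` if `C` has head `ℓ` and sign `ε`. -/
def botPlus : Submodule K (T.Top M) where
  carrier := {θ | (¬ BddBelow C.word.I → ∃ n : ℤ, ∀ i : C.word.I, i.1 ≤ n → T.ev θ i = 0) ∧
    ∀ (h : IsLeast C.word.I 0) (v : V), C.word.vertex 0 = some v →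
      T.ev θ ⟨0, h.1⟩ ∈ trivialMinus M S v (- C.word.sign)}
  zero_mem' := ⟨fun _ => ⟨0, fun _ _ => rfl⟩, fun _ _ _ => zero_mem _⟩
  add_mem' := by
    rintro θ θ' ⟨h1, h2⟩ ⟨h1', h2'⟩
    refine ⟨fun h => ?_, fun h v hv => ?_⟩
    · obtain ⟨n, hn⟩ := h1 h
      obtain ⟨n', hn'⟩ := h1' h
      refine ⟨min n n', fun i hi => ?_⟩
      rw [ev_add, hn i (hi.trans (min_le_left _ _)), hn' i (hi.trans (min_le_right _ _)), add_zero]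
    · rw [ev_add]
      exact add_mem (h2 h v hv) (h2' h v hv)
  smul_mem' := by
    rintro l θ ⟨h1, h2⟩
    refine ⟨fun h => ?_, fun h v hv => ?_⟩
    · obtain ⟨n, hn⟩ := h1 h
      refine ⟨n, fun i hi => ?_⟩
      rw [ev_smul, hn i hi, smul_zero]
    · rw [ev_smul]
      exact Submodule.smul_mem _ _ (h2 h v hv)

/-- `B_C^-(M)`: the condition is `θ(b_i) = 0` for `i ≫ 0` if `I` is not bounded above, and
`θ(b_n) ∈ 1_{ℓ,-ε}^-(M)` if `n = max I` and `C⁻¹` has head `ℓ = v_n(C)` and sign `ε`.  In the last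
case `-ε` is the sign that a letter following `C` must have. -/
def botMinus : Submodule K (T.Top M) where
  carrier := {θ | (¬ BddAbove C.word.I → ∃ n : ℤ, ∀ i : C.word.I, n ≤ i.1 → T.ev θ i = 0) ∧
    ∀ (n : ℤ) (h : IsGreatest C.word.I n) (v : V), C.word.vertex n = some v →
      T.ev θ ⟨n, h.1⟩ ∈ trivialMinus M S v (C.word.signAt n)}
  zero_mem' := ⟨fun _ => ⟨0, fun _ _ => rfl⟩, fun _ _ _ _ => zero_mem _⟩
  add_mem' := by
    rintro θ θ' ⟨h1, h2⟩ ⟨h1', h2'⟩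
    refine ⟨fun h => ?_, fun k h v hv => ?_⟩
    · obtain ⟨n, hn⟩ := h1 h
      obtain ⟨n', hn'⟩ := h1' h
      refine ⟨max n n', fun i hi => ?_⟩
      rw [ev_add, hn i ((le_max_left _ _).trans hi), hn' i ((le_max_right _ _).trans hi), add_zero]
    · rw [ev_add]
      exact add_mem (h2 k h v hv) (h2' k h v hv)
  smul_mem' := by
    rintro l θ ⟨h1, h2⟩
    refine ⟨fun h => ?_, fun k h v hv => ?_⟩
    · obtain ⟨n, hn⟩ := h1 h
      refine ⟨n, fun i hi => ?_⟩
      rw [ev_smul, hn i hi, smul_zero]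
    · rw [ev_smul]
      exact Submodule.smul_mem _ _ (h2 k h v hv)

/-- `B_C(M) = B_C^+(M) + B_C^-(M)`. -/
def bot : Submodule K (T.Top M) := T.botPlus M ⊔ T.botMinus M

variable {M} {N : Type*} [AddCommGroup N] [Module D.Alg N]

/-- The map `T_C(M) → T_C(N)` given by composition with `f : M → N`. -/
def topMap (f : M →ₗ[D.Alg] N) : T.Top M →ₗ[K] T.Top N where
  toFun θ := f.comp (show C.Mod →ₗ[D.Alg] M from θ)
  map_add' _ _ := LinearMap.comp_add _ _ _
  map_smul' _ _ := rfl

theorem ev_topMap (f : M →ₗ[D.Alg] N) (θ : T.Top M) (i : C.word.I) :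
    T.ev (T.topMap f θ) i = f (T.ev θ i) := rfl

theorem map_mem_trivialMinus (f : M →ₗ[D.Alg] N) (v : V) (ε : ℤˣ) (m : Res D M)
    (hm : m ∈ trivialMinus M S v ε) :
    (show Res D N from f m) ∈ trivialMinus N S v ε := by
  let g : Res D M →ₗ[K] Res D N :=
    { toFun := f
      map_add' := fun x y => f.map_add x y
      map_smul' := fun l x => f.map_smul (D.scal l) x }
  have h : trivialMinus M S v ε ≤ (trivialMinus N S v ε).comap g := by
    refine iSup₂_le fun a ha => ?_
    rintro _ ⟨n, hn, rfl⟩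
    refine Submodule.mem_iSup_of_mem a (Submodule.mem_iSup_of_mem ha ⟨g n, ?_, ?_⟩)
    · have hn' : D.e (D.tl a) • n = n := hn
      exact (f.map_smul (D.e (D.tl a)) n).symm.trans (congrArg f hn')
    · exact f.map_smul (D.arr a) n
  exact h hm

theorem bot_le_comap (f : M →ₗ[D.Alg] N) : T.bot M ≤ (T.bot N).comap (T.topMap f) := by
  refine sup_le ?_ ?_
  · rintro θ ⟨h1, h2⟩
    refine Submodule.mem_sup_left ⟨fun h => ?_, fun h v hv => ?_⟩
    · obtain ⟨n, hn⟩ := h1 h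
      exact ⟨n, fun i hi => by rw [ev_topMap, hn i hi]; exact map_zero f⟩
    · exact map_mem_trivialMinus f _ _ _ (h2 h v hv)
  · rintro θ ⟨h1, h2⟩
    refine Submodule.mem_sup_right ⟨fun h => ?_, fun k h v hv => ?_⟩
    · obtain ⟨n, hn⟩ := h1 h
      exact ⟨n, fun i hi => by rw [ev_topMap, hn i hi]; exact map_zero f⟩
    · exact map_mem_trivialMinus f _ _ _ (h2 k h v hv)

end Twisting

end Walk

/-- The functor `F_C = T_C / B_C` from left `R`-modules to left `K`-modules. -/
def Walk.Twisting.functor {K : Type u₁} {V : Type u₂} {A : Type u₃}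
    [DivisionRing K] [Fintype V] {D : SemilinearClannishData K V A} {S : SignChoice D}
    {C : Walk S} (T : C.Twisting) :
    ModuleCat.{v} D.Alg ⥤ ModuleCat.{max u₁ u₂ u₃ v} K where
  obj M := ModuleCat.of K (T.Top M ⧸ T.bot M)
  map f := ModuleCat.ofHom (Submodule.mapQ _ _ (T.topMap f.hom) (T.bot_le_comap f.hom))
  map_id M := by
    ext θ
    rfl
  map_comp f g := by
    ext θ
    rfl

end

/-! A homomorphism out of M(C) is a family of elements m_i linked by the letters of C (a chain) and
satisfying the conditions 1^+ at the ends; end-admissibility makes the end conditions fit the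
remaining relations of M(C) (`Word.family_good`, `Word.exists_of_good`). A chain that vanishes at j
can be cut there. Hence, for every j in I, F_C(M) is the set of values at j of chains
(`Strand.topSet`) modulo the sums of values of chains that die out on the left or on the right
(`Strand.botSet`), with K acting through π_j (`Word.mem_bot_iff`). So it is enough to compare these
value sets for different orientations of the *-letters, possibly at different indices: `Strand.Sim`
gives an isomorphism up to twist (`Strand.Sim.isoUpToTwist`).

The local reason is that s² = β s - γ with γ ≠ 0. If x and y are related by s or by s⁻¹, then x is
related by the opposite letter to c y + d x with c ≠ 0 (`LetterRel.switch`). Reorienting the letter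
at k therefore replaces m_i by c_i m_i + d_i q_i for i ≥ k, where q is a chain along the same
letters with q_k = m_{k-1} (`Strand.Chain.flip`). Such a q is found in the spans of those entries of
m whose two-sided word, read in either direction, is bounded by the two-sided word at the position
reached (`Strand.flow`). An entry with a strictly smaller word is killed by the first inverse letter
that tells the words apart. At a *-letter with the wrong orientation the entry is switched and also
turns around, and the bounds survive because the orientation is compatible with the order
(`Strand.Pair.step`).

To reach the natural orientation, words are compared up to a depth P. At depth 0 every *-letter is
direct; at depth ⊤ the orientation is the natural one with symmetries direct. From P to P + 1 only
those letters are flipped whose two sides agree up to P and then differ, the left side being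
smaller. The corrections stop at points where no strictly bounded word exists (`Strand.Halt`). These
points cut the word into blocks, which are treated outwards from j, so that the chains converge
pointwise (`Strand.moves_flipOn`). In a finite word the halting points lie outside the index set; in
a periodic one a minimality argument gives one of them, and its translates give the others
(`Strand.exists_halt`). Only finitely many depths matter (`Strand.Regular.exists_depth`). Thus D_w
gives the same functor, up to twist, as the natural orientation with direct symmetries
(`Strand.natOrient_rel`) and, by reversal, D'_w gives the same as the one with inverse symmetries.

Without symmetries these two natural orientations coincide. If there is a symmetry, reflection in it
exchanges D_w and D'_w (`Strand.SymmAt.sim`). The canonical walk differs from the natural one with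
inverse symmetries only at the symmetries i ≤ 0. These are changed one at a time, with the reflected
chain as the correction q; seen from j ≥ 0 the correction lies in the part of `Strand.botSet` that
dies out on the right, so the value sets do not change (`Strand.sim_tieOrient`). Finally one index
must serve for all depths at once: the right end of a finite word, or in a periodic word a *-letter
that is extremal to a large depth, in w or in its inverse. Which of the two occurs decides between
D'_w and D_w (`Strand.exists_sim_canonical`). -/

/-! ## Truncated lexicographic comparison of sequences of letters -/

section Lex

variable {K V A : Type*} [DivisionRing K] {D : SemilinearClannishData K V A}

/-- The rank of a letter (or of the end of a word): ordinary direct letters are smallest and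
ordinary inverse letters are largest. -/
def Letter.rank : Option (Letter D) → ℕ
  | some (.dir _ _) => 0
  | some (.inv _ _) => 2
  | some (.star _ _) => 1
  | none => 1

/-- `f` is smaller than `g` at the first place where they differ, which is before `P`. -/
def LexLT (P : ℕ∞) (f g : ℕ → Option (Letter D)) : Prop :=
  ∃ n : ℕ, (n : ℕ∞) < P ∧ (∀ k < n, f k = g k) ∧ Letter.rank (f n) < Letter.rank (g n)

/-- `f` and `g` agree before `P`. -/
def EqUpTo (P : ℕ∞) (f g : ℕ → Option (Letter D)) : Prop :=
  ∀ k : ℕ, (k : ℕ∞) < P → f k = g k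

/-- The strict order truncated at `P`, or the non-strict one if `b` holds. -/
def LexRel (b : Prop) (P : ℕ∞) (f g : ℕ → Option (Letter D)) : Prop :=
  LexLT P f g ∨ (b ∧ EqUpTo P f g)

variable {b : Prop} {P Q : ℕ∞} {f g h : ℕ → Option (Letter D)}

theorem EqUpTo.refl (P : ℕ∞) (f : ℕ → Option (Letter D)) : EqUpTo P f f := fun _ _ => rfl

theorem EqUpTo.symm (h : EqUpTo P f g) : EqUpTo P g f := fun k hk => (h k hk).symm

theorem EqUpTo.trans (h₁ : EqUpTo P f g) (h₂ : EqUpTo P g h) : EqUpTo P f h :=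
  fun k hk => (h₁ k hk).trans (h₂ k hk)

theorem EqUpTo.mono (hPQ : P ≤ Q) (h : EqUpTo Q f g) : EqUpTo P f g :=
  fun k hk => h k (hk.trans_le hPQ)

theorem LexLT.mono (hPQ : P ≤ Q) (h : LexLT P f g) : LexLT Q f g := by
  obtain ⟨n, hn, h⟩ := h
  exact ⟨n, hn.trans_le hPQ, h⟩

theorem EqUpTo.trans_lt (h₁ : EqUpTo P f g) (h₂ : LexLT P g h) : LexLT P f h := by
  obtain ⟨n, hn, h, h'⟩ := h₂
  exact ⟨n, hn, fun k hk => (h₁ k (lt_trans (by exact_mod_cast hk) hn)).trans (h k hk),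
    by rwa [h₁ n hn]⟩

theorem LexLT.trans_eq (h₁ : LexLT P f g) (h₂ : EqUpTo P g h) : LexLT P f h := by
  obtain ⟨n, hn, h, h'⟩ := h₁
  exact ⟨n, hn, fun k hk => (h k hk).trans (h₂ k (lt_trans (by exact_mod_cast hk) hn)),
    by rwa [← h₂ n hn]⟩

theorem LexLT.trans (h₁ : LexLT P f g) (h₂ : LexLT P g h) : LexLT P f h := by
  obtain ⟨n, hn, e, r⟩ := h₁
  obtain ⟨n', hn', e', r'⟩ := h₂
  rcases lt_trichotomy n n' with hlt | rfl | hlt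
  · exact ⟨n, hn, fun k hk => (e k hk).trans (e' k (hk.trans hlt)), by rwa [← e' n hlt]⟩
  · exact ⟨n, hn, fun k hk => (e k hk).trans (e' k hk), r.trans r'⟩
  · exact ⟨n', hn', fun k hk => (e k (hk.trans hlt)).trans (e' k hk), by rwa [e n' hlt]⟩

theorem LexLT.irrefl : ¬ LexLT P f f := fun ⟨_, _, _, h⟩ => lt_irrefl _ h

theorem LexLT.not_eq (h : LexLT P f g) : ¬ EqUpTo P f g := by
  rintro h'
  exact LexLT.irrefl (h.trans_eq h'.symm)

theorem LexLT.not_symm (h : LexLT P f g) : ¬ LexLT P g f := fun h' => LexLT.irrefl (h.trans h')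

theorem LexLT.rel (h : LexLT P f g) : LexRel b P f g := Or.inl h

theorem EqUpTo.le (h : EqUpTo P f g) : LexRel True P f g := Or.inr ⟨trivial, h⟩

theorem LexRel.le (h : LexRel b P f g) : LexRel True P f g := h.imp id fun h => ⟨trivial, h.2⟩

theorem LexRel.trans_le (h₁ : LexRel b P f g) (h₂ : LexRel True P g h) : LexRel b P f h := by
  rcases h₁ with h₁ | ⟨hb, h₁⟩ <;> rcases h₂ with h₂ | ⟨-, h₂⟩
  · exact Or.inl (h₁.trans h₂)
  · exact Or.inl (h₁.trans_eq h₂)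
  · exact Or.inl (h₁.trans_lt h₂)
  · exact Or.inr ⟨hb, h₁.trans h₂⟩

theorem LexRel.le_trans (h₁ : LexRel True P f g) (h₂ : LexRel b P g h) : LexRel b P f h := by
  rcases h₁ with h₁ | ⟨-, h₁⟩ <;> rcases h₂ with h₂ | ⟨hb, h₂⟩
  · exact Or.inl (h₁.trans h₂)
  · exact Or.inl (h₁.trans_eq h₂)
  · exact Or.inl (h₁.trans_lt h₂)
  · exact Or.inr ⟨hb, h₁.trans h₂⟩

theorem LexRel.mono_le (hPQ : P ≤ Q) (h : LexRel True Q f g) : LexRel True P f g := by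
  rcases h with ⟨n, hn, e, r⟩ | ⟨-, h⟩
  · by_cases hP : (n : ℕ∞) < P
    · exact Or.inl ⟨n, hP, e, r⟩
    · refine Or.inr ⟨trivial, fun k hk => e k ?_⟩
      exact_mod_cast hk.trans_le (not_lt.1 hP)
  · exact Or.inr ⟨trivial, h.mono hPQ⟩

theorem EqUpTo.succ_iff :
    EqUpTo (P + 1) f g ↔ f 0 = g 0 ∧ EqUpTo P (fun k => f (k + 1)) (fun k => g (k + 1)) := by
  constructor
  · refine fun h => ⟨h 0 (by simp), fun k hk => h (k + 1) ?_⟩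
    push_cast
    exact (ENat.add_lt_add_iff_right (by simp)).2 hk
  · rintro ⟨h0, h⟩ (_ | k) hk
    · exact h0
    · refine h k ?_
      push_cast at hk
      exact (ENat.add_lt_add_iff_right (by simp)).1 hk

theorem LexLT.succ_iff :
    LexLT (P + 1) f g ↔ Letter.rank (f 0) < Letter.rank (g 0) ∨
      (f 0 = g 0 ∧ LexLT P (fun k => f (k + 1)) (fun k => g (k + 1))) := by
  constructor
  · rintro ⟨_ | n, hn, e, r⟩
    · exact Or.inl r
    · refine Or.inr ⟨e 0 (Nat.succ_pos _), n, ?_, fun k hk => e (k + 1) (by omega), r⟩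
      push_cast at hn
      exact (ENat.add_lt_add_iff_right (by simp)).1 hn
  · rintro (h | ⟨h0, n, hn, e, r⟩)
    · exact ⟨0, by simp, fun k hk => absurd hk (Nat.not_lt_zero _), h⟩
    · refine ⟨n + 1, ?_, ?_, r⟩
      · push_cast
        exact (ENat.add_lt_add_iff_right (by simp)).2 hn
      · rintro (_ | k) hk
        · exact h0
        · exact e k (by omega)

theorem LexRel.succ_iff :
    LexRel b (P + 1) f g ↔ Letter.rank (f 0) < Letter.rank (g 0) ∨
      (f 0 = g 0 ∧ LexRel b P (fun k => f (k + 1)) (fun k => g (k + 1))) := by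
  unfold LexRel
  rw [EqUpTo.succ_iff, LexLT.succ_iff]
  tauto

/-- A strict inequality decided before P stays decided at a greater depth, but agreement up to P
says nothing about the next letter. This is why non-strict bounds are carried along only for P = ⊤.
-/
theorem LexRel.mono_succ (hb : b → P = ⊤) (h : LexRel b P f g) : LexRel b (P + 1) f g := by
  rcases h with h | ⟨h', h⟩
  · exact Or.inl (h.mono le_self_add)
  · have hP := hb h'
    subst hP
    exact Or.inr ⟨h', h⟩

/-- The ranks of the first `N` letters, read as the digits of a natural number in base `3`. -/
def lexCode : ℕ → (ℕ → Option (Letter D)) → ℕ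
  | 0, _ => 0
  | N + 1, f => Letter.rank (f 0) * 3 ^ N + lexCode N (fun k => f (k + 1))

theorem Letter.rank_le (x : Option (Letter D)) : Letter.rank x ≤ 2 := by
  rcases x with _ | _ | _ | _ <;> simp [Letter.rank]

theorem lexCode_lt (N : ℕ) (f : ℕ → Option (Letter D)) : lexCode N f < 3 ^ N := by
  induction N generalizing f with
  | zero => simp [lexCode]
  | succ N ih =>
    have h1 := ih (fun k => f (k + 1))
    have h2 := Nat.mul_le_mul_right (3 ^ N) (Letter.rank_le (f 0))
    simp only [lexCode, pow_succ]
    omega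

theorem EqUpTo.lexCode_eq {N : ℕ} (h : EqUpTo (N : ℕ∞) f g) : lexCode N f = lexCode N g := by
  induction N generalizing f g with
  | zero => rfl
  | succ N ih =>
    push_cast at h
    rw [EqUpTo.succ_iff] at h
    simp only [lexCode, h.1, ih h.2]

/-- Natural numbers as codes make it possible to choose minimal truncated words among infinitely
many positions. -/
theorem LexLT.lexCode_lt {N : ℕ} (h : LexLT (N : ℕ∞) f g) : lexCode N f < lexCode N g := by
  induction N generalizing f g with
  | zero => obtain ⟨n, hn, -⟩ := h; simp at hn
  | succ N ih =>
    push_cast at h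
    rw [LexLT.succ_iff] at h
    simp only [lexCode]
    rcases h with h | ⟨h0, h⟩
    · have h1 := _root_.lexCode_lt N (fun k => f (k + 1))
      have h2 := Nat.mul_le_mul_right (3 ^ N) (Nat.succ_le_of_lt h)
      rw [Nat.succ_mul] at h2
      omega
    · rw [h0]
      exact Nat.add_lt_add_left (ih h) _

theorem LexRel.lexCode_le {N : ℕ} (h : LexRel b (N : ℕ∞) f g) : lexCode N f ≤ lexCode N g := by
  rcases h with h | h
  · exact h.lexCode_lt.le
  · exact h.2.lexCode_eq.le

end Lex

/-! ## Words with an arbitrary index set -/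

/-- A word without normalization of its index set: `sgn i` is the sign that a letter following
the vertex at `i` must have. -/
@[ext] structure Strand {K V A : Type*} [DivisionRing K] {D : SemilinearClannishData K V A}
    (S : SignChoice D) where
  vertex : ℤ → Option V
  letter : ℤ → Option (Letter D)
  sgn : ℤ → ℤˣ
  head_letter : ∀ i x, letter i = some x → vertex (i - 1) = some x.head
  tail_letter : ∀ i x, letter i = some x → vertex i = some x.tail
  sgn_letter : ∀ i x, letter (i + 1) = some x → S.sgn x = sgn i
  sgn_inverse : ∀ i x, letter i = some x → S.sgn x.inverse = - sgn i
  right_none : ∀ i v, vertex i = some v → letter (i + 1) = none → ∀ j, i < j → letter j = none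
  left_none : ∀ i v, vertex i = some v → letter i = none → ∀ j, j ≤ i → letter j = none

namespace Strand

variable {K V A : Type*} [DivisionRing K] {D : SemilinearClannishData K V A} {S : SignChoice D}

/-- The inverse word, reflected at `0`. -/
def rev (w : Strand S) : Strand S where
  vertex i := w.vertex (-i)
  letter i := (w.letter (1 - i)).map Letter.inverse
  sgn i := - w.sgn (-i)
  head_letter i x h := by
    obtain ⟨y, hy, rfl⟩ := Option.map_eq_some_iff.1 h
    rw [Letter.head_inverse, ← w.tail_letter _ _ hy]
    congr 1; ring
  tail_letter i x h := by
    obtain ⟨y, hy, rfl⟩ := Option.map_eq_some_iff.1 h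
    rw [Letter.tail_inverse, ← w.head_letter _ _ hy]
    congr 1; ring
  sgn_letter i x h := by
    obtain ⟨y, hy, rfl⟩ := Option.map_eq_some_iff.1 h
    rw [w.sgn_inverse _ _ hy]
    congr 2; ring
  sgn_inverse i x h := by
    obtain ⟨y, hy, rfl⟩ := Option.map_eq_some_iff.1 h
    rw [Letter.inverse_inverse, neg_neg]
    apply w.sgn_letter
    rw [← hy]; congr 1; ring
  right_none i v hv h j hj := by
    rw [Option.map_eq_none_iff] at h ⊢
    refine w.left_none _ v hv ?_ _ (by omega)
    rw [← h]; congr 1; ring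
  left_none i v hv h j hj := by
    rw [Option.map_eq_none_iff] at h ⊢
    refine w.right_none _ v hv ?_ _ (by omega)
    rw [← h]; congr 1; ring

theorem rev_vertex (w : Strand S) (i : ℤ) : w.rev.vertex i = w.vertex (-i) := rfl

theorem rev_letter (w : Strand S) (i : ℤ) :
    w.rev.letter i = (w.letter (1 - i)).map Letter.inverse := rfl

theorem rev_sgn (w : Strand S) (i : ℤ) : w.rev.sgn i = - w.sgn (-i) := rfl

@[simp] theorem rev_rev (w : Strand S) : w.rev.rev = w := by
  ext i : 2
  · simp [rev_vertex]
  · simp only [rev_letter, Option.map_map, sub_sub_cancel]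
    have : (Letter.inverse ∘ Letter.inverse : Letter D → Letter D) = id :=
      funext Letter.inverse_inverse
    rw [this, Option.map_id, id]
  · simp [rev_sgn]

/-- The letters read to the right from position `i`. -/
def read (w : Strand S) (i : ℤ) (k : ℕ) : Option (Letter D) := w.letter (i + 1 + k)

/-- The letters read to the left from position `i`. -/
def readL (w : Strand S) (i : ℤ) : ℕ → Option (Letter D) := w.rev.read (-i)

theorem read_zero (w : Strand S) (i : ℤ) : w.read i 0 = w.letter (i + 1) := by simp [read]

theorem read_tail (w : Strand S) (i : ℤ) : (fun k => w.read i (k + 1)) = w.read (i + 1) := by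
  funext k
  simp only [read]
  congr 1; push_cast; ring

theorem readL_apply (w : Strand S) (i : ℤ) (k : ℕ) :
    w.readL i k = (w.letter (i - k)).map Letter.inverse := by
  simp only [readL, read, rev_letter]
  congr 2; ring

theorem readL_zero (w : Strand S) (i : ℤ) :
    w.readL i 0 = (w.letter i).map Letter.inverse := by simp [readL_apply]

theorem readL_tail (w : Strand S) (i : ℤ) :
    (fun k => w.readL (i + 1) (k + 1)) = w.readL i := by
  funext k
  simp only [readL_apply]
  congr 2; push_cast; ring

theorem rev_readL (w : Strand S) (i : ℤ) : w.rev.readL i = w.read (-i) := by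
  simp [readL]

theorem rev_read (w : Strand S) (i : ℤ) : w.rev.read i = w.readL (-i) := by
  simp [readL]

/-- No `*`-letter can be appended at a right end. -/
def RightAdm (w : Strand S) : Prop :=
  ∀ i v, w.vertex i = some v → w.letter (i + 1) = none → ∀ s (hs : s ∈ D.Sp), D.hd s = v →
    S.sgn (.star s hs) ≠ w.sgn i

/-- No `*`-letter can be appended at an end. -/
def Adm (w : Strand S) : Prop := w.RightAdm ∧ w.rev.RightAdm

theorem Adm.rev {w : Strand S} (h : w.Adm) : w.rev.Adm := ⟨h.2, by simpa using h.1⟩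

/-- The vertex and the sign of `u` at `l` and of `w` at `i` are the same. -/
def SameAt (u : Strand S) (l : ℤ) (w : Strand S) (i : ℤ) : Prop :=
  ∃ v, u.vertex l = some v ∧ w.vertex i = some v ∧ u.sgn l = w.sgn i

variable {u w : Strand S} {l i : ℤ}

theorem SameAt.symm (h : SameAt u l w i) : SameAt w i u l := by
  obtain ⟨v, h1, h2, h3⟩ := h
  exact ⟨v, h2, h1, h3.symm⟩

theorem sameAt_succ {x : Letter D} (hx : u.letter (l + 1) = some x)
    (hy : w.letter (i + 1) = some x) : SameAt u (l + 1) w (i + 1) := by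
  refine ⟨_, u.tail_letter _ _ hx, w.tail_letter _ _ hy, ?_⟩
  have h1 := u.sgn_inverse _ _ hx
  rw [w.sgn_inverse _ _ hy] at h1
  exact neg_injective h1.symm

theorem head_of_letter {x : Letter D} (hx : w.letter (i + 1) = some x) :
    w.vertex i = some x.head := by
  simpa using w.head_letter _ _ hx

/-- A special loop begins and ends at the same vertex and its *-letter is its own inverse, so
reading backwards from before the letter starts with the same data as reading forwards from after
it. -/
theorem sameAt_turn {s : A} {hs : s ∈ D.Sp} (hx : u.letter (l + 1) = some (.star s hs))
    (hy : w.letter (i + 1) = some (.star s hs)) : SameAt u.rev (-l) w (i + 1) := by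
  refine ⟨D.hd s, ?_, ?_, ?_⟩
  · simpa [rev_vertex, Letter.head] using head_of_letter hx
  · rw [w.tail_letter _ _ hy, D.special_loop s hs]; rfl
  · have h1 := w.sgn_inverse _ _ hy
    have h2 := u.sgn_letter _ _ hx
    simp only [rev_sgn, neg_neg, ← h2]
    exact neg_eq_iff_eq_neg.2 h1

theorem SameAt.compat (h : SameAt u l w i) {x y : Letter D} (hx : u.letter (l + 1) = some x)
    (hy : w.letter (i + 1) = some y) (hxy : x ≠ y) :
    ∃ (a b : A) (ha : a ∉ D.Sp) (hb : b ∉ D.Sp), [a, b] ∈ D.Z ∧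
      ((x = .inv a ha ∧ y = .dir b hb) ∨ (x = .dir b hb ∧ y = .inv a ha)) := by
  obtain ⟨v, h1, h2, h3⟩ := h
  rw [head_of_letter hx] at h1
  rw [head_of_letter hy] at h2
  refine S.compat x y hxy ?_ ?_
  · exact Option.some_injective _ (h1.trans h2.symm)
  · rw [u.sgn_letter _ _ hx, w.sgn_letter _ _ hy, h3]

/-- Distinct letters with the same head and sign are both ordinary, and admissibility forbids ending
where a *-letter fits. So a first difference never involves a *-letter, and it is harmless that
`Letter.rank` does not separate *-letters from the end of a word. -/
theorem SameAt.eq_star (h : SameAt u l w i) (hu : u.RightAdm) {s : A} {hs : s ∈ D.Sp}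
    (hy : w.letter (i + 1) = some (.star s hs)) : u.letter (l + 1) = some (.star s hs) := by
  rcases hx : u.letter (l + 1) with _ | x
  · exfalso
    obtain ⟨v, h1, h2, h3⟩ := h
    rw [head_of_letter hy] at h2
    refine hu l v h1 hx s hs (Option.some_injective _ h2) ?_
    rw [w.sgn_letter _ _ hy, h3]
  · by_contra hne
    obtain ⟨a, b, ha, hb, -, ⟨-, h'⟩ | ⟨-, h'⟩⟩ := h.compat hx hy (fun e => hne (by rw [e])) <;>
    cases h'

theorem SameAt.eq_or_rank_ne (h : SameAt u l w i) (hu : u.RightAdm) (hw : w.RightAdm) :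
    u.letter (l + 1) = w.letter (i + 1) ∨
      Letter.rank (u.letter (l + 1)) ≠ Letter.rank (w.letter (i + 1)) := by
  rcases hx : u.letter (l + 1) with _ | x <;> rcases hy : w.letter (i + 1) with _ | y
  · exact Or.inl rfl
  · cases y with
    | star s hs => exact Or.inl (by rw [← hx, h.eq_star hu hy])
    | _ => right; simp [Letter.rank]
  · cases x with
    | star s hs => exact Or.inl (by rw [← hy, h.symm.eq_star hw hx])
    | _ => right; simp [Letter.rank]
  · by_cases hxy : x = y
    · exact Or.inl (by rw [hxy])
    · right
      obtain ⟨a, b, ha, hb, -, ⟨rfl, rfl⟩ | ⟨rfl, rfl⟩⟩ := h.compat hx hy hxy <;>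
      simp [Letter.rank]

theorem SameAt.add (h : SameAt u l w i) (n : ℕ) (hn : ∀ k < n, u.read l k = w.read i k)
    (hs : ∀ k < n, (u.read l k).isSome) : SameAt u (l + n) w (i + n) := by
  rcases n with _ | n
  · simpa using h
  · obtain ⟨x, hx⟩ := Option.isSome_iff_exists.1 (hs n (by omega))
    have hy := (hn n (by omega)).symm.trans hx
    have e : ∀ j : ℤ, j + ((n + 1 : ℕ) : ℤ) = j + n + 1 := fun j => by push_cast; ring
    rw [e, e]
    refine sameAt_succ (x := x) ?_ ?_
    · rw [← hx, read]; congr 1; ring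
    · rw [← hy, read]; congr 1; ring

theorem read_none {n m : ℕ} (h : SameAt u l w i) (hn : ∀ k < n, (u.read l k).isSome)
    (h0 : u.read l n = none) (hm : n ≤ m) : u.read l m = none := by
  have h1 := (show SameAt u l u l from ⟨_, h.choose_spec.1, h.choose_spec.1, rfl⟩).add n
    (fun _ _ => rfl) hn
  obtain ⟨v, hv, -⟩ := h1
  refine u.right_none _ v hv ?_ _ (by omega)
  rw [← h0, read]; congr 1; ring

theorem SameAt.trichotomy (h : SameAt u l w i) (hu : u.RightAdm) (hw : w.RightAdm) (P : ℕ∞) :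
    LexLT P (u.read l) (w.read i) ∨ EqUpTo P (u.read l) (w.read i) ∨
      LexLT P (w.read i) (u.read l) := by
  classical
  by_cases heq : EqUpTo P (u.read l) (w.read i)
  · exact Or.inr (Or.inl heq)
  have hex : ∃ n : ℕ, (n : ℕ∞) < P ∧ u.read l n ≠ w.read i n := by
    simpa [EqUpTo] using heq
  have hn := Nat.find_spec hex
  have hmin : ∀ k < Nat.find hex, u.read l k = w.read i k := by
    intro k hk
    by_contra hne
    exact Nat.find_min hex hk ⟨lt_trans (by exact_mod_cast hk) hn.1, hne⟩
  set n := Nat.find hex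
  -- Had one word ended before n, the other would have ended at the same place, and both would be
  -- empty at n.
  have hsome : ∀ k < n, (u.read l k).isSome := by
    by_contra hcon
    push Not at hcon
    have hcon' : ∃ k, k < n ∧ u.read l k = none := by simpa using hcon
    have hk := Nat.find_spec hcon'
    have hm : ∀ j < Nat.find hcon', (u.read l j).isSome := by
      intro j hj
      have := Nat.find_min hcon' hj
      rw [Option.isSome_iff_ne_none]
      exact fun e => this ⟨hj.trans hk.1, e⟩
    refine hn.2 ?_
    rw [read_none h hm hk.2 hk.1.le, read_none h.symm (n := Nat.find hcon')
      (fun j hj => by rw [← hmin j (hj.trans hk.1)]; exact hm j hj)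
      (by rw [← hmin _ hk.1]; exact hk.2) hk.1.le]
  have h1 := h.add n hmin hsome
  have e1 : u.letter (l + n + 1) = u.read l n := by rw [read]; congr 1; ring
  have e2 : w.letter (i + n + 1) = w.read i n := by rw [read]; congr 1; ring
  have h2 := h1.eq_or_rank_ne hu hw
  rw [e1, e2] at h2
  rcases h2 with h2 | h2
  · exact absurd h2 hn.2
  rcases lt_or_gt_of_ne h2 with h2 | h2
  · exact Or.inl ⟨n, hn.1, hmin, h2⟩
  · exact Or.inr (Or.inr ⟨n, hn.1, fun k hk => (hmin k hk).symm, h2⟩)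

theorem SameAt.not_lt (h : SameAt u l w i) (hu : u.RightAdm) (hw : w.RightAdm) {P : ℕ∞} :
    ¬ LexLT P (u.read l) (w.read i) ↔ LexRel True P (w.read i) (u.read l) := by
  constructor
  · intro h'
    rcases h.trichotomy hu hw P with h1 | h1 | h1
    · exact absurd h1 h'
    · exact h1.symm.le
    · exact h1.rel
  · rintro (h1 | ⟨-, h1⟩) h2
    · exact h1.not_symm h2
    · exact h2.not_eq h1.symm

end Strand

/-! ## Relations given by oriented letters -/

open SemilinearClannishData

section Orient

variable {K V A : Type*} [DivisionRing K] {D : SemilinearClannishData K V A} {S : SignChoice D}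

open Classical in
/-- The letter of a walk over `x`, where `s^*` becomes `s` if `o` holds and `s⁻¹` otherwise. -/
noncomputable def Letter.orient : Letter D → Prop → WalkLetter A
  | .dir a _, _ => .dir a
  | .inv a _, _ => .inv a
  | .star s _, o => if o then .dir s else .inv s

theorem Letter.orient_inverse (x : Letter D) (o : Prop) :
    x.inverse.orient (¬ o) = (x.orient o).inverse := by
  cases x <;> by_cases h : o <;> simp [Letter.inverse, Letter.orient, WalkLetter.inverse, h]

/-- The orientations of the `*`-letters of the inverse walk. -/
def orev (o : ℤ → Prop) (i : ℤ) : Prop := ¬ o (1 - i)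

@[simp] theorem orev_orev (o : ℤ → Prop) : orev (orev o) = o := by
  funext i
  simp [orev]

/-- Automorphisms compatible with the orientation `o` of `w`. -/
structure Strand.Twist (w : Strand S) (o : ℤ → Prop) (π : ℤ → RingAut K) : Prop where
  dir : ∀ i x a, w.letter i = some x → x.orient (o i) = .dir a → π (i - 1) = D.σ a * π i
  inv : ∀ i x a, w.letter i = some x → x.orient (o i) = .inv a → π i = D.σ a * π (i - 1)

theorem exists_int_rec {G : Type*} [Group G] (g : ℤ → G) (j : ℤ) :
    ∃ π : ℤ → G, π j = 1 ∧ ∀ i, π (i - 1) = g i * π i := by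
  obtain ⟨f, hf⟩ : ∃ f : ℕ → G × G, f 0 = (1, 1) ∧ ∀ n,
      f (n + 1) = ((g (j + n + 1))⁻¹ * (f n).1, g (j - n) * (f n).2) :=
    ⟨fun n => Nat.rec (1, 1) (fun n p => ((g (j + n + 1))⁻¹ * p.1, g (j - n) * p.2)) n,
      rfl, fun _ => rfl⟩
  refine ⟨fun i => if j ≤ i then (f (i - j).toNat).1 else (f (j - i).toNat).2, by simp [hf.1], ?_⟩
  intro i
  by_cases h : j ≤ i - 1
  · obtain ⟨n, rfl⟩ : ∃ n : ℕ, i = j + n + 1 := ⟨(i - 1 - j).toNat, by omega⟩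
    have e1 : (j + n + 1 - 1 - j).toNat = n := by omega
    have e2 : (j + n + 1 - j).toNat = n + 1 := by omega
    have h2 : j ≤ j + n + 1 := by omega
    simp only [h, h2, if_true, e1, e2, hf.2, mul_inv_cancel_left]
  · obtain ⟨n, rfl⟩ : ∃ n : ℕ, i = j - n := ⟨(j - i).toNat, by omega⟩
    have e1 : (j - (j - n - 1)).toNat = n + 1 := by omega
    simp only [h, if_false, e1, hf.2]
    congr 1
    rcases n with _ | n
    · simp [hf.1]
    · have h2 : ¬ j ≤ j - ((n + 1 : ℕ) : ℤ) := by omega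
      have e2 : (j - (j - ((n + 1 : ℕ) : ℤ))).toNat = n + 1 := by omega
      simp only [h2, if_false, e2]

/-- The normalisation at j lets a chain be rescaled so that its entry at j is multiplied by a
prescribed scalar. -/
theorem Strand.exists_twist (w : Strand S) (o : ℤ → Prop) (j : ℤ) :
    ∃ π, π j = 1 ∧ w.Twist o π := by
  obtain ⟨π, h1, h2⟩ := exists_int_rec (fun i => match (w.letter i).map fun x => x.orient (o i) with
    | some (.dir a) => D.σ a
    | some (.inv a) => (D.σ a)⁻¹
    | none => 1) j
  refine ⟨π, h1, fun i x a hx ha => ?_, fun i x a hx ha => ?_⟩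
  · rw [h2 i]; simp [hx, ha]
  · rw [h2 i]; simp [hx, ha]

theorem star_dir_of_notMem {a : A} (ha : a ∉ D.Sp) : WalkLetter.star D (.dir a) = .dir a ha := by
  simp [WalkLetter.star, ha]

theorem star_inv_of_notMem {a : A} (ha : a ∉ D.Sp) : WalkLetter.star D (.inv a) = .inv a ha := by
  simp [WalkLetter.star, ha]

end Orient

/-! ### Arrow relations in a module and the switching of a special loop -/

section Relations

variable {K V A : Type*} [DivisionRing K] [Fintype V] {D : SemilinearClannishData K V A}
  {S : SignChoice D} {M : Type*} [AddCommGroup M] [Module D.Alg M]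

theorem SemilinearClannishData.e_mul_arr (a : A) : D.e (D.hd a) * D.arr a = D.arr a := by
  have h := congrArg D.toAlg (D.toPathAlgebra_rel (PathRel.head_arrow (D := D) a))
  simp only [map_mul] at h
  exact h

theorem SemilinearClannishData.arr_mul_arr {a b : A} (h : [a, b] ∈ D.Z) :
    D.arr a * D.arr b = 0 := by
  have h := D.toAlg_rel (ClannishRel.zero _ h)
  simpa [arr, gen] using h

theorem arr_smul_mem (a : A) (m : Res D M) : D.arr a • m ∈ vertexSpace D M (D.hd a) := by
  change D.e (D.hd a) • D.arr a • m = D.arr a • m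
  rw [smul_smul, D.e_mul_arr]

theorem arr_arr_smul {a b : A} (h : [a, b] ∈ D.Z) (m : Res D M) :
    D.arr a • D.arr b • m = 0 := by
  rw [smul_smul, D.arr_mul_arr h, zero_smul]

theorem special_smul (s : D.Sp) {m : Res D M} (hm : m ∈ vertexSpace D M (D.hd s)) :
    D.arr s • D.arr s • m = D.β s • D.arr (s : A) • m - D.γ s • m := by
  have h := D.toAlg_rel (ClannishRel.quadratic (D := D) s)
  simp only [map_add, map_sub, map_mul, map_pow, map_zero] at h
  have h2 : (D.arr s ^ 2 - D.scal (D.β s) * D.arr s + D.scal (D.γ s) * D.e (D.hd s)) • m = 0 := by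
    rw [show D.arr s ^ 2 - D.scal (D.β s) * D.arr s + D.scal (D.γ s) * D.e (D.hd s) = 0 from h,
      zero_smul]
  rw [add_smul, sub_smul, pow_two, mul_smul, mul_smul, mul_smul,
    show D.e (D.hd s) • m = m from hm] at h2
  rw [Res.smul_def, Res.smul_def, ← sub_eq_zero, ← h2]
  abel

theorem LetterRel.zero (x : WalkLetter A) : LetterRel (D := D) (0 : Res D M) 0 x := by
  cases x <;> exact ⟨zero_mem _, (smul_zero _).symm⟩

theorem LetterRel.add {x : WalkLetter A} {m m' n n' : Res D M} (h₁ : LetterRel m' m x)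
    (h₂ : LetterRel n' n x) : LetterRel (m' + n') (m + n) x := by
  cases x <;> exact ⟨add_mem h₁.1 h₂.1, by rw [smul_add, ← h₁.2, ← h₂.2]⟩

theorem LetterRel.neg {x : WalkLetter A} {m m' : Res D M} (h : LetterRel m' m x) :
    LetterRel (-m') (-m) x := by
  cases x <;> exact ⟨neg_mem h.1, by rw [smul_neg, ← h.2]⟩

theorem LetterRel.inverse {x : WalkLetter A} {m m' : Res D M} :
    LetterRel m m' x.inverse ↔ LetterRel m' m x := by
  cases x <;> rfl

theorem LetterRel.smul {x : WalkLetter A} {m m' : Res D M} (h : LetterRel m' m x)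
    {π π' : RingAut K} (h₁ : ∀ a, x = .dir a → π' = D.σ a * π)
    (h₂ : ∀ a, x = .inv a → π = D.σ a * π') (l : K) :
    LetterRel (π' l • m') (π l • m) x := by
  cases x with
  | dir a => exact ⟨Submodule.smul_mem _ _ h.1, by rw [Res.arr_smul, ← h.2, h₁ a rfl]; rfl⟩
  | inv a => exact ⟨Submodule.smul_mem _ _ h.1, by rw [Res.arr_smul, ← h.2, h₂ a rfl]; rfl⟩

theorem LetterRel.exists_smul {x : WalkLetter A} {m m' : Res D M} (h : LetterRel m' m x) (l : K) :
    ∃ l' : K, LetterRel (l • m') (l' • m) x := by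
  cases x with
  | dir a =>
    refine ⟨(D.σ a).symm l, Submodule.smul_mem _ _ h.1, ?_⟩
    rw [Res.arr_smul, ← h.2, RingEquiv.apply_symm_apply]
  | inv a => exact ⟨D.σ a l, Submodule.smul_mem _ _ h.1, by rw [Res.arr_smul, ← h.2]⟩

/-- An element related to `x` by `s^{±1}` can be corrected by a multiple of `x` to an element
related to `x` by `s^{∓1}`. -/
theorem LetterRel.switch (hns : D.NonSingularType) {s : A} (hs : s ∈ D.Sp) {o o' : Prop}
    (ho : o' ↔ ¬ o) {x y : Res D M} (h : LetterRel x y ((Letter.star s hs).orient o)) :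
    ∃ c d : K, c ≠ 0 ∧ LetterRel x (c • y + d • x) ((Letter.star s hs).orient o') := by
  have hγ : D.γ ⟨s, hs⟩ ≠ 0 := hns ⟨s, hs⟩
  have hloop := D.special_loop s hs
  by_cases hp : o
  · have hp' : ¬ o' := fun h => ho.1 h hp
    simp only [Letter.orient, hp, hp', if_true, if_false] at h ⊢
    obtain ⟨hy, rfl⟩ := h
    -- Here x = s y, so s x = s² y = β x - γ y.
    refine ⟨- D.γ ⟨s, hs⟩, D.β ⟨s, hs⟩, neg_ne_zero.2 hγ, ?_, ?_⟩
    · rw [← hloop]; exact arr_smul_mem s y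
    · have := special_smul (D := D) ⟨s, hs⟩ (m := y) (by simpa only [hloop] using hy)
      simp only at this
      rw [this, neg_smul]
      abel
  · have hp' : o' := ho.2 hp
    simp only [Letter.orient, hp, hp', if_true, if_false] at h ⊢
    obtain ⟨hx, rfl⟩ := h
    have key : ∀ z ∈ vertexSpace D M (D.tl s), z = (D.γ ⟨s, hs⟩)⁻¹ •
        (D.β ⟨s, hs⟩ • D.arr s • z - D.arr s • D.arr s • z) := by
      intro z hz
      have := special_smul (D := D) ⟨s, hs⟩ (m := z) (by simpa only [hloop] using hz)
      simp only at this
      rw [this, sub_sub_cancel, smul_smul, inv_mul_cancel₀ hγ, one_smul]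
    -- The loop s acts surjectively: for t = -γ⁻¹ x one has s (s t - σ_s⁻¹(β) t) = -γ t = x. For z
    -- with s z = x, the quadratic relation gives z = γ⁻¹ (β x - y), as y = s x = s² z.
    obtain ⟨z, hz, hzx⟩ : ∃ z ∈ vertexSpace D M (D.tl s), D.arr s • z = x := by
      set t : Res D M := - ((D.γ ⟨s, hs⟩)⁻¹ • x) with ht
      have htm : t ∈ vertexSpace D M (D.tl s) := neg_mem (Submodule.smul_mem _ _ hx)
      have hst : D.arr s • t ∈ vertexSpace D M (D.tl s) := by
        rw [← hloop]; exact arr_smul_mem s t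
      refine ⟨D.arr s • t - (D.σ s).symm (D.β ⟨s, hs⟩) • t,
        sub_mem hst (Submodule.smul_mem _ _ htm), ?_⟩
      have := special_smul (D := D) ⟨s, hs⟩ (m := t) (by simpa only [hloop] using htm)
      simp only at this
      rw [smul_sub, this, Res.arr_smul, RingEquiv.apply_symm_apply, sub_sub_cancel_left, ht,
        smul_neg, neg_neg, smul_smul, mul_inv_cancel₀ hγ, one_smul]
    refine ⟨- (D.γ ⟨s, hs⟩)⁻¹, (D.γ ⟨s, hs⟩)⁻¹ * D.β ⟨s, hs⟩, neg_ne_zero.2 (inv_ne_zero hγ), ?_⟩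
    have e : -(D.γ ⟨s, hs⟩)⁻¹ • D.arr s • x + ((D.γ ⟨s, hs⟩)⁻¹ * D.β ⟨s, hs⟩) • x = z := by
      conv_rhs => rw [key z hz]
      rw [← hzx, smul_sub, mul_smul, neg_smul]
      abel
    rw [e]
    exact ⟨hz, hzx.symm⟩

/-- Both submodules come from ordinary arrows when no *-letter fits, and the sign condition puts the
product of the killing arrow and the image arrow into Z. -/
theorem trivialMinus_le_trivialPlus {v : V} {ε : ℤˣ}
    (h : ∀ s (hs : s ∈ D.Sp), D.hd s = v → S.sgn (.star s hs) ≠ ε) :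
    trivialMinus M S v ε ≤ trivialPlus M S v ε := by
  refine iSup₂_le fun b hb => ?_
  rintro _ ⟨n, hn, rfl⟩
  have hbS : b ∉ D.Sp := fun hs => h b hs hb.1 (by simpa [WalkLetter.star, hs] using hb.2)
  refine ⟨by rw [← hb.1]; exact arr_smul_mem b n, ?_⟩
  simp only [SetLike.mem_coe, Submodule.mem_iInf]
  intro a ha
  have haS : a ∉ D.Sp := fun hs => h a hs ((D.special_loop a hs).trans ha.1)
    (by simpa [WalkLetter.star, hs] using ha.2)
  rw [star_inv_of_notMem haS] at ha
  rw [star_dir_of_notMem hbS] at hb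
  refine ⟨by rw [ha.1, ← hb.1]; exact arr_smul_mem b n, ?_⟩
  obtain ⟨a', b', ha', hb', hZ, ⟨h1, h2⟩ | ⟨h1, h2⟩⟩ := S.compat (.inv a haS) (.dir b hbS)
    (by simp) (ha.1.trans hb.1.symm) (ha.2.trans hb.2.symm)
  · cases h1; cases h2
    exact arr_arr_smul hZ n
  · cases h1

end Relations

/-! ### Chains of elements along an oriented word -/

namespace Strand

open SemilinearClannishData

section Chain

variable {K V A : Type*} [DivisionRing K] [Fintype V] {D : SemilinearClannishData K V A}
  {S : SignChoice D} {M : Type*} [AddCommGroup M] [Module D.Alg M]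

/-- Families of elements of `M` linked by the letters of `w` with orientation `o`. -/
structure Chain (w : Strand S) (o : ℤ → Prop) (m : ℤ → Res D M) : Prop where
  mem : ∀ i v, w.vertex i = some v → m i ∈ vertexSpace D M v
  rel : ∀ i x, w.letter i = some x → LetterRel (m (i - 1)) (m i) (x.orient (o i))

/-- The condition `1^+` at a right end. -/
def RightPlus (w : Strand S) (m : ℤ → Res D M) : Prop :=
  ∀ i v, w.vertex i = some v → w.letter (i + 1) = none → m i ∈ trivialPlus M S v (w.sgn i)

/-- The condition `1^-` at a right end. -/
def RightMinus (w : Strand S) (m : ℤ → Res D M) : Prop :=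
  ∀ i v, w.vertex i = some v → w.letter (i + 1) = none → m i ∈ trivialMinus M S v (w.sgn i)

variable {u w : Strand S} {o o' : ℤ → Prop} {m m' : ℤ → Res D M}

theorem RightMinus.plus (h : w.RightMinus m) (hw : w.RightAdm) : w.RightPlus m :=
  fun i v hv hi => trivialMinus_le_trivialPlus (hw i v hv hi) (h i v hv hi)

theorem Chain.rev (h : w.Chain o m) : w.rev.Chain (orev o) (fun i => m (-i)) := by
  refine ⟨fun i v hv => h.mem _ _ hv, fun i x hx => ?_⟩
  obtain ⟨y, hy, rfl⟩ := Option.map_eq_some_iff.1 hx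
  have := h.rel _ _ hy
  rw [show orev o i = ¬ o (1 - i) from rfl, Letter.orient_inverse, LetterRel.inverse]
  convert this using 2 <;> ring

theorem Chain.congr (h : w.Chain o m)
    (ho : ∀ i s hs, w.letter i = some (.star s hs) → (o i ↔ o' i)) : w.Chain o' m := by
  refine ⟨h.mem, fun i x hx => ?_⟩
  have := h.rel i x hx
  cases x with
  | dir a ha => exact this
  | inv a ha => exact this
  | star s hs => rwa [← propext (ho i s hs hx)]

theorem Chain.smul (h : w.Chain o m) {π : ℤ → RingAut K} (hπ : w.Twist o π) (l : K) :
    w.Chain o (fun i => π i l • m i) :=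
  ⟨fun i v hv => Submodule.smul_mem _ _ (h.mem i v hv), fun i x hx =>
    (h.rel i x hx).smul (fun a ha => hπ.dir i x a hx ha) (fun a ha => hπ.inv i x a hx ha) l⟩

theorem Chain.add (h : w.Chain o m) (h' : w.Chain o m') : w.Chain o (fun i => m i + m' i) :=
  ⟨fun i v hv => add_mem (h.mem i v hv) (h'.mem i v hv), fun i x hx =>
    (h.rel i x hx).add (h'.rel i x hx)⟩

theorem Chain.neg (h : w.Chain o m) : w.Chain o (fun i => - m i) :=
  ⟨fun i v hv => neg_mem (h.mem i v hv), fun i x hx => (h.rel i x hx).neg⟩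

/-- Two chains with the same element at `j` can be glued at `j`. -/
theorem Chain.glue {n : ℤ → Res D M} {j : ℤ} {on : ℤ → Prop} (hm : w.Chain o m)
    (hn : w.Chain on n) (hj : m j = n j) (ho : ∀ i ≤ j, o' i ↔ o i) (ho' : ∀ i, j < i → (o' i ↔ on i)) :
    w.Chain o' (fun i => if i ≤ j then m i else n i) := by
  refine ⟨fun i v hv => ?_, fun i x hx => ?_⟩
  · by_cases h : i ≤ j
    · simpa only [h, if_true] using hm.mem i v hv
    · simpa only [h, if_false] using hn.mem i v hv
  · by_cases h : i ≤ j
    · have h' : i - 1 ≤ j := by omega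
      simp only [h, h', if_true]
      rw [propext (ho i h)]
      exact hm.rel i x hx
    · rw [propext (ho' i (by omega))]
      have e : (if i - 1 ≤ j then m (i - 1) else n (i - 1)) = n (i - 1) := by
        by_cases h' : i - 1 ≤ j
        · have : i - 1 = j := by omega
          rw [if_pos h', this, hj]
        · rw [if_neg h']
      rw [e]
      simp only [h, if_false]
      exact hn.rel i x hx

end Chain

/-! ### Two-sided comparison of words -/

section Pair

variable {K V A : Type*} [DivisionRing K] {D : SemilinearClannishData K V A} {S : SignChoice D}

/-- The word of `u` at `l` is bounded by the word of `w` at `i` on both sides, up to depth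
`P + 1`, and strictly so on the right unless `b` holds. -/
structure Pair (b : Prop) (P : ℕ∞) (u : Strand S) (l : ℤ) (w : Strand S) (i : ℤ) : Prop where
  same : SameAt u l w i
  right : LexRel b (P + 1) (u.read l) (w.read i)
  left : LexRel True (P + 1) (u.readL l) (w.readL i)

/-- The orientation `o` is compatible with the order of the words on both sides, up to
depth `P`. -/
structure Compat (P : ℕ∞) (w : Strand S) (o : ℤ → Prop) : Prop where
  dir : ∀ i s hs, w.letter i = some (.star s hs) → o i →
    LexRel True P (w.read i) (w.readL (i - 1))
  inv : ∀ i s hs, w.letter i = some (.star s hs) → ¬ o i →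
    LexRel True P (w.readL (i - 1)) (w.read i)

theorem rev_star {w : Strand S} {i : ℤ} {s : A} {hs : s ∈ D.Sp}
    (h : w.rev.letter i = some (.star s hs)) : w.letter (1 - i) = some (.star s hs) := by
  obtain ⟨y, hy, hys⟩ := Option.map_eq_some_iff.1 h
  rw [hy]
  cases y <;> simp_all [Letter.inverse]

theorem Compat.rev {P : ℕ∞} {w : Strand S} {o : ℤ → Prop} (h : Compat P w o) :
    Compat P w.rev (orev o) := by
  refine ⟨fun i s hs hi ho => ?_, fun i s hs hi ho => ?_⟩
  · have := h.inv _ s hs (rev_star hi) ho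
    rw [rev_read, rev_readL]
    convert this using 2 <;> ring
  · have := h.dir _ s hs (rev_star hi) (not_not.1 ho)
    rw [rev_read, rev_readL]
    convert this using 2 <;> ring

variable {u w : Strand S} {l i : ℤ} {b : Prop} {P : ℕ∞}

theorem readL_succ_zero {x : Letter D} (hx : w.letter (i + 1) = some x) :
    w.readL (i + 1) 0 = some x.inverse := by
  rw [readL_zero, hx]; rfl

/-- On the right the common letter is dropped and one unit of depth is lost, which
`LexRel.mono_succ` restores. On the left the common letter is added in front, so depth P suffices to
get P + 1 again. -/
theorem Pair.succ (h : Pair b P u l w i) (hb : b → P = ⊤) {x : Letter D}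
    (hx : u.letter (l + 1) = some x) (hy : w.letter (i + 1) = some x) :
    Pair b P u (l + 1) w (i + 1) := by
  refine ⟨sameAt_succ hx hy, ?_, ?_⟩
  · have h1 := LexRel.succ_iff.1 h.right
    rw [read_zero, read_zero, hx, hy, read_tail, read_tail] at h1
    rcases h1 with h1 | ⟨-, h1⟩
    · exact absurd h1 (lt_irrefl _)
    · exact h1.mono_succ hb
  · rw [LexRel.succ_iff, readL_succ_zero hx, readL_succ_zero hy, readL_tail, readL_tail]
    exact Or.inr ⟨rfl, h.left.mono_le le_self_add⟩

/-- Turning around at a `*`-letter. -/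
theorem pair_turn (hb : b → P = ⊤) {s : A} {hs : s ∈ D.Sp}
    (hx : u.letter (l + 1) = some (.star s hs)) (hy : w.letter (i + 1) = some (.star s hs))
    (hr : LexRel b P (u.readL l) (w.read (i + 1)))
    (hl : LexRel True P (u.read (l + 1)) (w.readL i)) : Pair b P u.rev (-l) w (i + 1) := by
  refine ⟨sameAt_turn hx hy, ?_, ?_⟩
  · rw [rev_read, neg_neg]
    exact hr.mono_succ hb
  · rw [rev_readL, neg_neg, LexRel.succ_iff, readL_succ_zero hy, readL_tail, read_tail, read_zero, hx]
    exact Or.inr ⟨rfl, hl⟩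

end Pair

/-! ### Propagating entries of a chain along a bounding word -/

section Step

variable {K V A : Type*} [DivisionRing K] [Fintype V] {D : SemilinearClannishData K V A}
  {S : SignChoice D} {M : Type*} [AddCommGroup M] [Module D.Alg M]
  {u w : Strand S} {o : ℤ → Prop} {m : ℤ → Res D M} {l i : ℤ} {b : Prop} {P : ℕ∞}

/-- This is where the order on words controls linear algebra: a bounded entry can follow the next
letter of w with an arbitrary prescribed orientation compatible with the order, at the cost of
turning around at *-letters oriented differently. -/
theorem Pair.step (hns : D.NonSingularType) (hm : u.Chain o m) (hmp : u.RightPlus m)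
    (hu : u.RightAdm) (hc : Compat P u o) (hb : b → P = ⊤) (h : Pair b P u l w i)
    {z : Letter D} (hz : w.letter (i + 1) = some z) {oz : Prop}
    (hd : oz → ∀ s hs, z = .star s hs → LexRel True P (w.read (i + 1)) (w.readL i))
    (hi : ¬ oz → ∀ s hs, z = .star s hs → LexRel b P (w.readL i) (w.read (i + 1))) :
    ∃ y ∈ Submodule.span K {x | (x = m (l + 1) ∧ Pair b P u (l + 1) w (i + 1)) ∨
      (x = m l ∧ Pair b P u.rev (-l) w (i + 1))}, LetterRel (m l) y (z.orient oz) := by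
  have h1 := LexRel.succ_iff.1 h.right
  rw [read_zero, read_zero, hz, read_tail, read_tail] at h1
  have hrel : ∀ x, u.letter (l + 1) = some x →
      LetterRel (m l) (m (l + 1)) (x.orient (o (l + 1))) := fun x hx => by
    simpa using hm.rel _ x hx
  obtain ⟨v, hv1, hv2, hsg⟩ := h.same
  cases z with
  | dir a ha =>
    -- Nothing is smaller than a direct letter, so u continues with the same one.
    rcases h1 with h1 | ⟨h1, -⟩
    · simp [Letter.rank] at h1
    · exact ⟨m (l + 1), Submodule.subset_span (Or.inl ⟨rfl, h.succ hb h1 hz⟩), hrel _ h1⟩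
  | inv a ha =>
    have hva : v = D.tl a := Option.some_injective _ (hv2.symm.trans (head_of_letter hz))
    have hml : m l ∈ vertexSpace D M (D.tl a) := hm.mem l _ (by rw [hv1, hva])
    rcases h1 with h1 | ⟨h1, -⟩
    · refine ⟨0, zero_mem _, hml, ?_⟩
      rcases hx : u.letter (l + 1) with _ | x
      · have h2 := (hmp l v hv1 hx).2
        simp only [SetLike.mem_coe, Submodule.mem_iInf] at h2
        have h3 := h2 a ⟨hva.symm, by
          rw [star_inv_of_notMem ha, w.sgn_letter _ _ hz, hsg]⟩
        exact h3.2.symm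
      · rw [hx] at h1
        obtain ⟨a', b', ha', hb', hZ, ⟨rfl, h3⟩ | ⟨rfl, h3⟩⟩ := h.same.compat hx hz
          (by rintro rfl; exact lt_irrefl _ h1)
        · cases h3
        · cases h3
          have := hrel _ hx
          rw [this.2, arr_arr_smul hZ]
    · exact ⟨m (l + 1), Submodule.subset_span (Or.inl ⟨rfl, h.succ hb h1 hz⟩), hrel _ h1⟩
  | star s hs =>
    have hx := h.same.eq_star hu hz
    have h2 := hrel _ hx
    have hmatch := h.succ hb hx hz
    have hxy : LexRel b P (u.read (l + 1)) (w.read (i + 1)) := by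
      rcases h1 with h1 | h1
      · rw [hx] at h1; exact absurd h1 (lt_irrefl _)
      · exact h1.2
    have hl : LexRel True P (u.readL l) (w.readL i) := h.left.mono_le le_self_add
    by_cases hoo : oz ↔ o (l + 1)
    · refine ⟨m (l + 1), Submodule.subset_span (Or.inl ⟨rfl, hmatch⟩), ?_⟩
      rwa [propext hoo]
    · obtain ⟨c, d, -, hcd⟩ := h2.switch hns hs (o' := oz) (by tauto)
      refine ⟨_, ?_, hcd⟩
      -- The two orientations are opposite. If w is direct here, the bounds are u-left ≤ u-right,
      -- then u-right bounded by w-right, then w-right ≤ w-left; if w is inverse, they are u-right ≤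
      -- u-left ≤ w-left, then w-left bounded by w-right. Either way they compose to the bounds
      -- needed after turning.
      have hturn : Pair b P u.rev (-l) w (i + 1) := by
        by_cases hoz : oz
        · have h3 := hc.inv _ s hs hx (by tauto)
          rw [add_sub_cancel_right] at h3
          have h4 := hd hoz s hs rfl
          exact pair_turn hb hx hz (h3.le_trans hxy) (hxy.le.trans_le h4)
        · have h3 := hc.dir _ s hs hx (by tauto)
          rw [add_sub_cancel_right] at h3
          have h4 := hi hoz s hs rfl
          exact pair_turn hb hx hz (hl.le_trans h4) (h3.trans_le hl)
      refine add_mem (Submodule.smul_mem _ _ (Submodule.subset_span (Or.inl ⟨rfl, hmatch⟩)))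
        (Submodule.smul_mem _ _ (Submodule.subset_span (Or.inr ⟨rfl, hturn⟩)))

/-- The span of the elements of a chain whose words are bounded by the word of `w` at `i`. -/
def flow (b : Prop) (P : ℕ∞) (w : Strand S) (m : ℤ → Res D M) (i : ℤ) : Submodule K (Res D M) :=
  Submodule.span K {x | (∃ l, x = m l ∧ Pair b P w l w i) ∨
    (∃ l, x = m (-l) ∧ Pair b P w.rev l w i)}

/-- The letter relations are additive and semilinear, so it suffices to move the generators of the
span. -/
theorem flow_step (hns : D.NonSingularType) (hm : w.Chain o m) (hmp : w.RightPlus m)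
    (hml : w.rev.RightPlus (fun i => m (-i))) (hw : w.Adm) (hc : Compat P w o) (hb : b → P = ⊤)
    {z : Letter D} (hz : w.letter (i + 1) = some z) {oz : Prop}
    (hd : oz → ∀ s hs, z = .star s hs → LexRel True P (w.read (i + 1)) (w.readL i))
    (hi : ¬ oz → ∀ s hs, z = .star s hs → LexRel b P (w.readL i) (w.read (i + 1)))
    {x : Res D M} (hx : x ∈ flow b P w m i) :
    ∃ y ∈ flow b P w m (i + 1), LetterRel x y (z.orient oz) := by
  induction hx using Submodule.span_induction with
  | zero => exact ⟨0, zero_mem _, LetterRel.zero _⟩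
  | add x x' _ _ hx hx' =>
    obtain ⟨y, hy, h⟩ := hx
    obtain ⟨y', hy', h'⟩ := hx'
    exact ⟨y + y', add_mem hy hy', h.add h'⟩
  | smul c x _ hx =>
    obtain ⟨y, hy, h⟩ := hx
    obtain ⟨c', h'⟩ := h.exists_smul c
    exact ⟨c' • y, Submodule.smul_mem _ _ hy, h'⟩
  | mem x hx =>
    rcases hx with ⟨l, rfl, hp⟩ | ⟨l, rfl, hp⟩
    · obtain ⟨y, hy, h⟩ := hp.step hns hm hmp hw.1 hc hb hz hd hi
      refine ⟨y, Submodule.span_mono ?_ hy, h⟩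
      rintro x (⟨rfl, h⟩ | ⟨rfl, h⟩)
      · exact Or.inl ⟨_, rfl, h⟩
      · exact Or.inr ⟨-l, by rw [neg_neg], h⟩
    · obtain ⟨y, hy, h⟩ := hp.step hns hm.rev hml hw.2 hc.rev hb hz hd hi
      refine ⟨y, Submodule.span_mono ?_ hy, h⟩
      rintro x (⟨rfl, h⟩ | ⟨rfl, h⟩)
      · exact Or.inr ⟨_, rfl, h⟩
      · exact Or.inl ⟨-l, rfl, by simpa using h⟩

theorem flow_mem (hm : w.Chain o m) {v : V} (hv : w.vertex i = some v) {x : Res D M}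
    (hx : x ∈ flow b P w m i) : x ∈ vertexSpace D M v := by
  refine Submodule.span_le.2 ?_ hx
  rintro x (⟨l, rfl, h⟩ | ⟨l, rfl, h⟩)
  · obtain ⟨v', h1, h2, -⟩ := h.same
    refine hm.mem l v ?_
    rw [h1, ← h2, hv]
  · obtain ⟨v', h1, h2, -⟩ := h.same
    refine hm.rev.mem l v ?_
    rw [h1, ← h2, hv]

/-- Where w ends, a strictly smaller word continues with a direct letter and its entry lies in the
image of that arrow, hence in 1^-. An equal word also ends, and then only 1^+ is known. -/
theorem pair_end {v : V} (hm : u.Chain o m) (hmp : u.RightPlus m)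
    (hv : w.vertex i = some v) (hz : w.letter (i + 1) = none) (h : Pair b P u l w i) :
    m l ∈ trivialMinus M S v (w.sgn i) ∨ (b ∧ m l ∈ trivialPlus M S v (w.sgn i)) := by
  obtain ⟨v', hv1, hv2, hsg⟩ := h.same
  obtain rfl : v' = v := Option.some_injective _ (hv2.symm.trans hv)
  have hnone : ∀ k, w.read i k = none := fun k => w.right_none i _ hv hz _ (by omega)
  rcases hx : u.letter (l + 1) with _ | x
  · have hnone' : ∀ k, u.read l k = none := fun k => u.right_none l _ hv1 hx _ (by omega)
    have e : u.read l = w.read i := by funext k; rw [hnone, hnone']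
    have hr := h.right
    rw [e] at hr
    rcases hr with hr | hr
    · exact absurd hr LexLT.irrefl
    · exact Or.inr ⟨hr.1, by rw [← hsg]; exact hmp l _ hv1 hx⟩
  · have h1 := LexRel.succ_iff.1 h.right
    rw [read_zero, read_zero, hz, hx] at h1
    rcases h1 with h1 | h1
    · cases x with
      | dir a ha =>
        left
        have h2 := hm.rel _ _ hx
        rw [add_sub_cancel_right] at h2
        refine Submodule.mem_iSup_of_mem a (Submodule.mem_iSup_of_mem ⟨?_, ?_⟩ ⟨_, h2.1, h2.2⟩)
        · exact Option.some_injective _ ((head_of_letter hx).symm.trans hv1)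
        · rw [star_dir_of_notMem ha, u.sgn_letter _ _ hx, hsg]
      | inv a ha => simp [Letter.rank] at h1
      | star s hs => simp [Letter.rank] at h1
    · exact absurd h1.1 (by simp)

theorem flow_end {v : V} (hm : w.Chain o m) (hw : w.Adm) (hmp : w.RightPlus m)
    (hml : w.rev.RightPlus (fun i => m (-i)))
    (hv : w.vertex i = some v) (hz : w.letter (i + 1) = none) {x : Res D M}
    (hx : x ∈ flow b P w m i) :
    x ∈ trivialPlus M S v (w.sgn i) ∧ (¬ b → x ∈ trivialMinus M S v (w.sgn i)) := by
  have hle := trivialMinus_le_trivialPlus (M := M) (hw.1 i v hv hz)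
  constructor
  · refine Submodule.span_le.2 ?_ hx
    rintro x (⟨l, rfl, h⟩ | ⟨l, rfl, h⟩)
    · rcases pair_end hm hmp hv hz h with h | h
      · exact hle h
      · exact h.2
    · rcases pair_end hm.rev hml hv hz h with h | h
      · exact hle h
      · exact h.2
  · intro hb
    refine Submodule.span_le.2 ?_ hx
    rintro x (⟨l, rfl, h⟩ | ⟨l, rfl, h⟩)
    · rcases pair_end hm hmp hv hz h with h | h
      · exact h
      · exact absurd h.1 hb
    · rcases pair_end hm.rev hml hv hz h with h | h
      · exact h
      · exact absurd h.1 hb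

end Step

end Strand

/-! ### One-sided corrections and the reorientation of one letter -/

namespace Strand

open SemilinearClannishData

section Half

variable {K V A : Type*} [DivisionRing K] [Fintype V] {D : SemilinearClannishData K V A}
  {S : SignChoice D} {M : Type*} [AddCommGroup M] [Module D.Alg M]
  {w : Strand S} {o o' : ℤ → Prop} {m : ℤ → Res D M} {b : Prop} {P : ℕ∞}

/-- A family on `[k, ∞)` linked by the letters of `w` with orientation `o`. -/
def HalfRel (w : Strand S) (o : ℤ → Prop) (k : ℤ) (q : ℤ → Res D M) : Prop :=
  ∀ i, k ≤ i → ∀ z, w.letter (i + 1) = some z →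
    LetterRel (q i) (q (i + 1)) (z.orient (o (i + 1)))

theorem exists_halfRel {k : ℤ} (Q : ℤ → Submodule K (Res D M)) {x : Res D M} (hx : x ∈ Q k)
    (hQ : ∀ i, k ≤ i → ∀ x ∈ Q i, ∃ y ∈ Q (i + 1), ∀ z, w.letter (i + 1) = some z →
      LetterRel x y (z.orient (o (i + 1)))) :
    ∃ q : ℤ → Res D M, q k = x ∧ (∀ i, k ≤ i → q i ∈ Q i) ∧ w.HalfRel o k q := by
  choose! f hf hf' using hQ
  let g : ℕ → Res D M := fun n => Nat.rec x (fun n y => f (k + n) y) n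
  have hg : ∀ n, g (n + 1) = f (k + n) (g n) := fun _ => rfl
  have hgQ : ∀ n : ℕ, g n ∈ Q (k + n) := by
    intro n
    induction n with
    | zero => simpa [g] using hx
    | succ n ih =>
      have := hf (k + n) (by omega) _ ih
      rw [hg]
      convert this using 2; push_cast; ring
  refine ⟨fun i => g (i - k).toNat, by simp [g], fun i hi => ?_, fun i hi z hz => ?_⟩
  · have := hgQ (i - k).toNat
    rwa [show k + ((i - k).toNat : ℤ) = i by omega] at this
  · have e : (i + 1 - k).toNat = (i - k).toNat + 1 := by omega
    have e' : k + ((i - k).toNat : ℤ) = i := by omega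
    simp only [e, hg, e']
    refine hf' i hi _ ?_ z hz
    have := hgQ (i - k).toNat
    rwa [e'] at this

/-- The correction chain is obtained by iterating `flow_step`. A new orientation that violates the
required bounds does no harm once the flow has vanished. -/
theorem exists_flow (hns : D.NonSingularType) (hm : w.Chain o m) (hmp : w.RightPlus m)
    (hml : w.rev.RightPlus (fun i => m (-i))) (hw : w.Adm) (hc : Compat P w o) (hb : b → P = ⊤)
    {k : ℤ} {x : Res D M} (hx : x ∈ flow b P w m k)
    (hd : ∀ i, k < i → o' i → ∀ s hs, w.letter i = some (.star s hs) →
      LexRel True P (w.read i) (w.readL (i - 1)))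
    (hi : ∀ i, k < i → ¬ o' i → ∀ s hs, w.letter i = some (.star s hs) →
      LexRel b P (w.readL (i - 1)) (w.read i) ∨ ∃ J, k ≤ J ∧ J < i ∧ flow b P w m J = ⊥) :
    ∃ q : ℤ → Res D M, q k = x ∧ (∀ i, k ≤ i → q i ∈ flow b P w m i) ∧ w.HalfRel o' k q ∧
      ∀ i J, k ≤ J → J ≤ i → flow b P w m J = ⊥ → q i = 0 := by
  classical
  -- After the first zero flow the family is forced to be zero, since flows further on need not be.
  let Q : ℤ → Submodule K (Res D M) := fun i =>
    if ∃ J, k ≤ J ∧ J ≤ i ∧ flow b P w m J = ⊥ then ⊥ else flow b P w m i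
  have hQ : ∀ i, Q i ≤ flow b P w m i := by
    intro i
    by_cases h : ∃ J, k ≤ J ∧ J ≤ i ∧ flow b P w m J = ⊥
    · simp [Q, h]
    · simp [Q, h]
  have hxQ : x ∈ Q k := by
    by_cases h : ∃ J, k ≤ J ∧ J ≤ k ∧ flow b P w m J = ⊥
    · obtain ⟨J, h1, h2, h3⟩ := h
      obtain rfl : J = k := le_antisymm h2 h1
      rw [h3, Submodule.mem_bot] at hx
      rw [hx]; exact zero_mem _
    · simpa only [Q, h, if_false] using hx
  obtain ⟨q, h0, hq, hr⟩ := exists_halfRel (w := w) (o := o') Q hxQ (by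
    intro i hki x hx
    by_cases h : ∃ J, k ≤ J ∧ J ≤ i ∧ flow b P w m J = ⊥
    · simp only [Q, h, if_true, Submodule.mem_bot] at hx
      exact ⟨0, zero_mem _, fun z _ => by rw [hx]; exact LetterRel.zero _⟩
    rcases hz : w.letter (i + 1) with _ | z
    · exact ⟨0, zero_mem _, fun z hz' => by simp at hz'⟩
    obtain ⟨y, hy, hxy⟩ := flow_step (oz := o' (i + 1)) hns hm hmp hml hw hc hb hz
      (by
        rintro ho s hs rfl
        simpa using hd _ (by omega) ho s hs hz)
      (by
        rintro ho s hs rfl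
        rcases hi _ (by omega) ho s hs hz with h1 | ⟨J, h1, h2, h3⟩
        · simpa using h1
        · exact absurd ⟨J, h1, by omega, h3⟩ h)
      (hQ i hx)
    refine ⟨y, ?_, fun z' hz' => by obtain rfl : z = z' := by simpa using hz'
                                    exact hxy⟩
    by_cases h' : ∃ J, k ≤ J ∧ J ≤ i + 1 ∧ flow b P w m J = ⊥
    · obtain ⟨J, h1, h2, h3⟩ := h'
      have hJ : J = i + 1 := by
        by_contra hne
        exact h ⟨J, h1, by omega, h3⟩
      rw [hJ] at h3
      rw [h3, Submodule.mem_bot] at hy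
      rw [hy]; exact zero_mem _
    · simpa only [Q, h', if_false] using hy)
  refine ⟨q, h0, fun i hi => hQ i (hq i hi), hr, fun i J h1 h2 h3 => ?_⟩
  have := hq i (h1.trans h2)
  have h : ∃ J, k ≤ J ∧ J ≤ i ∧ flow b P w m J = ⊥ := ⟨J, h1, h2, h3⟩
  simpa only [Q, h, if_true, Submodule.mem_bot] using this

/-- Changing the orientation of the letter at `k`. -/
theorem Chain.flip (hns : D.NonSingularType) (hm : w.Chain o m) {k : ℤ} {s : A} {hs : s ∈ D.Sp}
    (hk : w.letter k = some (.star s hs)) (ho : ∀ i, i ≠ k → (o' i ↔ o i)) (hok : o' k ↔ ¬ o k)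
    {q : ℤ → Res D M} (hq0 : q k = m (k - 1))
    (hqm : ∀ i, k ≤ i → ∀ v, w.vertex i = some v → q i ∈ vertexSpace D M v)
    (hq : w.HalfRel o k q) :
    ∃ c d : ℤ → K, (∀ i, c i ≠ 0) ∧
      w.Chain o' (fun i => if i < k then m i else c i • m i + d i • q i) := by
  have h1 := hm.rel k _ hk
  obtain ⟨c, d, hc, hcd⟩ := h1.switch hns hs hok
  -- The scalars obtained at k are spread to the right by automorphisms normalised at k, so that the
  -- combination is linked by the same letters.
  obtain ⟨π, hπ1, hπ⟩ := w.exists_twist o k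
  refine ⟨fun i => π i c, fun i => π i d, fun i => by simpa using hc,
    fun i v hv => ?_, fun i x hx => ?_⟩
  · by_cases h : i < k
    · simpa only [h, if_true] using hm.mem i v hv
    · simp only [h, if_false]
      exact add_mem (Submodule.smul_mem _ _ (hm.mem i v hv))
        (Submodule.smul_mem _ _ (hqm i (by omega) v hv))
  · rcases lt_trichotomy i k with h | rfl | h
    · have h' : i - 1 < k := by omega
      simp only [h, h', if_true]
      rw [propext (ho i h.ne)]
      exact hm.rel i x hx
    · obtain rfl : Letter.star s hs = x := by simpa [hk] using hx
      have h' : i - 1 < i := by omega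
      simp only [h', if_true, lt_irrefl, if_false, hπ1, hq0]
      exact hcd
    · have h' : ¬ i - 1 < k := by omega
      have h'' : ¬ i < k := by omega
      simp only [h', h'', if_false]
      rw [propext (ho i h.ne')]
      have h2 := hq (i - 1) (by omega) x (by simpa using hx)
      rw [sub_add_cancel] at h2
      exact ((hm.rel i x hx).smul (fun a ha => hπ.dir i x a hx ha)
        (fun a ha => hπ.inv i x a hx ha) c).add (h2.smul (fun a ha => hπ.dir i x a hx ha)
        (fun a ha => hπ.inv i x a hx ha) d)

end Half

/-! ### Transformations of chains and their limits -/

section Moves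

variable {K V A : Type*} [DivisionRing K] [Fintype V] {D : SemilinearClannishData K V A}
  {S : SignChoice D} {M : Type*} [AddCommGroup M] [Module D.Alg M]

/-- A chain satisfying the conditions `1^+` at both ends. -/
structure Good (w : Strand S) (o : ℤ → Prop) (m : ℤ → Res D M) : Prop where
  chain : w.Chain o m
  right : w.RightPlus m
  left : w.rev.RightPlus (fun i => m (-i))

/-- The condition `1^-` at a left end. -/
def LeftMinus (w : Strand S) (m : ℤ → Res D M) : Prop := w.rev.RightMinus (fun i => m (-i))

variable {w : Strand S} {o o' o'' : ℤ → Prop} {m m' : ℤ → Res D M}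

theorem Good.rev (h : w.Good o m) : w.rev.Good (orev o) (fun i => m (-i)) :=
  ⟨h.chain.rev, h.left, by simpa using h.right⟩

theorem Good.congr (h : w.Good o m)
    (ho : ∀ i s hs, w.letter i = some (.star s hs) → (o i ↔ o' i)) : w.Good o' m :=
  ⟨h.chain.congr ho, h.right, h.left⟩

theorem RightPlus.congr {n : ℤ → Res D M}
    (hm : w.RightPlus m) (h : ∀ i, ∃ c : K, n i = c • m i) : w.RightPlus n := by
  intro i v hv hi
  obtain ⟨c, hc⟩ := h i
  rw [hc]
  exact Submodule.smul_mem _ _ (hm i v hv hi)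

theorem RightMinus.congr {n : ℤ → Res D M}
    (hm : w.RightMinus m) (h : ∀ i, ∃ c : K, n i = c • m i) : w.RightMinus n := by
  intro i v hv hi
  obtain ⟨c, hc⟩ := h i
  rw [hc]
  exact Submodule.smul_mem _ _ (hm i v hv hi)

theorem Good.smul (h : w.Good o m) {π : ℤ → RingAut K} (hπ : w.Twist o π) (l : K) :
    w.Good o (fun i => π i l • m i) :=
  ⟨h.chain.smul hπ l, h.right.congr fun _ => ⟨_, rfl⟩, h.left.congr fun _ => ⟨_, rfl⟩⟩

variable (M) in
/-- Every chain for `o` can be changed to a chain for `o'`, without changing it on `T`, and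
preserving conditions `1^-` at the ends and vanishing on rays ending in `G`. -/
def Moves (w : Strand S) (o o' : ℤ → Prop) (T G : Set ℤ) : Prop :=
  ∀ m : ℤ → Res D M, w.Good o m → ∃ m', w.Good o' m' ∧ (∀ i ∈ T, m' i = m i) ∧
    (w.RightMinus m → w.RightMinus m') ∧ (w.LeftMinus m → w.LeftMinus m') ∧
    (∀ a ∈ G, (∀ i, a ≤ i → m i = 0) → ∀ i, a ≤ i → m' i = 0) ∧
    (∀ a ∈ G, (∀ i, i ≤ a → m i = 0) → ∀ i, i ≤ a → m' i = 0)

variable {T T' G G' : Set ℤ}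

theorem Moves.mono (h : Moves M w o o' T G) (hT : T' ⊆ T) (hG : G' ⊆ G) :
    Moves M w o o' T' G' := by
  intro m hm
  obtain ⟨m', h1, h2, h3, h4, h5, h6⟩ := h m hm
  exact ⟨m', h1, fun i hi => h2 i (hT hi), h3, h4, fun a ha => h5 a (hG ha),
    fun a ha => h6 a (hG ha)⟩

theorem Moves.trans (h : Moves M w o o' T G) (h' : Moves M w o' o'' T G) :
    Moves M w o o'' T G := by
  intro m hm
  obtain ⟨m', h1, h2, h3, h4, h5, h6⟩ := h m hm
  obtain ⟨m'', g1, g2, g3, g4, g5, g6⟩ := h' m' h1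
  exact ⟨m'', g1, fun i hi => (g2 i hi).trans (h2 i hi), g3 ∘ h3, g4 ∘ h4,
    fun a ha h => g5 a ha (h5 a ha h), fun a ha h => g6 a ha (h6 a ha h)⟩

theorem Moves.of_congr (ho : ∀ i s hs, w.letter i = some (.star s hs) → (o i ↔ o' i)) :
    Moves M w o o' T G :=
  fun m hm => ⟨m, hm.congr ho, fun _ _ => rfl, id, id, fun _ _ => id, fun _ _ => id⟩

/-- The sets on which the stages are constant grow. The relation at i involves only the entries at i
- 1 and i; once both are frozen and the orientation has its final value there, it passes to the
limit. -/
theorem Moves.limit (on : ℕ → ℤ → Prop) (Tn : ℕ → Set ℤ) (hT : Monotone Tn)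
    (h : ∀ n, Moves M w (on n) (on (n + 1)) (Tn n) G)
    (ho : ∀ i, ∃ n, i ∈ Tn n ∧ i - 1 ∈ Tn n ∧ (o' i ↔ on n i)) :
    Moves M w (on 0) o' (Tn 0) G := by
  intro m hm
  choose f hf using h
  let g : (n : ℕ) → {m : ℤ → Res D M // w.Good (on n) m} := fun n =>
    Nat.rec ⟨m, hm⟩ (fun n m' => ⟨f n m'.1 m'.2, (hf n m'.1 m'.2).1⟩) n
  have hg : ∀ n, (g (n + 1)).1 = f n (g n).1 (g n).2 := fun _ => rfl
  have hstep : ∀ n, _ := fun n => (hf n (g n).1 (g n).2).2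
  have hmono : ∀ i n n', n ≤ n' → i ∈ Tn n → (g n').1 i = (g n).1 i := by
    intro i n n' hn hi
    induction n', hn using Nat.le_induction with
    | base => rfl
    | succ n' hn ih =>
      rw [hg, (hstep n').1 i (hT hn hi), ih]
  choose N hN1 hN2 hN3 using ho
  have hlim : ∀ i n, i ∈ Tn n → (g (N i)).1 i = (g n).1 i := by
    intro i n hi
    rw [← hmono i n (max n (N i)) (le_max_left _ _) hi,
      hmono i (N i) (max n (N i)) (le_max_right _ _) (hN1 i)]
  have hpt : ∀ i, ∃ n, (g (N i)).1 i = (g n).1 i ∧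
      (g (N (i - 1))).1 (i - 1) = (g n).1 (i - 1) ∧
      (o' i ↔ on n i) := fun i =>
    ⟨N i, rfl, hlim _ _ (hN2 i), hN3 i⟩
  refine ⟨fun i => (g (N i)).1 i, ⟨⟨?_, ?_⟩, ?_, ?_⟩, ?_, ?_, ?_, ?_, ?_⟩
  · exact fun i v hv => (g (N i)).2.chain.mem i v hv
  · intro i x hx
    obtain ⟨n, h1, h2, h3⟩ := hpt i
    simp only [h1, h2]
    rw [propext h3]
    exact (g n).2.chain.rel i x hx
  · exact fun i v hv hi => (g (N i)).2.right i v hv hi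
  · exact fun i v hv hi => (g (N (-i))).2.left i v hv hi
  · exact fun i hi => hlim i 0 hi
  · intro hr i v hv hi
    have : ∀ n, w.RightMinus (g n).1 := by
      intro n
      induction n with
      | zero => exact hr
      | succ n ih => rw [hg]; exact (hstep n).2.1 ih
    exact this _ i v hv hi
  · intro hr i v hv hi
    have : ∀ n, w.LeftMinus (g n).1 := by
      intro n
      induction n with
      | zero => exact hr
      | succ n ih => rw [hg]; exact (hstep n).2.2.1 ih
    exact this _ i v hv hi
  · intro a ha hz i hi
    have : ∀ n, ∀ i, a ≤ i → (g n).1 i = 0 := by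
      intro n
      induction n with
      | zero => exact hz
      | succ n ih => rw [hg]; exact (hstep n).2.2.2.1 a ha ih
    exact this _ i hi
  · intro a ha hz i hi
    have : ∀ n, ∀ i, i ≤ a → (g n).1 i = 0 := by
      intro n
      induction n with
      | zero => exact hz
      | succ n ih => rw [hg]; exact (hstep n).2.2.2.2 a ha ih
    exact this _ i hi

end Moves

end Strand

/-! ### Flipping ties inside one block -/

namespace Strand

open SemilinearClannishData

section Sets

variable {K V A : Type*} [DivisionRing K] {D : SemilinearClannishData K V A} {S : SignChoice D}

/-- The positions of `*`-letters at which the words on the left and on the right agree up to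
depth `P`, and then the one on the left is smaller. -/
def tieSet (P : ℕ∞) (w : Strand S) : Set ℤ :=
  {k | (∃ s hs, w.letter k = some (.star s hs)) ∧ EqUpTo P (w.readL (k - 1)) (w.read k) ∧
    LexLT (P + 1) (w.readL (k - 1)) (w.read k)}

/-- No word is bounded by the one at `J` in the sense of `Pair`. -/
def Halt (P : ℕ∞) (w : Strand S) (J : ℤ) : Prop :=
  (∀ l, ¬ Pair False P w l w J) ∧ ∀ l, ¬ Pair False P w.rev l w J

/-- Outside the index set there is nothing to compare with, so every position there is a halting
point. -/
theorem halt_of_vertex {P : ℕ∞} {w : Strand S} {J : ℤ} (h : w.vertex J = none) : Halt P w J := by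
  constructor <;>
  · rintro l ⟨⟨v, -, hv, -⟩, -, -⟩
    simp [h] at hv

theorem lt_of_left_end {w : Strand S} {k i : ℤ} {x : Letter D} (hk : w.letter k = some x) {v : V}
    (hv : w.rev.vertex i = some v) (hi : w.rev.letter (i + 1) = none) : -i < k := by
  by_contra hcon
  rw [rev_letter, Option.map_eq_none_iff] at hi
  have := w.left_none (-i) v hv (by rw [← hi]; congr 1; ring) k (by omega)
  simp [hk] at this

/-- The orientation obtained from `o` by changing the letters of `tieSet P w` in `T` to `s⁻¹`. -/
def flipOn (P : ℕ∞) (w : Strand S) (o : ℤ → Prop) (T : Set ℤ) (i : ℤ) : Prop :=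
  o i ∧ ¬ (i ∈ T ∧ i ∈ tieSet P w)

theorem Compat.flipOn {P : ℕ∞} {w : Strand S} {o : ℤ → Prop} (hc : Compat P w o) (T : Set ℤ) : Compat P w (flipOn P w o T) := by
  refine ⟨fun i s hs h hi => hc.dir i s hs h hi.1, fun i s hs h hi => ?_⟩
  by_cases hoi : o i
  · have : i ∈ T ∧ i ∈ tieSet P w := by
      by_contra hcon
      exact hi ⟨hoi, hcon⟩
    exact this.2.2.1.le
  · exact hc.inv i s hs h hoi

end Sets

section Sweep

variable {K V A : Type*} [DivisionRing K] [Fintype V] {D : SemilinearClannishData K V A}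
  {S : SignChoice D} {M : Type*} [AddCommGroup M] [Module D.Alg M]
  {w : Strand S} {o o' o'' : ℤ → Prop} {m : ℤ → Res D M} {P : ℕ∞} {J J' : ℤ}

theorem Halt.flow_eq_bot (h : Halt P w J) : flow False P w m J = ⊥ := by
  rw [flow, Submodule.span_eq_bot]
  rintro x (⟨l, -, hl⟩ | ⟨l, -, hl⟩)
  · exact absurd hl (h.1 l)
  · exact absurd hl (h.2 l)

variable (M) in
/-- Every chain for `o` can be changed to a chain for `o'`, without changing it up to `J`, and
up to non-zero scalars from `J'` on. -/
def Sweep (w : Strand S) (o o' : ℤ → Prop) (J J' : ℤ) : Prop :=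
  ∀ m : ℤ → Res D M, w.Good o m → ∃ m', w.Good o' m' ∧ (∀ i, i ≤ J → m' i = m i) ∧
    (∀ i, J' ≤ i → ∃ c : K, c ≠ 0 ∧ m' i = c • m i) ∧
    (w.RightMinus m → w.RightMinus m') ∧ (w.LeftMinus m → w.LeftMinus m')

theorem Sweep.trans (h : Sweep M w o o' J J') (h' : Sweep M w o' o'' J J') :
    Sweep M w o o'' J J' := by
  intro m hm
  obtain ⟨m', h1, h2, h3, h4, h5⟩ := h m hm
  obtain ⟨m'', g1, g2, g3, g4, g5⟩ := h' m' h1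
  refine ⟨m'', g1, fun i hi => (g2 i hi).trans (h2 i hi), fun i hi => ?_, g4 ∘ h4, g5 ∘ h5⟩
  obtain ⟨c, hc, e⟩ := h3 i hi
  obtain ⟨c', hc', e'⟩ := g3 i hi
  exact ⟨c' * c, mul_ne_zero hc' hc, by rw [e', e, smul_smul]⟩

theorem Sweep.of_congr (ho : ∀ i s hs, w.letter i = some (.star s hs) → (o i ↔ o' i)) :
    Sweep M w o o' J J' :=
  fun m hm => ⟨m, hm.congr ho, fun _ _ => rfl, fun _ _ => ⟨1, one_ne_zero, (one_smul _ _).symm⟩,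
    id, id⟩

/-- A letter in `tieSet` can be flipped because the word read backwards from it is smaller at depth
P + 1, so its left neighbour enters the flow. The correction lives from k up to the halting point
J'; beyond that only the scalars c_i remain. -/
theorem sweep_flip (hns : D.NonSingularType) (hw : w.Adm) (hc : Compat P w o) {k : ℤ}
    (hk : k ∈ tieSet P w) (hJk : J < k) (hkJ : k ≤ J')
    (hties : ∀ i, k < i → i ≤ J' → ¬ o i → ∀ s hs, w.letter i = some (.star s hs) →
      LexLT P (w.readL (i - 1)) (w.read i))
    (hhalt : Halt P w J') (ho : ∀ i, i ≠ k → (o' i ↔ o i)) (hok : o' k ↔ ¬ o k) :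
    Sweep M w o o' J J' := by
  intro m hm
  obtain ⟨⟨s, hs, hks⟩, heq, hlt⟩ := hk
  have hks' : w.letter (k - 1 + 1) = some (.star s hs) := by rwa [sub_add_cancel]
  -- The tie condition is exactly what this needs: the left side is strictly smaller at depth P + 1,
  -- while in the other direction agreement up to P gains the common *-letter.
  have hpair : Pair False P w.rev (-(k - 1)) w k := by
    refine ⟨?_, ?_, ?_⟩
    · have := sameAt_turn hks' hks'
      rwa [sub_add_cancel] at this
    · rw [rev_read, neg_neg]
      exact hlt.rel
    · have h1 := readL_succ_zero hks'
      have h2 := readL_tail w (k - 1)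
      rw [sub_add_cancel] at h1 h2
      rw [rev_readL, neg_neg, LexRel.succ_iff, h1, h2, read_tail, read_zero, hks', sub_add_cancel]
      exact Or.inr ⟨rfl, heq.symm.le⟩
  have hx : m (k - 1) ∈ flow False P w m k :=
    Submodule.subset_span (Or.inr ⟨_, by rw [neg_neg], hpair⟩)
  obtain ⟨q, hq0, hqf, hqr, hqz⟩ := exists_flow (o' := o) hns hm.chain hm.right hm.left hw hc
    (fun h => h.elim) hx (fun i _ hi s hs h => hc.dir i s hs h hi) (by
      intro i hi hoi s hs h
      by_cases hiJ : i ≤ J'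
      · exact Or.inl (hties i hi hiJ hoi s hs h).rel
      · exact Or.inr ⟨J', hkJ, by omega, hhalt.flow_eq_bot⟩)
  obtain ⟨c, d, hc0, hch⟩ := hm.chain.flip hns hks ho hok hq0
    (fun i hi v hv => flow_mem hm.chain hv (hqf i hi)) hqr
  have hleft : ∀ {i : ℤ} {v : V}, w.rev.vertex i = some v → w.rev.letter (i + 1) = none →
      -i < k := fun hv hi => lt_of_left_end hks hv hi
  refine ⟨_, ⟨hch, ?_, ?_⟩, ?_, ?_, ?_, ?_⟩
  · intro i v hv hi
    by_cases h : i < k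
    · simpa only [h, if_true] using hm.right i v hv hi
    · simp only [h, if_false]
      exact add_mem (Submodule.smul_mem _ _ (hm.right i v hv hi)) (Submodule.smul_mem _ _
        (flow_end hm.chain hw hm.right hm.left hv hi (hqf i (by omega))).1)
  · intro i v hv hi
    simpa only [hleft hv hi, if_true] using hm.left i v hv hi
  · intro i hi
    have : i < k := by omega
    simp only [this, if_true]
  · intro i hi
    have : ¬ i < k := by omega
    refine ⟨c i, hc0 i, ?_⟩
    simp only [this, if_false, hqz i J' hkJ hi hhalt.flow_eq_bot, smul_zero, add_zero]
  · intro hr i v hv hi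
    by_cases h : i < k
    · simpa only [h, if_true] using hr i v hv hi
    · simp only [h, if_false]
      exact add_mem (Submodule.smul_mem _ _ (hr i v hv hi)) (Submodule.smul_mem _ _
        ((flow_end hm.chain hw hm.right hm.left hv hi (hqf i (by omega))).2 id))
  · intro hr i v hv hi
    simpa only [hleft hv hi, if_true] using hr i v hv hi

/-- Flipping from left to right, and undoing the flips from right to left, keeps the strict
inequality at every inverse letter still to be crossed: the flipped ties, where only equality holds,
always lie behind. -/
theorem sweep_block (hns : D.NonSingularType) (hw : w.Adm) (hc : Compat P w o)
    (hties : ∀ i, J < i → i ≤ J' → ¬ o i → ∀ s hs, w.letter i = some (.star s hs) →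
      LexLT P (w.readL (i - 1)) (w.read i))
    (hhalt : Halt P w J') (n : ℕ) (hn : J + n ≤ J') :
    Sweep M w o (flipOn P w o (Set.Ioc J (J + n))) J J' ∧
      Sweep M w (flipOn P w o (Set.Ioc J (J + n))) o J J' := by
  have hkey : ∀ i, J < i → i ≤ J' → i ∈ tieSet P w → o i := by
    intro i h1 h2 h3
    by_contra hoi
    obtain ⟨⟨s, hs, h⟩, h4, -⟩ := h3
    exact (hties i h1 h2 hoi s hs h).not_eq h4
  induction n with
  | zero =>
    constructor <;>
    · refine Sweep.of_congr fun i s hs _ => ?_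
      simp [flipOn]
  | succ n ih =>
    obtain ⟨ih1, ih2⟩ := ih (by push_cast at hn; omega)
    have hne : ∀ i, i ≠ J + n + 1 → (flipOn P w o (Set.Ioc J (J + (n + 1 : ℕ))) i ↔
        flipOn P w o (Set.Ioc J (J + n)) i) := by
      intro i hi
      have : i ∈ Set.Ioc J (J + (n + 1 : ℕ)) ↔ i ∈ Set.Ioc J (J + n) := by
        simp only [Set.mem_Ioc]; push_cast; omega
      simp only [flipOn, this]
    have htie : ∀ T, T ⊆ Set.Ioc J (J + (n + 1 : ℕ)) → ∀ i, J + n + 1 < i → i ≤ J' →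
        ¬ flipOn P w o T i → ∀ s hs, w.letter i = some (.star s hs) →
          LexLT P (w.readL (i - 1)) (w.read i) := by
      intro T hT i h1 h2 h3 s hs h
      refine hties i (by omega) h2 (fun hoi => h3 ⟨hoi, fun h4 => ?_⟩) s hs h
      have := (hT h4.1).2
      push_cast at this
      omega
    by_cases hk : J + n + 1 ∈ tieSet P w
    · have hkJ : J + n + 1 ≤ J' := by push_cast at hn; omega
      have hok := hkey _ (by omega) hkJ hk
      have h1 : flipOn P w o (Set.Ioc J (J + n)) (J + n + 1) := by
        refine ⟨hok, fun h => ?_⟩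
        have := h.1.2
        omega
      have h2 : ¬ flipOn P w o (Set.Ioc J (J + (n + 1 : ℕ))) (J + n + 1) := by
        rintro ⟨-, h⟩
        refine h ⟨⟨by omega, by push_cast; omega⟩, hk⟩
      have hsub : Set.Ioc J (J + n) ⊆ Set.Ioc J (J + (n + 1 : ℕ)) :=
        Set.Ioc_subset_Ioc_right (by push_cast; omega)
      exact ⟨ih1.trans (sweep_flip hns hw (hc.flipOn _) hk (by omega) hkJ (htie _ hsub) hhalt hne
          (by tauto)),
        (sweep_flip hns hw (hc.flipOn _) hk (by omega) hkJ (htie _ subset_rfl) hhalt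
          (fun i hi => (hne i hi).symm) (by tauto)).trans ih2⟩
    · have hcongr : ∀ i, (flipOn P w o (Set.Ioc J (J + n)) i ↔
          flipOn P w o (Set.Ioc J (J + (n + 1 : ℕ))) i) := by
        intro i
        by_cases hi : i = J + n + 1
        · subst hi
          simp [flipOn, hk]
        · exact (hne i hi).symm
      exact ⟨ih1.trans (Sweep.of_congr fun i _ _ _ => hcongr i),
        (Sweep.of_congr fun i _ _ _ => (hcongr i).symm).trans ih2⟩

/-- Between two zero entries the orientation of the letter is irrelevant. -/
theorem Good.of_zero (hm : w.Good o m) (ho : ∀ i, (o' i ↔ o i) ∨ (m (i - 1) = 0 ∧ m i = 0)) :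
    w.Good o' m := by
  refine ⟨⟨hm.chain.mem, fun i x hx => ?_⟩, hm.right, hm.left⟩
  rcases ho i with h | ⟨h1, h2⟩
  · rw [propext h]; exact hm.chain.rel i x hx
  · rw [h1, h2]; exact LetterRel.zero _

/-- A sweep over a block gives a move which does not change anything up to `J`. -/
theorem Sweep.moves_right (h : Sweep M w o o' J J')
    (ho : ∀ i, i ≤ J ∨ J' < i → (o' i ↔ o i)) :
    Moves M w o o' (Set.Iic J) (Set.Ioo J J')ᶜ := by
  intro m hm
  -- The correction may be non-zero where m vanishes. A ray of zeros ending outside the open block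
  -- either avoids its interior or covers the whole block, and in the second case m is left as it
  -- is.
  by_cases hz1 : ∀ i, J ≤ i → m i = 0
  · refine ⟨m, hm.of_zero fun i => ?_, fun _ _ => rfl, id, id, fun _ _ => id, fun _ _ => id⟩
    by_cases hi : i ≤ J
    · exact Or.inl (ho i (Or.inl hi))
    · exact Or.inr ⟨hz1 _ (by omega), hz1 _ (by omega)⟩
  by_cases hz2 : ∀ i, i ≤ J' → m i = 0
  · refine ⟨m, hm.of_zero fun i => ?_, fun _ _ => rfl, id, id, fun _ _ => id, fun _ _ => id⟩
    by_cases hi : J' < i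
    · exact Or.inl (ho i (Or.inr hi))
    · exact Or.inr ⟨hz2 _ (by omega), hz2 _ (by omega)⟩
  obtain ⟨m', h1, h2, h3, h4, h5⟩ := h m hm
  refine ⟨m', h1, h2, h4, h5, fun a ha h i hi => ?_, fun a ha h i hi => ?_⟩
  · have : J' ≤ a := by
      by_contra hcon
      refine hz1 fun i hi => h i (le_trans ?_ hi)
      by_contra hcon'
      exact ha ⟨by omega, by omega⟩
    obtain ⟨c, -, hc⟩ := h3 i (this.trans hi)
    rw [hc, h i hi, smul_zero]
  · have : a ≤ J := by
      by_contra hcon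
      refine hz2 fun i hi => h i (hi.trans ?_)
      by_contra hcon'
      exact ha ⟨by omega, by omega⟩
    rw [h2 i (hi.trans this), h i hi]

/-- A sweep over a block gives a move which does not change anything from `J'` on. -/
theorem Sweep.moves_left (h : Sweep M w o o' J J') (hJ : J ≤ J')
    (ho : ∀ i, i ≤ J ∨ J' < i → (o' i ↔ o i)) :
    Moves M w o o' (Set.Ici J') (Set.Ioo J J')ᶜ := by
  intro m hm
  by_cases hz1 : ∀ i, J ≤ i → m i = 0
  · refine ⟨m, hm.of_zero fun i => ?_, fun _ _ => rfl, id, id, fun _ _ => id, fun _ _ => id⟩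
    by_cases hi : i ≤ J
    · exact Or.inl (ho i (Or.inl hi))
    · exact Or.inr ⟨hz1 _ (by omega), hz1 _ (by omega)⟩
  by_cases hz2 : ∀ i, i ≤ J' → m i = 0
  · refine ⟨m, hm.of_zero fun i => ?_, fun _ _ => rfl, id, id, fun _ _ => id, fun _ _ => id⟩
    by_cases hi : J' < i
    · exact Or.inl (ho i (Or.inr hi))
    · exact Or.inr ⟨hz2 _ (by omega), hz2 _ (by omega)⟩
  obtain ⟨m', h1, h2, h3, h4, h5⟩ := h m hm
  obtain ⟨c, hc0, hc⟩ := h3 J' le_rfl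
  -- The new chain equals c times m at J'; after multiplication by c⁻¹, normalised at J', it can be
  -- glued to the old chain on the right.
  obtain ⟨π, hπ1, hπ⟩ := w.exists_twist o' J'
  have h1' := h1.smul hπ c⁻¹
  set n : ℤ → Res D M := fun i => π i c⁻¹ • m' i with hn
  have hnJ : n J' = m J' := by
    simp only [hn, hπ1, hc]
    rw [RingAut.one_apply, smul_smul, inv_mul_cancel₀ hc0, one_smul]
  have hglue := h1'.chain.glue hm.chain hnJ (o' := o') (fun _ _ => Iff.rfl)
    (fun i hi => ho i (Or.inr hi))
  refine ⟨_, ⟨hglue, ?_, ?_⟩, ?_, ?_, ?_, ?_, ?_⟩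
  · intro i v hv hi
    by_cases hiJ : i ≤ J'
    · simpa only [hiJ, if_true] using h1'.right i v hv hi
    · simpa only [hiJ, if_false] using hm.right i v hv hi
  · intro i v hv hi
    by_cases hiJ : -i ≤ J'
    · simpa only [hiJ, if_true] using h1'.left i v hv hi
    · simpa only [hiJ, if_false] using hm.left i v hv hi
  · intro i hi
    by_cases hiJ : i ≤ J'
    · obtain rfl : i = J' := le_antisymm hiJ hi
      simpa using hnJ
    · simp only [hiJ, if_false]
  · intro hr i v hv hi
    by_cases hiJ : i ≤ J'
    · simp only [hiJ, if_true]
      exact (h4 hr).congr (n := n) (fun _ => ⟨_, rfl⟩) i v hv hi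
    · simpa only [hiJ, if_false] using hr i v hv hi
  · intro hr i v hv hi
    by_cases hiJ : -i ≤ J'
    · simp only [hiJ, if_true]
      exact (h5 hr).congr (n := fun i => n (-i)) (fun _ => ⟨_, rfl⟩) i v hv hi
    · simpa only [hiJ, if_false] using hr i v hv hi
  · intro a ha h i hi
    have : J' ≤ a := by
      by_contra hcon
      refine hz1 fun i hi => h i (le_trans ?_ hi)
      by_contra hcon'
      exact ha ⟨by omega, by omega⟩
    by_cases hiJ : i ≤ J'
    · simp only [show i = J' by omega, le_refl, if_true, hnJ]
      exact h J' (by omega)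
    · simp only [hiJ, if_false]
      exact h i hi
  · intro a ha h i hi
    have : a ≤ J := by
      by_contra hcon
      refine hz2 fun i hi => h i (hi.trans ?_)
      by_contra hcon'
      exact ha ⟨by omega, by omega⟩
    have hiJ : i ≤ J' := by omega
    simp only [hiJ, if_true, hn, h2 i (hi.trans this), h i hi, smul_zero]

end Sweep

end Strand

/-! ### Flipping all ties of one depth -/

namespace Strand

open SemilinearClannishData

theorem flipOn_flipOn {K V A : Type*} [DivisionRing K] {D : SemilinearClannishData K V A}
    {S : SignChoice D} (P : ℕ∞) (w : Strand S) (o : ℤ → Prop) (T T' : Set ℤ) :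
    flipOn P w (flipOn P w o T) T' = flipOn P w o (T ∪ T') := by
  funext i
  simp only [flipOn, Set.mem_union]
  exact propext (by tauto)

@[simp] theorem flipOn_empty {K V A : Type*} [DivisionRing K] {D : SemilinearClannishData K V A}
    {S : SignChoice D} (P : ℕ∞) (w : Strand S) (o : ℤ → Prop) : flipOn P w o ∅ = o := by
  funext i
  simp [flipOn]

theorem strictMono_add_le {J : ℤ → ℤ} (hJ : StrictMono J) (n : ℕ) (i : ℤ) :
    J i + n ≤ J (i + n) ∧ J (i - n) ≤ J i - n := by
  induction n with
  | zero => simp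
  | succ n ih =>
    have h1 := hJ (show i + (n : ℤ) < i + ((n + 1 : ℕ) : ℤ) by push_cast; omega)
    have h2 := hJ (show i - ((n + 1 : ℕ) : ℤ) < i - (n : ℤ) by push_cast; omega)
    push_cast at h1 h2 ⊢
    omega

section Stage

variable {K V A : Type*} [DivisionRing K] [Fintype V] {D : SemilinearClannishData K V A}
  {S : SignChoice D} {M : Type*} [AddCommGroup M] [Module D.Alg M]
  {w : Strand S} {o : ℤ → Prop} {P : ℕ∞} {J J' : ℤ}

theorem moves_block (hns : D.NonSingularType) (hw : w.Adm) (hc : Compat P w o) (hJ : J ≤ J')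
    (hties : ∀ i, J < i → i ≤ J' → ¬ o i → ∀ s hs, w.letter i = some (.star s hs) →
      LexLT P (w.readL (i - 1)) (w.read i))
    (hhalt : Halt P w J' ∨ ∀ i ∈ Set.Ioc J J', i ∉ tieSet P w) {T : Set ℤ}
    (hT : T ⊆ Set.Iic J ∨ T ⊆ Set.Ici J') :
    Moves M w o (flipOn P w o (Set.Ioc J J')) T (Set.Ioo J J')ᶜ ∧
      Moves M w (flipOn P w o (Set.Ioc J J')) o T (Set.Ioo J J')ᶜ := by
  rcases hhalt with hhalt | hhalt
  · obtain ⟨h1, h2⟩ := sweep_block (M := M) hns hw hc hties hhalt (J' - J).toNat (by omega)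
    rw [show J + ((J' - J).toNat : ℤ) = J' by omega] at h1 h2
    have ho : ∀ i, i ≤ J ∨ J' < i → (flipOn P w o (Set.Ioc J J') i ↔ o i) := by
      intro i hi
      have : i ∉ Set.Ioc J J' := by rintro ⟨h3, h4⟩; omega
      simp [flipOn, this]
    rcases hT with hT | hT
    · exact ⟨(h1.moves_right ho).mono hT subset_rfl,
        (h2.moves_right fun i hi => (ho i hi).symm).mono hT subset_rfl⟩
    · exact ⟨(h1.moves_left hJ ho).mono hT subset_rfl,
        (h2.moves_left hJ fun i hi => (ho i hi).symm).mono hT subset_rfl⟩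
  · have ho : ∀ i, (flipOn P w o (Set.Ioc J J') i ↔ o i) := by
      intro i
      simp only [flipOn, and_iff_left_iff_imp]
      rintro - ⟨h1, h2⟩
      exact hhalt i h1 h2
    exact ⟨Moves.of_congr fun i _ _ _ => (ho i).symm, Moves.of_congr fun i _ _ _ => ho i⟩

/-- Blocks are treated outwards from J 0, those on the right keeping everything to their left and
those on the left keeping everything to their right. The entry at J 0 never changes, and each entry
changes only finitely often. -/
theorem moves_flipOn (hns : D.NonSingularType) (hw : w.Adm) (hc : Compat P w o)
    (hties : ∀ i, ¬ o i → ∀ s hs, w.letter i = some (.star s hs) →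
      LexLT P (w.readL (i - 1)) (w.read i))
    {J : ℤ → ℤ} (hJ : StrictMono J)
    (hhalt : ∀ n, Halt P w (J (n + 1)) ∨ ∀ i ∈ Set.Ioc (J n) (J (n + 1)), i ∉ tieSet P w) :
    Moves M w o (flipOn P w o Set.univ) {J 0} (Set.range J) ∧
      Moves M w (flipOn P w o Set.univ) o {J 0} (Set.range J) := by
  have hG : ∀ n, Set.range J ⊆ (Set.Ioo (J n) (J (n + 1)))ᶜ := by
    rintro n _ ⟨i, rfl⟩ ⟨h1, h2⟩
    have := hJ.lt_iff_lt.1 h1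
    have := hJ.lt_iff_lt.1 h2
    omega
  let I : ℕ → Set ℤ := fun n => Set.Icc (J (-n)) (J n)
  have hI : Monotone I := by
    intro n n' hn
    exact Set.Icc_subset_Icc (hJ.monotone (by omega)) (hJ.monotone (by omega))
  have hI0 : I 0 = {J 0} := by simp [I]
  have hmem : ∀ i, ∃ n : ℕ, i ∈ Set.Ioc (J (-n)) (J n) ∧ i ∈ I n ∧ i - 1 ∈ I n := by
    intro i
    obtain ⟨h1, h2⟩ := strictMono_add_le hJ (i.natAbs + (J 0).natAbs + 1) 0
    rw [zero_add] at h1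
    rw [zero_sub] at h2
    refine ⟨i.natAbs + (J 0).natAbs + 1, ?_, ?_, ?_⟩ <;>
    · constructor <;> omega
  have hcast : ∀ n : ℕ, J (-((n + 1 : ℕ) : ℤ)) ≤ J (-n) ∧ J (-n) ≤ J n ∧ J n ≤ J ((n + 1 : ℕ)) :=
    fun n => ⟨hJ.monotone (by push_cast; omega), hJ.monotone (by omega),
      hJ.monotone (by push_cast; omega)⟩
  have hU1 : ∀ n : ℕ, Set.Ioc (J (-n)) (J n) ∪ Set.Ioc (J n) (J ((n + 1 : ℕ))) =
      Set.Ioc (J (-n)) (J (n + 1 : ℕ)) :=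
    fun n => Set.Ioc_union_Ioc_eq_Ioc (hcast n).2.1 (hcast n).2.2
  have hU2 : ∀ n : ℕ, Set.Ioc (J (-n)) (J (n + 1 : ℕ)) ∪
      Set.Ioc (J (-((n + 1 : ℕ) : ℤ))) (J (-n)) =
      Set.Ioc (J (-((n + 1 : ℕ) : ℤ))) (J (n + 1 : ℕ)) := fun n => by
    rw [Set.union_comm, Set.Ioc_union_Ioc_eq_Ioc (hcast n).1 ((hcast n).2.1.trans (hcast n).2.2)]
  have hR : ∀ (n : ℕ) (T : Set ℤ), (∀ i ∈ T, i ∉ Set.Ioc (J n) (J (n + 1 : ℕ))) →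
      Moves M w (flipOn P w o T) (flipOn P w (flipOn P w o T) (Set.Ioc (J n) (J (n + 1 : ℕ))))
        (I n) (Set.range J) ∧
      Moves M w (flipOn P w (flipOn P w o T) (Set.Ioc (J n) (J (n + 1 : ℕ)))) (flipOn P w o T)
        (I n) (Set.range J) := by
    intro n T hT
    have h := moves_block (M := M) hns hw (hc.flipOn T) (hcast n).2.2
      (fun i h1 h2 h3 => hties i fun h => h3 ⟨h, fun h4 => hT i h4.1 ⟨h1, h2⟩⟩)
      (by simpa using hhalt n) (T := I n) (Or.inl fun i hi => hi.2)
    exact ⟨h.1.mono subset_rfl (by simpa using hG n), h.2.mono subset_rfl (by simpa using hG n)⟩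
  have hL : ∀ (n : ℕ) (T : Set ℤ), (∀ i ∈ T, i ∉ Set.Ioc (J (-((n + 1 : ℕ) : ℤ))) (J (-n))) →
      Moves M w (flipOn P w o T)
        (flipOn P w (flipOn P w o T) (Set.Ioc (J (-((n + 1 : ℕ) : ℤ))) (J (-n))))
        (I n) (Set.range J) ∧
      Moves M w (flipOn P w (flipOn P w o T) (Set.Ioc (J (-((n + 1 : ℕ) : ℤ))) (J (-n))))
        (flipOn P w o T) (I n) (Set.range J) := by
    intro n T hT
    have e : -((n + 1 : ℕ) : ℤ) + 1 = -n := by push_cast; ring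
    have h := moves_block (M := M) hns hw (hc.flipOn T) (hcast n).1
      (fun i h1 h2 h3 => hties i fun h => h3 ⟨h, fun h4 => hT i h4.1 ⟨h1, h2⟩⟩)
      (by simpa only [e] using hhalt (-((n + 1 : ℕ) : ℤ))) (T := I n) (Or.inr fun i hi => hi.1)
    have hG' := hG (-((n + 1 : ℕ) : ℤ))
    rw [e] at hG'
    exact ⟨h.1.mono subset_rfl hG', h.2.mono subset_rfl hG'⟩
  constructor
  · have h := Moves.limit (M := M) (w := w) (G := Set.range J)
      (o' := flipOn P w o Set.univ)
      (fun n => flipOn P w o (Set.Ioc (J (-n)) (J n))) I hI (fun n => by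
        have h1 := (hR n (Set.Ioc (J (-n)) (J n)) (fun i hi h => by
          have := hi.2; have := h.1; omega)).1
        have h2 := (hL n (Set.Ioc (J (-n)) (J (n + 1 : ℕ))) (fun i hi h => by
          have := hi.1; have := h.2; omega)).1
        rw [flipOn_flipOn, hU1] at h1
        rw [flipOn_flipOn, hU2] at h2
        exact h1.trans h2) (fun i => by
        obtain ⟨n, h1, h2, h3⟩ := hmem i
        exact ⟨n, h2, h3, by simp [flipOn, h1]⟩)
    rw [hI0] at h
    simpa using h
  -- Undoing the flips also has to proceed outwards, so here stage n has the ties flipped outside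
  -- the interval (J (-n), J n]; at n = 0 this interval is empty.
  · have h := Moves.limit (M := M) (w := w) (G := Set.range J) (o' := o)
      (fun n => flipOn P w o (Set.Ioc (J (-n)) (J n))ᶜ) I hI (fun n => by
        have h1 := (hR n (Set.Ioc (J (-n)) (J (n + 1 : ℕ)))ᶜ (fun i hi h => hi
          ⟨(hcast n).2.1.trans_lt h.1, h.2⟩)).2
        have h2 := (hL n (Set.Ioc (J (-((n + 1 : ℕ) : ℤ))) (J (n + 1 : ℕ)))ᶜ (fun i hi h => hi
          ⟨h.1, h.2.trans ((hcast n).2.1.trans (hcast n).2.2)⟩)).2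
        have e1 : (Set.Ioc (J (-n)) (J (n + 1 : ℕ)))ᶜ ∪ Set.Ioc (J n) (J (n + 1 : ℕ)) =
            (Set.Ioc (J (-n)) (J n))ᶜ := by
          have := (hcast n).2
          ext i
          simp only [Set.mem_union, Set.mem_compl_iff, Set.mem_Ioc]
          omega
        have e2 : (Set.Ioc (J (-((n + 1 : ℕ) : ℤ))) (J (n + 1 : ℕ)))ᶜ ∪
            Set.Ioc (J (-((n + 1 : ℕ) : ℤ))) (J (-n)) = (Set.Ioc (J (-n)) (J (n + 1 : ℕ)))ᶜ := by
          have := hcast n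
          ext i
          simp only [Set.mem_union, Set.mem_compl_iff, Set.mem_Ioc]
          omega
        rw [flipOn_flipOn, e1] at h1
        rw [flipOn_flipOn, e2] at h2
        exact h1.trans h2) (fun i => by
        obtain ⟨n, h1, h2, h3⟩ := hmem i
        refine ⟨n, h2, h3, ?_⟩
        have : i ∉ (Set.Ioc (J (-n)) (J n))ᶜ := fun h => h h1
        simp only [flipOn, this, false_and, not_false_eq_true, and_true])
    rw [hI0] at h
    simpa using h

end Stage

end Strand

/-! ### Values of chains at one index -/

namespace Strand

open SemilinearClannishData

section Sets

variable {K V A : Type*} [DivisionRing K] [Fintype V] {D : SemilinearClannishData K V A}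
  {S : SignChoice D} (M : Type*) [AddCommGroup M] [Module D.Alg M]

/-- The elements at `j` of the chains satisfying `1^+` at the ends. -/
def topSet (w : Strand S) (o : ℤ → Prop) (j : ℤ) : Set (Res D M) :=
  {x | ∃ m, w.Good o m ∧ m j = x}

/-- The elements at `j` of the chains which satisfy `1^-` at a left end and vanish far to the
left. -/
def leftSet (w : Strand S) (o : ℤ → Prop) (j : ℤ) : Set (Res D M) :=
  {x | ∃ m, w.Good o m ∧ w.LeftMinus m ∧ (∃ a, ∀ i ≤ a, m i = 0) ∧ m j = x}

/-- The elements at `j` of the chains which satisfy `1^-` at a right end and vanish far to the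
right. -/
def rightSet (w : Strand S) (o : ℤ → Prop) (j : ℤ) : Set (Res D M) :=
  {x | ∃ m, w.Good o m ∧ w.RightMinus m ∧ (∃ a, ∀ i, a ≤ i → m i = 0) ∧ m j = x}

/-- The sums of elements of `leftSet` and `rightSet`. -/
def botSet (w : Strand S) (o : ℤ → Prop) (j : ℤ) : Set (Res D M) :=
  {x | ∃ y ∈ leftSet M w o j, ∃ z ∈ rightSet M w o j, y + z = x}

variable {M} {w w' w'' : Strand S} {o o' o'' : ℤ → Prop} {j j' j'' : ℤ}

theorem topSet_rev : topSet M w.rev (orev o) (-j) = topSet M w o j := by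
  ext x
  constructor
  · rintro ⟨m, hm, rfl⟩
    exact ⟨fun i => m (-i), by simpa using hm.rev, rfl⟩
  · rintro ⟨m, hm, rfl⟩
    exact ⟨fun i => m (-i), hm.rev, by simp⟩

theorem leftSet_rev : leftSet M w.rev (orev o) (-j) = rightSet M w o j := by
  ext x
  constructor
  · rintro ⟨m, hm, hm', ⟨a, ha⟩, rfl⟩
    exact ⟨fun i => m (-i), by simpa using hm.rev, by simpa [LeftMinus] using hm',
      ⟨-a, fun i hi => ha _ (by omega)⟩, rfl⟩
  · rintro ⟨m, hm, hm', ⟨a, ha⟩, rfl⟩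
    exact ⟨fun i => m (-i), hm.rev, by simpa [LeftMinus] using hm',
      ⟨-a, fun i hi => ha _ (by omega)⟩, by simp⟩

theorem rightSet_rev : rightSet M w.rev (orev o) (-j) = leftSet M w o j := by
  rw [← leftSet_rev (w := w.rev), rev_rev, orev_orev, neg_neg]

theorem botSet_rev : botSet M w.rev (orev o) (-j) = botSet M w o j := by
  ext x
  simp only [botSet, leftSet_rev, rightSet_rev, Set.mem_ofPred_eq]
  constructor
  · rintro ⟨y, hy, z, hz, rfl⟩
    exact ⟨z, hz, y, hy, add_comm _ _⟩
  · rintro ⟨y, hy, z, hz, rfl⟩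
    exact ⟨z, hz, y, hy, add_comm _ _⟩

variable {K : Type u₁} {V : Type u₂} {A : Type u₃} [DivisionRing K] [Fintype V]
  {D : SemilinearClannishData K V A} {S : SignChoice D} {w w' w'' : Strand S}

/-- The two oriented words define the same subfunctors at `j` and `j'`. -/
def Sim (w : Strand S) (o : ℤ → Prop) (j : ℤ) (w' : Strand S) (o' : ℤ → Prop) (j' : ℤ) : Prop :=
  ∀ (M : Type v) [AddCommGroup M] [Module D.Alg M],
    topSet M w o j = topSet M w' o' j' ∧ botSet M w o j = botSet M w' o' j'

theorem Sim.symm (h : Sim.{v} w o j w' o' j') : Sim.{v} w' o' j' w o j :=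
  fun M _ _ => ⟨(h M).1.symm, (h M).2.symm⟩

theorem Sim.trans (h : Sim.{v} w o j w' o' j') (h' : Sim.{v} w' o' j' w'' o'' j'') :
    Sim.{v} w o j w'' o'' j'' :=
  fun M _ _ => ⟨(h M).1.trans (h' M).1, (h M).2.trans (h' M).2⟩

theorem Sim.rev (w : Strand S) (o : ℤ → Prop) (j : ℤ) : Sim.{v} w.rev (orev o) (-j) w o j :=
  fun _ _ _ => ⟨topSet_rev, botSet_rev⟩

theorem Sim.of_sets (h : ∀ (M : Type v) [AddCommGroup M] [Module D.Alg M],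
    topSet M w o j = topSet M w' o' j' ∧ leftSet M w o j = leftSet M w' o' j' ∧
      rightSet M w o j = rightSet M w' o' j') : Sim.{v} w o j w' o' j' := by
  intro M _ _
  obtain ⟨h1, h2, h3⟩ := h M
  exact ⟨h1, by simp only [botSet, h2, h3]⟩

/-- Vanishing is preserved only on rays ending in G, so a given ray is first shortened to one of
these; this needs G unbounded on both sides. -/
theorem Moves.subset {M : Type*} [AddCommGroup M] [Module D.Alg M] {G : Set ℤ}
    (h : Moves M w o o' {j} G) (hG : ∀ i, (∃ a ∈ G, a ≤ i) ∧ ∃ a ∈ G, i ≤ a) :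
    topSet M w o j ⊆ topSet M w o' j ∧ leftSet M w o j ⊆ leftSet M w o' j ∧
      rightSet M w o j ⊆ rightSet M w o' j := by
  refine ⟨?_, ?_, ?_⟩
  · rintro _ ⟨m, hm, rfl⟩
    obtain ⟨m', h1, h2, -⟩ := h m hm
    exact ⟨m', h1, h2 j rfl⟩
  · rintro _ ⟨m, hm, hl, ⟨a, ha⟩, rfl⟩
    obtain ⟨m', h1, h2, -, h3, -, h4⟩ := h m hm
    obtain ⟨b, hb, hba⟩ := (hG a).1
    exact ⟨m', h1, h3 hl, ⟨b, h4 b hb fun i hi => ha i (hi.trans hba)⟩, h2 j rfl⟩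
  · rintro _ ⟨m, hm, hl, ⟨a, ha⟩, rfl⟩
    obtain ⟨m', h1, h2, h3, -, h4, -⟩ := h m hm
    obtain ⟨b, hb, hba⟩ := (hG a).2
    exact ⟨m', h1, h3 hl, ⟨b, h4 b hb fun i hi => ha i (hba.trans hi)⟩, h2 j rfl⟩

theorem Sim.of_moves {G : Set ℤ} (hG : ∀ i, (∃ a ∈ G, a ≤ i) ∧ ∃ a ∈ G, i ≤ a)
    (h : ∀ (M : Type v) [AddCommGroup M] [Module D.Alg M],
      Moves M w o o' {j} G ∧ Moves M w o' o {j} G) : Sim.{v} w o j w o' j := by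
  refine Sim.of_sets fun M _ _ => ?_
  obtain ⟨h1, h2, h3⟩ := (h M).1.subset hG
  obtain ⟨h1', h2', h3'⟩ := (h M).2.subset hG
  exact ⟨h1.antisymm h1', h2.antisymm h2', h3.antisymm h3'⟩

theorem Sim.of_congr (ho : ∀ i s hs, w.letter i = some (.star s hs) → (o i ↔ o' i)) :
    Sim.{v} w o j w o' j :=
  Sim.of_moves (G := Set.univ) (fun i => ⟨⟨i, trivial, le_rfl⟩, i, trivial, le_rfl⟩)
    fun _ _ _ => ⟨Moves.of_congr ho, Moves.of_congr fun i s hs h => (ho i s hs h).symm⟩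

end Sets

/-! ### Natural orientations of finite depth and halting points -/

section Natural

variable {K V A : Type*} [DivisionRing K] {D : SemilinearClannishData K V A} {S : SignChoice D}
  {w : Strand S} {P : ℕ∞}

/-- The orientation for which `s^*` becomes `s⁻¹` when the word on the left is smaller than the
one on the right, up to depth `P`. -/
def natOrient (P : ℕ∞) (w : Strand S) (i : ℤ) : Prop := ¬ LexLT P (w.readL (i - 1)) (w.read i)

theorem sameAt_sides {i : ℤ} {s : A} {hs : s ∈ D.Sp} (h : w.letter i = some (.star s hs)) :
    SameAt w.rev (-(i - 1)) w i := by
  have h' : w.letter (i - 1 + 1) = some (.star s hs) := by rwa [sub_add_cancel]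
  simpa using sameAt_turn h' h'

theorem compat_natOrient (hw : w.Adm) : Compat P w (natOrient P w) :=
  ⟨fun _ _ _ h ho => ((sameAt_sides h).not_lt hw.2 hw.1).1 ho,
    fun _ _ _ _ ho => (not_not.1 ho).rel⟩

theorem lexLT_add_one {f g : ℕ → Option (Letter D)} :
    LexLT (P + 1) f g ↔ LexLT P f g ∨ (EqUpTo P f g ∧ LexLT (P + 1) f g) := by
  constructor
  · rintro ⟨n, hn, h, h'⟩
    by_cases hP : (n : ℕ∞) < P
    · exact Or.inl ⟨n, hP, h, h'⟩
    · refine Or.inr ⟨fun k hk => h k ?_, n, hn, h, h'⟩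
      exact_mod_cast hk.trans_le (not_lt.1 hP)
  · rintro (h | h)
    · exact h.mono le_self_add
    · exact h.2

/-- A comparison decided at depth P + 1 is either decided at depth P already or is a tie up to P, so
the ties in `tieSet` are the only letters that change. -/
theorem natOrient_succ {i : ℤ} {s : A} {hs : s ∈ D.Sp} (h : w.letter i = some (.star s hs)) :
    flipOn P w (natOrient P w) Set.univ i ↔ natOrient (P + 1) w i := by
  simp only [flipOn, natOrient, tieSet, Set.mem_univ, true_and,
    Set.mem_ofPred_eq]
  have : ∃ s hs, w.letter i = some (.star s hs) := ⟨s, hs, h⟩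
  simp only [this, true_and]
  have := lexLT_add_one (P := P) (f := w.readL (i - 1)) (g := w.read i)
  tauto

/-- There are infinitely many points in both directions, including `j`, at which chains can be
cut. -/
def Halts (P : ℕ∞) (w : Strand S) (j : ℤ) : Prop :=
  ∃ J : ℤ → ℤ, StrictMono J ∧ J 0 = j ∧
    ∀ n, Halt P w (J (n + 1)) ∨ ∀ i ∈ Set.Ioc (J n) (J (n + 1)), i ∉ tieSet P w

theorem Halts.sim {K : Type u₁} {V : Type u₂} {A : Type u₃} [DivisionRing K] [Fintype V]
    {D : SemilinearClannishData K V A} {S : SignChoice D} {w : Strand S} {P : ℕ∞} {j : ℤ}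
    (hns : D.NonSingularType) (hw : w.Adm) (h : Halts P w j) :
    Sim.{v} w (natOrient P w) j w (natOrient (P + 1) w) j := by
  obtain ⟨J, hJ, rfl, hhalt⟩ := h
  refine Sim.trans (Sim.of_moves (G := Set.range J) (fun i => ?_) fun M _ _ =>
    moves_flipOn hns hw (compat_natOrient hw) (fun i hi _ _ _ => not_not.1 hi) hJ hhalt)
    (Sim.of_congr fun i s hs hi => natOrient_succ hi)
  have h := strictMono_add_le hJ (i.natAbs + (J 0).natAbs) 0
  exact ⟨⟨_, ⟨_, rfl⟩, h.2.trans (by omega)⟩, ⟨_, ⟨_, rfl⟩, le_trans (by omega) h.1⟩⟩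

/-- The word read to the right from the `*`-letter at `i` is minimal, up to depth `P`, among all
words that follow this `*`-letter or its inverse. -/
def RightMin (P : ℕ∞) (w : Strand S) (i : ℤ) : Prop :=
  ∃ s hs, w.letter i = some (.star s hs) ∧ ∀ k, w.letter k = some (.star s hs) →
    ¬ LexLT P (w.read k) (w.read i) ∧ ¬ LexLT P (w.readL (k - 1)) (w.read i)

theorem RightMin.mono {Q : ℕ∞} {i : ℤ} (h : RightMin Q w i) (hPQ : P ≤ Q) : RightMin P w i := by
  obtain ⟨s, hs, h1, h2⟩ := h
  exact ⟨s, hs, h1, fun k hk => ⟨fun h => (h2 k hk).1 (h.mono hPQ),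
    fun h => (h2 k hk).2 (h.mono hPQ)⟩⟩

theorem Pair.star (u : Strand S) (hu : u.RightAdm) {l i : ℤ} {s : A} {hs : s ∈ D.Sp}
    (hi : w.letter (i + 1) = some (.star s hs)) (h : Pair False P u l w i) :
    u.letter (l + 1) = some (.star s hs) ∧ LexLT P (u.read (l + 1)) (w.read (i + 1)) := by
  have hx := h.same.eq_star hu hi
  refine ⟨hx, ?_⟩
  have h1 := LexRel.succ_iff.1 h.right
  rw [read_zero, read_zero, hx, hi, read_tail, read_tail] at h1
  rcases h1 with h1 | ⟨-, h1⟩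
  · exact absurd h1 (lt_irrefl _)
  · exact h1.resolve_right fun h => h.1

theorem rev_star_iff {i : ℤ} {s : A} {hs : s ∈ D.Sp} :
    w.rev.letter i = some (.star s hs) ↔ w.letter (1 - i) = some (.star s hs) := by
  refine ⟨rev_star, fun h => ?_⟩
  rw [rev_letter, h]
  rfl

/-- Any word strictly bounded by the one at i - 1 has to begin with the same *-letter and then
continue with something smaller than a minimal word. -/
theorem RightMin.halt (hw : w.Adm) {i : ℤ} (h : RightMin P w i) : Halt P w (i - 1) := by
  obtain ⟨s, hs, h1, h2⟩ := h
  have h1' : w.letter (i - 1 + 1) = some (.star s hs) := by rwa [sub_add_cancel]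
  constructor
  · intro l hl
    obtain ⟨h3, h4⟩ := hl.star _ hw.1 h1'
    rw [sub_add_cancel] at h4
    exact (h2 _ h3).1 h4
  · intro l hl
    obtain ⟨h3, h4⟩ := hl.star _ hw.2 h1'
    rw [sub_add_cancel, rev_read] at h4
    refine (h2 _ (rev_star h3)).2 ?_
    convert h4 using 2
    ring

theorem exists_minimal_code {α : Type*} {p : α → Prop} (f : α → ℕ) (h : ∃ a, p a) :
    ∃ a, p a ∧ ∀ b, p b → f a ≤ f b := by
  obtain ⟨a, ha⟩ := h
  have := (measure f).wf.has_min {a | p a} ⟨a, ha⟩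
  obtain ⟨a, ha, h⟩ := this
  exact ⟨a, ha, fun b hb => not_lt.1 (h b hb)⟩

/-- The least code among the right sides is compared with the least code among the left sides. If
the left sides win, they do so strictly, against every right side. -/
theorem exists_rightMin (N : ℕ) {i : ℤ} {s : A} {hs : s ∈ D.Sp}
    (hi : w.letter i = some (.star s hs)) :
    (∃ k, RightMin N w k) ∨ ∃ k, w.letter k = some (.star s hs) ∧
      (∀ l, w.letter l = some (.star s hs) → lexCode N (w.readL (k - 1)) < lexCode N (w.read l)) ∧
      ∀ l, w.letter l = some (.star s hs) →
        lexCode N (w.readL (k - 1)) ≤ lexCode N (w.readL (l - 1)) := by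
  obtain ⟨a, ha, hamin⟩ := exists_minimal_code (p := fun k => w.letter k = some (.star s hs))
    (fun k => lexCode N (w.read k)) ⟨i, hi⟩
  obtain ⟨b, hb, hbmin⟩ := exists_minimal_code (p := fun k => w.letter k = some (.star s hs))
    (fun k => lexCode N (w.readL (k - 1))) ⟨i, hi⟩
  by_cases hab : lexCode N (w.read a) ≤ lexCode N (w.readL (b - 1))
  · exact Or.inl ⟨a, s, hs, ha, fun k hk => ⟨fun h => (hamin k hk).not_gt h.lexCode_lt,
      fun h => (hab.trans (hbmin k hk)).not_gt h.lexCode_lt⟩⟩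
  · exact Or.inr ⟨b, hb, fun l hl => (not_le.1 hab).trans_le (hamin l hl), hbmin⟩

/-- If some right side is minimal among all sides, that position works. Otherwise one takes, among
the positions with minimal left side, one with minimal right side. A bounded word in the same
direction contradicts the second choice, one in the opposite direction the strictness of the first.
-/
theorem exists_halt (hw : w.Adm) (N : ℕ) {i : ℤ} {s : A} {hs : s ∈ D.Sp}
    (hi : w.letter i = some (.star s hs)) : ∃ J, Halt N w J := by
  -- Depth N + 1 is needed because the left comparison in `Pair` has one letter more than the strict
  -- comparison after the *-letter.
  rcases exists_rightMin (N + 1) hi with ⟨k, hk⟩ | ⟨k, hk, hk1, hk2⟩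
  · exact ⟨k - 1, (hk.mono (by exact_mod_cast Nat.le_succ N)).halt hw⟩
  obtain ⟨a, ⟨ha, ha'⟩, hamin⟩ := exists_minimal_code (p := fun l => w.letter l =
    some (.star s hs) ∧ lexCode (N + 1) (w.readL (l - 1)) ≤ lexCode (N + 1) (w.readL (k - 1)))
    (fun k => lexCode N (w.read k)) ⟨k, hk, le_rfl⟩
  have h1' : w.letter (a - 1 + 1) = some (.star s hs) := by rwa [sub_add_cancel]
  refine ⟨a - 1, fun l hl => ?_, fun l hl => ?_⟩
  · obtain ⟨h3, h4⟩ := hl.star _ hw.1 h1'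
    rw [sub_add_cancel] at h4
    have h5 : lexCode (N + 1) (w.readL l) ≤ lexCode (N + 1) (w.readL (a - 1)) :=
      LexRel.lexCode_le (by exact_mod_cast hl.left)
    exact (hamin (l + 1) ⟨h3, by rw [add_sub_cancel_right]; exact h5.trans ha'⟩).not_gt
      h4.lexCode_lt
  · obtain ⟨h3, -⟩ := hl.star _ hw.2 h1'
    have h5 : lexCode (N + 1) (w.rev.readL l) ≤ lexCode (N + 1) (w.readL (a - 1)) :=
      LexRel.lexCode_le (by exact_mod_cast hl.left)
    rw [rev_readL] at h5
    have h6 := hk1 (-l) (by rw [← rev_star h3]; congr 1; ring)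
    exact absurd (h5.trans ha') (not_le.2 h6)

end Natural

end Strand

/-! ### Finite and periodic words -/

namespace Strand

open SemilinearClannishData

section Regular

variable {K V A : Type*} [DivisionRing K] {D : SemilinearClannishData K V A} {S : SignChoice D}
  {w : Strand S} {P : ℕ∞} {a b p : ℤ}

/-- The word is indexed by `{a, …, b}`. -/
def IndexedBy (w : Strand S) (a b : ℤ) : Prop :=
  a ≤ b ∧ ∀ i, (w.vertex i).isSome ↔ a ≤ i ∧ i ≤ b

/-- The word is indexed by `ℤ` and is equal to its shift by `p > 0`. -/
structure PeriodicBy (w : Strand S) (p : ℤ) : Prop where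
  pos : 0 < p
  isSome : ∀ i, (w.letter i).isSome
  vertex : Function.Periodic w.vertex p
  letter : Function.Periodic w.letter p
  sgn : Function.Periodic w.sgn p

theorem IndexedBy.rev (h : IndexedBy w a b) : IndexedBy w.rev (-b) (-a) := by
  refine ⟨by have := h.1; omega, fun i => ?_⟩
  rw [rev_vertex, h.2]
  omega

theorem PeriodicBy.rev (h : PeriodicBy w p) : PeriodicBy w.rev p := by
  refine ⟨h.pos, fun i => ?_, fun i => ?_, fun i => ?_, fun i => ?_⟩
  · simp [rev_letter, h.isSome]
  · rw [rev_vertex, rev_vertex, ← h.vertex]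
    congr 1; ring
  · rw [rev_letter, rev_letter, ← h.letter]
    congr 2; ring
  · rw [rev_sgn, rev_sgn, ← h.sgn]
    congr 2; ring

theorem PeriodicBy.read_add (h : PeriodicBy w p) (i n : ℤ) : w.read (i + n * p) = w.read i := by
  funext k
  rw [read, read, ← h.letter.int_mul n (i + 1 + k)]
  congr 1; simp only [Int.cast_id]; ring

theorem PeriodicBy.readL_add (h : PeriodicBy w p) (i n : ℤ) :
    w.readL (i + n * p) = w.readL i := by
  funext k
  rw [readL_apply, readL_apply, ← h.letter.int_mul n (i - k)]
  congr 2; simp only [Int.cast_id]; ring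

theorem IndexedBy.letter_bound (h : IndexedBy w a b) {i : ℤ} {x : Letter D}
    (hx : w.letter i = some x) : a < i ∧ i ≤ b := by
  have h1 := (h.2 i).1 (by rw [w.tail_letter i x hx]; rfl)
  have h2 := (h.2 (i - 1)).1 (by rw [w.head_letter i x hx]; rfl)
  omega

theorem PeriodicBy.vertex_isSome {p : ℤ} (h : PeriodicBy w p) (j : ℤ) :
    (w.vertex j).isSome := by
  obtain ⟨x, hx⟩ := Option.isSome_iff_exists.1 (h.isSome j)
  rw [w.tail_letter j x hx]
  rfl

/-- The word is finite or periodic. -/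
def Regular (w : Strand S) : Prop := (∃ a b, IndexedBy w a b) ∨ ∃ p, PeriodicBy w p

theorem Regular.rev (h : Regular w) : Regular w.rev := by
  rcases h with ⟨a, b, h⟩ | ⟨p, h⟩
  · exact Or.inl ⟨_, _, h.rev⟩
  · exact Or.inr ⟨_, h.rev⟩

theorem Regular.exists_depth (h : Regular w) : ∃ N : ℕ, ∀ i x, w.letter i = some x →
    (natOrient N w i ↔ natOrient ⊤ w i) := by
  have h1 : ∀ i, ∃ n : ℕ, LexLT ⊤ (w.readL (i - 1)) (w.read i) →
      LexLT n (w.readL (i - 1)) (w.read i) := by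
    intro i
    by_cases h : LexLT ⊤ (w.readL (i - 1)) (w.read i)
    · obtain ⟨n, -, h2, h3⟩ := h
      exact ⟨n + 1, fun _ => ⟨n, by exact_mod_cast Nat.lt_succ_self n, h2, h3⟩⟩
    · exact ⟨0, fun h' => absurd h' h⟩
  choose n hn using h1
  -- Up to equality there are only finitely many pairs of sides, and each strict inequality is
  -- decided at some finite depth.
  suffices hF : ∃ F : Finset ℤ, ∀ i x, w.letter i = some x → ∃ k ∈ F,
      w.readL (i - 1) = w.readL (k - 1) ∧ w.read i = w.read k by
    obtain ⟨F, hF⟩ := hF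
    refine ⟨F.sup n, fun i x hx => ?_⟩
    obtain ⟨k, hk, e1, e2⟩ := hF i x hx
    refine not_congr ⟨fun h => h.mono le_top, fun h => ?_⟩
    rw [e1, e2] at h ⊢
    exact (hn k h).mono (by exact_mod_cast Finset.le_sup hk)
  rcases h with ⟨a, b, h⟩ | ⟨p, h⟩
  · refine ⟨Finset.Icc a b, fun i x hx => ⟨i, ?_, rfl, rfl⟩⟩
    have := h.letter_bound hx
    exact Finset.mem_Icc.2 (by omega)
  · refine ⟨Finset.Icc 0 p, fun i x _ => ⟨i % p, ?_, ?_, ?_⟩⟩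
    · have := Int.emod_nonneg i h.pos.ne'
      have := Int.emod_lt_of_pos i h.pos
      exact Finset.mem_Icc.2 (by omega)
    · rw [← h.readL_add (i % p - 1) (i / p)]
      congr 1
      have := Int.emod_add_ediv_mul i p
      linarith
    · rw [← h.read_add (i % p) (i / p)]
      congr 1
      have := Int.emod_add_ediv_mul i p
      linarith

theorem IndexedBy.halts (h : IndexedBy w a b) : Halts P w a := by
  have hab := h.1
  -- The whole word lies in the block from a to b + 1. The later cutting points lie outside the
  -- index set, and the block ending at a contains no letters.
  refine ⟨fun n => if n ≤ 0 then a + n else b + n, ?_, by simp, fun n => ?_⟩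
  · intro n n' hn
    simp only
    split_ifs <;> omega
  · simp only
    by_cases hn : n = -1
    · subst hn
      right
      rintro i ⟨h1, h2⟩ ⟨⟨s, hs, h3⟩, -, -⟩
      have := h.letter_bound h3
      simp only [neg_add_cancel, le_refl, if_true] at h2
      omega
    · left
      apply halt_of_vertex
      rw [← Option.not_isSome_iff_eq_none, h.2]
      split_ifs <;> omega

theorem PeriodicBy.halt_add (h : PeriodicBy w p) {J : ℤ} (hJ : Halt P w J) (n : ℤ) :
    Halt P w (J + n * p) := by
  have hv : w.vertex (J + n * p) = w.vertex J := h.vertex.int_mul n J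
  have hs : w.sgn (J + n * p) = w.sgn J := h.sgn.int_mul n J
  have key : ∀ u l, Pair False P u l w (J + n * p) → Pair False P u l w J := by
    rintro u l ⟨⟨v, h1, h2, h3⟩, h4, h5⟩
    rw [hv] at h2
    rw [hs] at h3
    rw [h.read_add] at h4
    rw [h.readL_add] at h5
    exact ⟨⟨v, h1, h2, h3⟩, h4, h5⟩
  exact ⟨fun l hl => hJ.1 l (key _ _ hl), fun l hl => hJ.2 l (key _ _ hl)⟩

theorem PeriodicBy.strictMono (h : PeriodicBy w p) (j : ℤ) :
    StrictMono fun n : ℤ => j + n * p := by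
  intro n n' hn
  have := mul_lt_mul_of_pos_right hn h.pos
  simp only
  omega

theorem PeriodicBy.halts (h : PeriodicBy w p) {J : ℤ} (hJ : Halt P w J) : Halts P w J :=
  ⟨fun n => J + n * p, h.strictMono J, by simp, fun n => Or.inl (h.halt_add hJ _)⟩

/-- In the periodic case one halting point yields all its translates; if there are no *-letters
there are no ties, and any points will do. -/
theorem Regular.exists_halts (h : Regular w) (hw : w.Adm) (N : ℕ) :
    ∃ j, (w.vertex j).isSome ∧ Halts N w j := by
  rcases h with ⟨a, b, h⟩ | ⟨p, h⟩
  · exact ⟨a, (h.2 a).2 ⟨le_rfl, h.1⟩, h.halts⟩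
  · have hsome := h.vertex_isSome
    by_cases hst : ∃ i s hs, w.letter i = some (.star s hs)
    · obtain ⟨i, s, hs, hi⟩ := hst
      obtain ⟨J, hJ⟩ := exists_halt hw N hi
      exact ⟨J, hsome J, h.halts hJ⟩
    · refine ⟨0, hsome 0, fun n => 0 + n * p, h.strictMono 0, by simp, fun n => Or.inr ?_⟩
      rintro i - ⟨⟨s, hs, h1⟩, -⟩
      exact hst ⟨i, s, hs, h1⟩

end Regular

section Natural

variable {K : Type u₁} {V : Type u₂} {A : Type u₃} [DivisionRing K] [Fintype V]
  {D : SemilinearClannishData K V A} {S : SignChoice D} {w : Strand S} {j : ℤ}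

/-- At depth 0 no strict inequality is decided, so every *-letter is direct; then one depth is added
at a time. -/
theorem sim_natOrient_nat (hns : D.NonSingularType) (hw : w.Adm) {N : ℕ}
    (h : ∀ n : ℕ, n < N → Halts n w j) :
    Sim.{v} w (fun _ => True) j w (natOrient N w) j := by
  induction N with
  | zero => exact Sim.of_congr fun i _ _ _ => by simp [natOrient, LexLT]
  | succ n ih =>
    exact (ih fun k hk => h k (by omega)).trans (by exact_mod_cast (h n (by omega)).sim hns hw)

theorem exists_sim_natOrient (hns : D.NonSingularType) (hw : w.Adm) (hr : Regular w) :
    ∃ N : ℕ, ∀ j, (∀ n : ℕ, n < N → Halts n w j) →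
      Sim.{v} w (fun _ => True) j w (natOrient ⊤ w) j := by
  obtain ⟨N, hN⟩ := hr.exists_depth
  exact ⟨N, fun j hj => (sim_natOrient_nat hns hw hj).trans
    (Sim.of_congr fun i _ _ hi => hN i _ hi)⟩

/-- If an equivalence relation on orientations contains the relation of being `Sim` at some
index, then it identifies the special-direct and the natural orientation. -/
theorem natOrient_rel (hns : D.NonSingularType) (hw : w.Adm) (hr : Regular w)
    {r : (ℤ → Prop) → (ℤ → Prop) → Prop} (htrans : ∀ o o' o'', r o o' → r o' o'' → r o o'')
    (h : ∀ o o' j, (w.vertex j).isSome → Sim.{v} w o j w o' j → r o o') :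
    r (fun _ => True) (natOrient ⊤ w) := by
  obtain ⟨j₀, hj₀, -⟩ := hr.exists_halts hw 0
  obtain ⟨N, hN⟩ := hr.exists_depth
  refine htrans _ (natOrient N w) _ ?_ (h _ _ j₀ hj₀ (Sim.of_congr fun i _ _ hi => hN i _ hi))
  clear hN
  -- The index at which two consecutive depths are compared may change with the depth, hence the
  -- abstract relation r, which forgets it.
  induction N with
  | zero => exact h _ _ j₀ hj₀ (Sim.of_congr fun i _ _ _ => by simp [natOrient, LexLT])
  | succ n ih =>
    obtain ⟨j, hj, hs⟩ := hr.exists_halts hw n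
    exact htrans _ _ _ ih (h _ _ j hj (by exact_mod_cast hs.sim hns hw))

end Natural

end Strand

/-! ### Symmetries and reflection -/

namespace Strand

open SemilinearClannishData

section Symmetry

variable {K V A : Type*} [DivisionRing K] {D : SemilinearClannishData K V A} {S : SignChoice D}
  {w : Strand S} {k : ℤ}

/-- The letter at `k` is a `*`-letter, and the words on both sides of it are equal. -/
def SymmAt (w : Strand S) (k : ℤ) : Prop :=
  (∃ s hs, w.letter k = some (.star s hs)) ∧ EqUpTo ⊤ (w.readL (k - 1)) (w.read k)

/-- The letter at i joins i - 1 and i, so the reflection in the letter at k acts by i ↦ 2k - i on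
letters and by i ↦ 2k - 1 - i on vertices. -/
theorem SymmAt.letter (h : SymmAt w k) (i : ℤ) :
    w.letter (2 * k - i) = (w.letter i).map Letter.inverse := by
  obtain ⟨⟨s, hs, hk⟩, h⟩ := h
  have h' : ∀ n : ℕ, (w.letter (k - 1 - n)).map Letter.inverse = w.letter (k + 1 + n) := by
    intro n
    rw [← readL_apply]
    exact h n (WithTop.coe_lt_top _)
  rcases lt_trichotomy i k with hi | rfl | hi
  · have := h' (k - 1 - i).toNat
    rw [show k - 1 - ((k - 1 - i).toNat : ℤ) = i by omega,
      show k + 1 + ((k - 1 - i).toNat : ℤ) = 2 * k - i by omega] at this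
    exact this.symm
  · rw [show 2 * i - i = i by ring, hk]
    rfl
  · have := h' (i - k - 1).toNat
    rw [show k - 1 - ((i - k - 1).toNat : ℤ) = 2 * k - i by omega,
      show k + 1 + ((i - k - 1).toNat : ℤ) = i by omega] at this
    rw [← this, Option.map_map]
    have : (Letter.inverse ∘ Letter.inverse : Letter D → Letter D) = id :=
      funext Letter.inverse_inverse
    rw [this, Option.map_id, id]

theorem exists_letter {x : Letter D} (hk : w.letter k = some x) {i : ℤ} {v : V}
    (hv : w.vertex i = some v) : (∃ y, w.letter i = some y) ∨ ∃ y, w.letter (i + 1) = some y := by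
  by_contra hcon
  push Not at hcon
  have h1 : w.letter i = none := Option.eq_none_iff_forall_ne_some.2 hcon.1
  have h2 : w.letter (i + 1) = none := Option.eq_none_iff_forall_ne_some.2 hcon.2
  rcases le_or_gt k i with h | h
  · have := w.left_none i v hv h1 k h
    simp [hk] at this
  · have := w.right_none i v hv h2 k h
    simp [hk] at this

theorem SymmAt.vertex (h : SymmAt w k) {i : ℤ} {v : V} (hv : w.vertex i = some v) :
    w.vertex (2 * k - 1 - i) = some v ∧ w.sgn (2 * k - 1 - i) = - w.sgn i := by
  obtain ⟨s, hs, hk⟩ := h.1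
  rcases exists_letter hk hv with ⟨y, hy⟩ | ⟨y, hy⟩
  · have h1 := h.letter i
    rw [hy, Option.map_some] at h1
    have h1' : w.letter (2 * k - 1 - i + 1) = some y.inverse := by rw [← h1]; congr 1; ring
    refine ⟨?_, ?_⟩
    · rw [head_of_letter h1', Letter.head_inverse, ← w.tail_letter i y hy, hv]
    · rw [← w.sgn_letter _ _ h1', w.sgn_inverse _ _ hy]
  · have h1 := h.letter (i + 1)
    rw [hy, Option.map_some] at h1
    have h1' : w.letter (2 * k - 1 - i) = some y.inverse := by rw [← h1]; congr 1; ring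
    refine ⟨?_, ?_⟩
    · rw [w.tail_letter _ _ h1', Letter.tail_inverse, ← head_of_letter hy, hv]
    · have h2 := w.sgn_inverse _ _ h1'
      rw [Letter.inverse_inverse, w.sgn_letter _ _ hy] at h2
      rw [h2, neg_neg]

theorem SymmAt.readL (h : SymmAt w k) (i : ℤ) : w.readL (2 * k - i - 1) = w.read i := by
  funext n
  rw [readL_apply, show 2 * k - i - 1 - (n : ℤ) = 2 * k - (i + 1 + n) by ring, h.letter,
    Option.map_map]
  have : (Letter.inverse ∘ Letter.inverse : Letter D → Letter D) = id :=
    funext Letter.inverse_inverse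
  rw [this, Option.map_id, id, read]

theorem SymmAt.read (h : SymmAt w k) (i : ℤ) : w.read (2 * k - i) = w.readL (i - 1) := by
  rw [← h.readL]
  congr 1; ring

theorem SymmAt.star (h : SymmAt w k) {i : ℤ} {s : A} {hs : s ∈ D.Sp}
    (hi : w.letter i = some (.star s hs)) : w.letter (2 * k - i) = some (.star s hs) := by
  rw [h.letter, hi]
  rfl

theorem SymmAt.compat (h : SymmAt w k) {P : ℕ∞} {o : ℤ → Prop} (hc : Compat P w o) :
    Compat P w fun i => ¬ o (2 * k - i) := by
  refine ⟨fun i s hs hi ho => ?_, fun i s hs hi ho => ?_⟩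
  · have := hc.inv _ s hs (h.star hi) ho
    rwa [h.readL, h.read] at this
  · have := hc.dir _ s hs (h.star hi) (not_not.1 ho)
    rwa [h.readL, h.read] at this

theorem SymmAt.leftEnd (h : SymmAt w k) {i : ℤ} {v : V} (hv : w.rev.vertex i = some v)
    (hi : w.rev.letter (i + 1) = none) : w.vertex (i + 2 * k - 1) = some v ∧
      w.letter (i + 2 * k - 1 + 1) = none ∧ w.sgn (i + 2 * k - 1) = w.rev.sgn i := by
  obtain ⟨h1, h2⟩ := h.vertex hv
  rw [show 2 * k - 1 - -i = i + 2 * k - 1 by ring] at h1 h2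
  refine ⟨h1, ?_, h2⟩
  rw [rev_letter, Option.map_eq_none_iff] at hi
  rw [show i + 2 * k - 1 + 1 = 2 * k - (1 - (i + 1)) by ring, h.letter, hi]
  rfl

theorem SymmAt.rightEnd (h : SymmAt w k) {i : ℤ} {v : V} (hv : w.vertex i = some v)
    (hi : w.letter (i + 1) = none) : w.rev.vertex (i + 1 - 2 * k) = some v ∧
      w.rev.letter (i + 1 - 2 * k + 1) = none ∧ w.rev.sgn (i + 1 - 2 * k) = w.sgn i := by
  obtain ⟨h1, h2⟩ := h.vertex hv
  refine ⟨by rw [rev_vertex, ← h1]; congr 1; ring, ?_, ?_⟩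
  · rw [rev_letter, show 1 - (i + 1 - 2 * k + 1) = 2 * k - (i + 1) by ring, h.letter, hi]
    rfl
  · rw [rev_sgn, show -(i + 1 - 2 * k) = 2 * k - 1 - i by ring, h2, neg_neg]

end Symmetry

section Reflect

variable {K V A : Type*} [DivisionRing K] [Fintype V] {D : SemilinearClannishData K V A}
  {S : SignChoice D} {M : Type*} [AddCommGroup M] [Module D.Alg M]
  {w : Strand S} {o o' : ℤ → Prop} {m : ℤ → Res D M} {k j : ℤ}

theorem SymmAt.rightMinus (h : SymmAt w k) (hm : w.LeftMinus m) :
    w.RightMinus fun i => m (2 * k - 1 - i) := by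
  intro i v hv hi
  obtain ⟨h1, h2, h3⟩ := h.rightEnd hv hi
  have := hm _ v h1 h2
  rw [h3] at this
  change m (2 * k - 1 - i) ∈ _
  convert this using 2
  ring

theorem SymmAt.leftMinus (h : SymmAt w k) (hm : w.RightMinus m) :
    w.LeftMinus fun i => m (2 * k - 1 - i) := by
  intro i v hv hi
  obtain ⟨h1, h2, h3⟩ := h.leftEnd hv hi
  have := hm _ v h1 h2
  rw [h3] at this
  convert this using 2
  ring

/-- Reading a letter backwards inverts it, which for a *-letter means the opposite orientation at
the reflected place. -/
theorem SymmAt.good (h : SymmAt w k) (hm : w.Good o m) :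
    w.Good (fun i => ¬ o (2 * k - i)) fun i => m (2 * k - 1 - i) := by
  refine ⟨⟨fun i v hv => hm.chain.mem _ v (h.vertex hv).1, fun i x hx => ?_⟩,
    fun i v hv hi => ?_, fun i v hv hi => ?_⟩
  · have h1 := h.letter i
    rw [hx, Option.map_some] at h1
    have h2 := hm.chain.rel _ _ h1
    rw [← LetterRel.inverse, ← Letter.orient_inverse, Letter.inverse_inverse] at h2
    convert h2 using 2
    · ring
    · ring
  · obtain ⟨h1, h2, h3⟩ := h.rightEnd hv hi
    have := hm.left _ v h1 h2
    rw [h3] at this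
    convert this using 2
    ring
  · obtain ⟨h1, h2, h3⟩ := h.leftEnd hv hi
    have := hm.right _ v h1 h2
    rw [h3] at this
    convert this using 2
    ring

theorem SymmAt.subset (h : SymmAt w k) (o : ℤ → Prop) (j : ℤ) :
    topSet M w o j ⊆ topSet M w (fun i => ¬ o (2 * k - i)) (2 * k - 1 - j) ∧
    botSet M w o j ⊆ botSet M w (fun i => ¬ o (2 * k - i)) (2 * k - 1 - j) := by
  constructor
  · rintro _ ⟨m, hm, rfl⟩
    exact ⟨_, h.good hm, by simp⟩
  · rintro _ ⟨_, ⟨m, hm, hl, ⟨a, ha⟩, rfl⟩, _, ⟨n, hn, hr, ⟨b, hb⟩, rfl⟩, rfl⟩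
    exact ⟨_, ⟨_, h.good hn, h.leftMinus hr, ⟨2 * k - 1 - b, fun i hi => hb _ (by omega)⟩,
      rfl⟩, _, ⟨_, h.good hm, h.rightMinus hl, ⟨2 * k - 1 - a, fun i hi => ha _ (by omega)⟩,
      rfl⟩, by simp [add_comm]⟩

end Reflect

/-- Applied to the special-direct orientation this yields the special-inverse one, at the reflected
index. -/
theorem SymmAt.sim {K : Type u₁} {V : Type u₂} {A : Type u₃} [DivisionRing K] [Fintype V]
    {D : SemilinearClannishData K V A} {S : SignChoice D} {w : Strand S} {k : ℤ}
    (h : SymmAt w k) (o : ℤ → Prop) (j : ℤ) :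
    Sim.{v} w o j w (fun i => ¬ o (2 * k - i)) (2 * k - 1 - j) := by
  intro M _ _
  obtain ⟨h1, h2⟩ := h.subset (M := M) o j
  obtain ⟨h3, h4⟩ := h.subset (M := M) (fun i => ¬ o (2 * k - i)) (2 * k - 1 - j)
  simp only [sub_sub_cancel, not_not] at h3 h4
  exact ⟨h1.antisymm h3, h2.antisymm h4⟩

/-! ### Refitting one side of a chain -/

section Fit

variable {K V A : Type*} [DivisionRing K] [Fintype V] {D : SemilinearClannishData K V A}
  {S : SignChoice D} {M : Type*} [AddCommGroup M] [Module D.Alg M]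
  {w : Strand S} {o o' : ℤ → Prop} {m : ℤ → Res D M} {k j : ℤ}

/-- The part to the right of `j` of a chain can be changed according to any compatible
orientation. -/
theorem Good.refit (hns : D.NonSingularType) (hw : w.Adm) (hm : w.Good o m) (hc : Compat ⊤ w o)
    (hc' : Compat ⊤ w o') (hj : (w.vertex j).isSome)
    (ho : ∀ i ≤ j, ∀ s hs, w.letter i = some (.star s hs) → (o i ↔ o' i)) :
    ∃ m', w.Good o' m' ∧ (∀ i ≤ j, m' i = m i) ∧ (w.LeftMinus m → w.LeftMinus m') := by
  by_cases hst : ∃ k x, j < k ∧ w.letter k = some x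
  · obtain ⟨k, x, hjk, hk⟩ := hst
    obtain ⟨v, hv⟩ := Option.isSome_iff_exists.1 hj
    -- Every word bounds itself, so non-strict flows at depth ⊤ start with the entry of the chain at
    -- j; the price is that vanishing and 1^- on the right are lost.
    have hx : m j ∈ flow True ⊤ w m j :=
      Submodule.subset_span (Or.inl ⟨j, rfl, ⟨v, hv, hv, rfl⟩, (EqUpTo.refl _ _).le,
        (EqUpTo.refl _ _).le⟩)
    obtain ⟨q, hq0, hqf, hqr, -⟩ := exists_flow (o' := o') hns hm.chain hm.right hm.left hw hc
      (fun _ => rfl) hx (fun i _ hi s hs h => hc'.dir i s hs h hi)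
      (fun i _ hi s hs h => Or.inl (hc'.inv i s hs h hi))
    have hleft : ∀ {i : ℤ} {v : V}, w.rev.vertex i = some v → w.rev.letter (i + 1) = none →
        -i ≤ j := by
      intro i v' hv' hi
      have h1 := lt_of_left_end hk hv' hi
      by_contra hcon
      rw [rev_letter, Option.map_eq_none_iff, sub_add_cancel_right] at hi
      have h2 := w.left_none _ _ hv' hi (j + 1) (by omega)
      have h3 := w.right_none _ _ hv h2 k hjk
      simp [hk] at h3
    refine ⟨fun i => if i ≤ j then m i else q i, ⟨⟨?_, ?_⟩, ?_, ?_⟩, ?_, ?_⟩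
    · intro i v hv
      by_cases h : i ≤ j
      · simpa only [h, if_true] using hm.chain.mem i v hv
      · simpa only [h, if_false] using flow_mem hm.chain hv (hqf i (by omega))
    · intro i x hx
      by_cases h : i ≤ j
      · have h' : i - 1 ≤ j := by omega
        simp only [h, h', if_true]
        have := hm.chain.rel i x hx
        cases x with
        | star s hs => rwa [← propext (ho i h s hs hx)]
        | _ => exact this
      · have h1 := hqr (i - 1) (by omega) x (by simpa using hx)
        rw [sub_add_cancel] at h1
        have e : (if i - 1 ≤ j then m (i - 1) else q (i - 1)) = q (i - 1) := by
          by_cases h' : i - 1 ≤ j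
          · rw [if_pos h', show i - 1 = j by omega, hq0]
          · rw [if_neg h']
        rw [e]
        simpa only [h, if_false] using h1
    · intro i v hv hi
      by_cases h : i ≤ j
      · simpa only [h, if_true] using hm.right i v hv hi
      · simp only [h, if_false]
        exact (flow_end hm.chain hw hm.right hm.left hv hi (hqf i (by omega))).1
    · intro i v hv hi
      simpa only [hleft hv hi, if_true] using hm.left i v hv hi
    · intro i hi
      simp only [hi, if_true]
    · intro hl i v hv hi
      simpa only [hleft hv hi, if_true] using hl i v hv hi
  · refine ⟨m, hm.congr fun i s hs hi => ho i ?_ s hs hi, fun _ _ => rfl, id⟩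
    by_contra hcon
    exact hst ⟨i, _, by omega, hi⟩

/-- The part of the chain up to j is kept, so the conditions on the left survive. -/
theorem refit_subset (hns : D.NonSingularType) (hw : w.Adm) (hc : Compat ⊤ w o)
    (hc' : Compat ⊤ w o') (hj : (w.vertex j).isSome)
    (ho : ∀ i ≤ j, ∀ s hs, w.letter i = some (.star s hs) → (o i ↔ o' i)) :
    topSet M w o j ⊆ topSet M w o' j ∧ leftSet M w o j ⊆ leftSet M w o' j := by
  constructor
  · rintro _ ⟨m, hm, rfl⟩
    obtain ⟨m', h1, h2, -⟩ := hm.refit hns hw hc hc' hj ho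
    exact ⟨m', h1, h2 j le_rfl⟩
  · rintro _ ⟨m, hm, hl, ⟨a, ha⟩, rfl⟩
    obtain ⟨m', h1, h2, h3⟩ := hm.refit hns hw hc hc' hj ho
    refine ⟨m', h1, h3 hl, ⟨min a j, fun i hi => ?_⟩, h2 j le_rfl⟩
    rw [h2 i (hi.trans (min_le_right _ _)), ha i (hi.trans (min_le_left _ _))]

theorem refit_subset_right (hns : D.NonSingularType) (hw : w.Adm) (hc : Compat ⊤ w o)
    (hc' : Compat ⊤ w o') (hj : (w.vertex j).isSome)
    (ho : ∀ i, j < i → ∀ s hs, w.letter i = some (.star s hs) → (o i ↔ o' i)) :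
    topSet M w o j ⊆ topSet M w o' j ∧ rightSet M w o j ⊆ rightSet M w o' j := by
  have h := refit_subset (M := M) (j := -j) hns hw.rev hc.rev hc'.rev
    (by rwa [rev_vertex, neg_neg])
    (fun i hi s hs h => not_congr (ho _ (by omega) s hs (rev_star h)))
  rwa [topSet_rev, topSet_rev, leftSet_rev, leftSet_rev] at h

end Fit

end Strand

/-! ### Natural orientations with prescribed symmetries -/

namespace Strand

open SemilinearClannishData

section Tie

variable {K V A : Type*} [DivisionRing K] {D : SemilinearClannishData K V A} {S : SignChoice D}
  {w : Strand S} {k : ℤ}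

/-- The orientation given by the order of the words on the two sides of a `*`-letter, where the
symmetries in `T` become `s`, and the other ones `s⁻¹`. -/
def tieOrient (w : Strand S) (T : Set ℤ) (i : ℤ) : Prop :=
  LexLT ⊤ (w.read i) (w.readL (i - 1)) ∨ (EqUpTo ⊤ (w.readL (i - 1)) (w.read i) ∧ i ∈ T)

theorem lexLT_sides (hw : w.Adm) {i : ℤ} {s : A} {hs : s ∈ D.Sp}
    (h : w.letter i = some (.star s hs)) : LexLT ⊤ (w.read i) (w.readL (i - 1)) ↔
      ¬ LexLT ⊤ (w.readL (i - 1)) (w.read i) ∧ ¬ EqUpTo ⊤ (w.readL (i - 1)) (w.read i) := by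
  constructor
  · exact fun h => ⟨h.not_symm, fun h' => h.not_eq h'.symm⟩
  · rintro ⟨h1, h2⟩
    rcases (sameAt_sides h).trichotomy hw.2 hw.1 ⊤ with h3 | h3 | h3
    · exact absurd h3 h1
    · exact absurd h3 h2
    · exact h3

theorem compat_tieOrient (hw : w.Adm) (T : Set ℤ) : Compat ⊤ w (tieOrient w T) := by
  refine ⟨fun i s hs h ho => ?_, fun i s hs h ho => ?_⟩
  · rcases ho with ho | ho
    · exact ho.rel
    · exact ho.1.symm.le
  · exact ((sameAt_sides h).symm.not_lt hw.1 hw.2).1 fun h => ho (Or.inl h)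

theorem natOrient_top_iff (hw : w.Adm) {i : ℤ} {s : A} {hs : s ∈ D.Sp}
    (h : w.letter i = some (.star s hs)) : natOrient ⊤ w i ↔ tieOrient w Set.univ i := by
  have h1 := lexLT_sides hw h
  have h2 := fun h : LexLT ⊤ (w.readL (i - 1)) (w.read i) => h.not_eq
  simp only [natOrient, tieOrient, Set.mem_univ, and_true]
  tauto

theorem orev_tieOrient (hw : w.Adm) (T : Set ℤ) {i : ℤ} {s : A} {hs : s ∈ D.Sp}
    (h : w.letter i = some (.star s hs)) :
    orev (tieOrient w.rev {k | 1 - k ∉ T}) i ↔ tieOrient w T i := by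
  have h1 := lexLT_sides hw h
  have h2 := fun h : LexLT ⊤ (w.readL (i - 1)) (w.read i) => h.not_eq
  simp only [orev, tieOrient, rev_read, rev_readL, Set.mem_ofPred_eq, sub_sub_cancel]
  rw [show -(1 - i) = i - 1 by ring, show -(1 - i - 1) = i by ring]
  have h3 : EqUpTo ⊤ (w.read i) (w.readL (i - 1)) ↔ EqUpTo ⊤ (w.readL (i - 1)) (w.read i) :=
    ⟨EqUpTo.symm, EqUpTo.symm⟩
  tauto

/-- Reversal exchanges the sides and negates the orientation: strict comparisons are unaffected,
while symmetries, direct in `natOrient`, become inverse. -/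
theorem orev_natOrient (hw : w.Adm) {i : ℤ} {s : A} {hs : s ∈ D.Sp}
    (h : w.letter i = some (.star s hs)) :
    orev (natOrient ⊤ w.rev) i ↔ tieOrient w ∅ i := by
  rw [← orev_tieOrient hw ∅ h]
  have h' : w.rev.letter (1 - i) = some (.star s hs) := rev_star_iff.2 (by simpa using h)
  have := natOrient_top_iff hw.rev h'
  simp only [Set.mem_empty_iff_false, not_false_eq_true, Set.ofPred_true]
  exact not_congr this

/-- Reflection exchanges the two sides at i with those at 2k - i. The order condition is thus
compatible with negation, and for symmetries this is the assumption on T. -/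
theorem SymmAt.tieOrient_reflect (hk : SymmAt w k) (hw : w.Adm) {T : Set ℤ} {i : ℤ} {s : A}
    {hs : s ∈ D.Sp} (h : w.letter i = some (.star s hs)) (hT : i ∈ T ↔ 2 * k - i ∉ T) :
    ¬ tieOrient w T (2 * k - i) ↔ tieOrient w T i := by
  have h1 := lexLT_sides hw h
  have h2 := fun h : LexLT ⊤ (w.readL (i - 1)) (w.read i) => h.not_eq
  simp only [tieOrient, hk.read, hk.readL]
  have h3 : EqUpTo ⊤ (w.read i) (w.readL (i - 1)) ↔ EqUpTo ⊤ (w.readL (i - 1)) (w.read i) :=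
    ⟨EqUpTo.symm, EqUpTo.symm⟩
  tauto

end Tie

/-! ### Changing one symmetry at a time -/

section Closed

variable {K V A : Type*} [DivisionRing K] [Fintype V] {D : SemilinearClannishData K V A}
  {S : SignChoice D} {M : Type*} [AddCommGroup M] [Module D.Alg M]
  {w : Strand S} {o o' o'' : ℤ → Prop} {m m' : ℤ → Res D M} {a k j : ℤ}

theorem RightPlus.add (hm : w.RightPlus m) (hm' : w.RightPlus m') :
    w.RightPlus fun i => m i + m' i :=
  fun i v hv hi => add_mem (hm i v hv hi) (hm' i v hv hi)

theorem RightMinus.add (hm : w.RightMinus m) (hm' : w.RightMinus m') :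
    w.RightMinus fun i => m i + m' i :=
  fun i v hv hi => add_mem (hm i v hv hi) (hm' i v hv hi)

theorem Good.add (hm : w.Good o m) (hm' : w.Good o m') : w.Good o fun i => m i + m' i :=
  ⟨hm.chain.add hm'.chain, hm.right.add hm'.right, hm.left.add hm'.left⟩

theorem rightSet_add {x y : Res D M} (hx : x ∈ rightSet M w o j) (hy : y ∈ rightSet M w o j) :
    x + y ∈ rightSet M w o j := by
  obtain ⟨m, h1, h2, ⟨a, ha⟩, rfl⟩ := hx
  obtain ⟨m', h1', h2', ⟨a', ha'⟩, rfl⟩ := hy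
  refine ⟨_, h1.add h1', h2.add h2', ⟨max a a', fun i hi => ?_⟩, rfl⟩
  simp only [ha i ((le_max_left _ _).trans hi), ha' i ((le_max_right _ _).trans hi), add_zero]

theorem rightSet_smul {x : Res D M} (hx : x ∈ rightSet M w o j) (c : K) :
    c • x ∈ rightSet M w o j := by
  obtain ⟨m, h1, h2, ⟨a, ha⟩, rfl⟩ := hx
  obtain ⟨π, hπ1, hπ⟩ := w.exists_twist o j
  refine ⟨_, h1.smul hπ c, h2.congr fun _ => ⟨_, rfl⟩, ⟨a, fun i hi => ?_⟩, ?_⟩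
  · simp only [ha i hi, smul_zero]
  · simp [hπ1]

variable (M) in
/-- The elements at `j` of the chains which satisfy `1^-` at a left end and vanish up to `a`. -/
def leftSetFrom (w : Strand S) (o : ℤ → Prop) (a j : ℤ) : Set (Res D M) :=
  {x | ∃ m, w.Good o m ∧ w.LeftMinus m ∧ (∀ i ≤ a, m i = 0) ∧ m j = x}

theorem leftSetFrom_smul {x : Res D M} (hx : x ∈ leftSetFrom M w o a j) (c : K) :
    c • x ∈ leftSetFrom M w o a j := by
  obtain ⟨m, h1, h2, ha, rfl⟩ := hx
  obtain ⟨π, hπ1, hπ⟩ := w.exists_twist o j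
  refine ⟨_, h1.smul hπ c, h2.congr fun _ => ⟨_, rfl⟩, fun i hi => ?_, ?_⟩
  · simp only [ha i hi, smul_zero]
  · simp [hπ1]

/-- A chain that vanishes up to a does not see how the letters up to a are oriented. -/
theorem leftSetFrom_congr (ho : ∀ i, a < i → (o i ↔ o' i)) :
    leftSetFrom M w o a j ⊆ leftSetFrom M w o' a j := by
  rintro _ ⟨m, h1, h2, ha, rfl⟩
  refine ⟨m, h1.of_zero fun i => ?_, h2, ha, rfl⟩
  by_cases hi : a < i
  · exact Or.inl (ho i hi).symm
  · exact Or.inr ⟨ha _ (by omega), ha _ (by omega)⟩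

variable (M) in
/-- The elements of `leftSetFrom` for `o` are sums of such elements for `o'` and elements of
`rightSet` for `o'`. -/
def LeftLe (w : Strand S) (a j : ℤ) (o o' : ℤ → Prop) : Prop :=
  ∀ x ∈ leftSetFrom M w o a j, ∃ y ∈ leftSetFrom M w o' a j, ∃ z ∈ rightSet M w o' j, y + z = x

theorem LeftLe.of_subset (h : leftSetFrom M w o a j ⊆ leftSetFrom M w o' a j) :
    LeftLe M w a j o o' := by
  refine fun x hx => ⟨x, h hx, 0, ⟨fun _ => 0, ⟨⟨fun _ _ _ => zero_mem _, fun _ _ _ =>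
    LetterRel.zero _⟩, fun _ _ _ _ => zero_mem _, fun _ _ _ _ => zero_mem _⟩,
    fun _ _ _ _ => zero_mem _, ⟨0, fun _ _ => rfl⟩, rfl⟩, add_zero x⟩

theorem LeftLe.trans (h : LeftLe M w a j o o') (h' : LeftLe M w a j o' o'')
    (hr : rightSet M w o' j ⊆ rightSet M w o'' j) : LeftLe M w a j o o'' := by
  intro x hx
  obtain ⟨y, hy, z, hz, rfl⟩ := h x hx
  obtain ⟨y', hy', z', hz', rfl⟩ := h' y hy
  exact ⟨y', hy', z' + z, rightSet_add hz' (hr hz), by rw [add_assoc]⟩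

/-- Changing the orientation of a symmetry, using the reflected chain. -/
theorem SymmAt.flip (hk : SymmAt w k) (hns : D.NonSingularType) (hm : w.Good o m)
    (hl : w.LeftMinus m) (ha : ∀ i ≤ a, m i = 0) (ho : ∀ i, i ≠ k → (o' i ↔ o i))
    (hok : o' k ↔ ¬ o k)
    (hr : ∀ i, k < i → ∀ s hs, w.letter i = some (.star s hs) → (¬ o (2 * k - i) ↔ o i))
    (hkj : k ≤ j) : ∃ m', w.Good o' m' ∧ w.LeftMinus m' ∧ (∀ i ≤ a, m' i = 0) ∧
      ∃ c d : K, c ≠ 0 ∧ m' j = c • m j + d • m (2 * k - 1 - j) := by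
  obtain ⟨s, hs, hks⟩ := hk.1
  have hn := hk.good hm
  obtain ⟨c, d, hc, hch⟩ := hm.chain.flip hns hks ho hok (q := fun i => m (2 * k - 1 - i))
    (by congr 1; ring) (fun i _ v hv => hn.chain.mem i v hv) (by
      intro i hi z hz
      have := hn.chain.rel _ _ hz
      rw [add_sub_cancel_right] at this
      cases z with
      | star s hs => rwa [← propext (hr (i + 1) (by omega) s hs hz)]
      | _ => exact this)
  have hleft : ∀ {i : ℤ} {v : V}, w.rev.vertex i = some v → w.rev.letter (i + 1) = none →
      -i < k := fun hv hi => lt_of_left_end hks hv hi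
  refine ⟨_, ⟨hch, fun i v hv hi => ?_, fun i v hv hi => ?_⟩, fun i v hv hi => ?_,
    fun i hi => ?_, c j, d j, hc j, ?_⟩
  · by_cases h : i < k
    · simpa only [h, if_true] using hm.right i v hv hi
    · simp only [h, if_false]
      exact add_mem (Submodule.smul_mem _ _ (hm.right i v hv hi)) (Submodule.smul_mem _ _
        (hn.right i v hv hi))
  · simpa only [hleft hv hi, if_true] using hm.left i v hv hi
  · simpa only [hleft hv hi, if_true] using hl i v hv hi
  · by_cases h : i < k
    · simpa only [h, if_true] using ha i hi
    · simp only [h, if_false, ha i hi, ha (2 * k - 1 - i) (by omega), smul_zero, add_zero]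
  · simp only [hkj.not_gt, if_false]

end Closed

section Canonical

variable {K V A : Type*} [DivisionRing K] [Fintype V] {D : SemilinearClannishData K V A}
  {S : SignChoice D} {M : Type*} [AddCommGroup M] [Module D.Alg M]
  {w : Strand S} {m m' : ℤ → Res D M} {a k j t : ℤ}

/-- Only letters up to j change, and the left part of a chain can be refitted without touching the
rest. -/
theorem rightSet_tieOrient (hns : D.NonSingularType) (hw : w.Adm) (hj : (w.vertex j).isSome)
    {T T' : Set ℤ} (hT : ∀ i, j < i → (i ∈ T ↔ i ∈ T')) :
    topSet M w (tieOrient w T) j ⊆ topSet M w (tieOrient w T') j ∧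
      rightSet M w (tieOrient w T) j ⊆ rightSet M w (tieOrient w T') j :=
  refit_subset_right hns hw (compat_tieOrient hw T) (compat_tieOrient hw T') hj
    fun i hi _ _ _ => by simp only [tieOrient, hT i hi]

/-- With the symmetries before t direct and those after t inverse, the orientation is invariant
under reflection in t away from t, so the reflected chain can serve as correction. It vanishes far
to the right because the chain vanishes far to the left, and contributes only to `rightSet`. -/
theorem leftLe_tieOrient (hns : D.NonSingularType) (hw : w.Adm) (hj : (w.vertex j).isSome)
    {T T' : Set ℤ} (ht : t ≤ j) (hT : ∀ i, i < t → i ∈ T) (hT' : ∀ i, t < i → i ∉ T)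
    (htt : t ∈ T' ↔ t ∉ T) (hTT : ∀ i, i ≠ t → (i ∈ T' ↔ i ∈ T)) :
    LeftLe M w a j (tieOrient w T) (tieOrient w T') := by
  have hne : ∀ i, i ≠ t → (tieOrient w T' i ↔ tieOrient w T i) := fun i hi => by
    simp only [tieOrient, hTT i hi]
  by_cases hk : SymmAt w t
  · rintro _ ⟨m, h1, h2, ha, rfl⟩
    have hr : ∀ i, t < i → ∀ s hs, w.letter i = some (.star s hs) →
        (¬ tieOrient w T (2 * t - i) ↔ tieOrient w T i) := fun i hi s hs h =>
      hk.tieOrient_reflect hw h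
        ⟨fun h => absurd h (hT' i hi), fun h => absurd (hT (2 * t - i) (by omega)) h⟩
    obtain ⟨m', g1, g2, g3, c, d, hc, hcd⟩ := hk.flip (o' := tieOrient w T') hns h1 h2 ha hne
      (by
        have h1 := hk.2
        have h2 : ¬ LexLT ⊤ (w.read t) (w.readL (t - 1)) := fun h => h.not_eq h1.symm
        simp only [tieOrient, h1, h2, htt, false_or, true_and])
      hr ht
    -- The new entry is m'_j = c m_j + d m_{2t-1-j}; this solves for m_j.
    refine ⟨c⁻¹ • m' j, leftSetFrom_smul ⟨m', g1, g2, g3, rfl⟩ _,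
      (-(c⁻¹ * d)) • m (2 * t - 1 - j), rightSet_smul ?_ _, ?_⟩
    · refine (refit_subset_right hns hw (hk.compat (compat_tieOrient hw T))
        (compat_tieOrient hw T') hj (fun i hi s hs h => ?_)).2
        ⟨_, hk.good h1, hk.rightMinus h2, ⟨2 * t - 1 - a, fun i hi => ha _ (by omega)⟩, rfl⟩
      rw [hr i (by omega) s hs h, hne i (by omega)]
    · rw [hcd, smul_add, smul_smul, smul_smul, inv_mul_cancel₀ hc, one_smul, neg_smul,
        add_neg_cancel_right]
  · refine LeftLe.of_subset ?_
    rintro _ ⟨m, h1, h2, ha, rfl⟩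
    refine ⟨m, h1.congr fun i s hs hi => ?_, h2, ha, rfl⟩
    by_cases h : i = t
    · subst h
      have : ¬ EqUpTo ⊤ (w.readL (i - 1)) (w.read i) := fun h => hk ⟨⟨s, hs, hi⟩, h⟩
      simp only [tieOrient, this, false_and]
    · exact (hne i h).symm

theorem botSet_subset (h : ∀ a, ∃ a' ≤ a, LeftLe M w a' j o o')
    (hr : rightSet M w o j ⊆ rightSet M w o' j) : botSet M w o j ⊆ botSet M w o' j := by
  rintro _ ⟨_, ⟨m, h1, h2, ⟨a, ha⟩, rfl⟩, z, hz, rfl⟩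
  obtain ⟨a', ha', hle⟩ := h a
  obtain ⟨y, ⟨n, g1, g2, g3, g4⟩, z', hz', hyz⟩ := hle (m j)
    ⟨m, h1, h2, fun i hi => ha i (hi.trans ha'), rfl⟩
  exact ⟨y, ⟨n, g1, g2, ⟨a', g3⟩, g4⟩, z' + z, rightSet_add hz' (hr hz),
    by rw [← add_assoc, hyz]⟩

/-- For chains vanishing up to a, making the symmetries before a direct changes nothing. From there
the threshold moves right one position at a time, so finitely many steps suffice although there may
be infinitely many symmetries. -/
theorem leftLe_Iio (hns : D.NonSingularType) (hw : w.Adm) (hj : (w.vertex j).isSome)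
    (n : ℕ) (hn : a + n ≤ j + 1) :
    LeftLe M w a j (tieOrient w ∅) (tieOrient w (Set.Iio (a + n))) ∧
      LeftLe M w a j (tieOrient w (Set.Iio (a + n))) (tieOrient w ∅) := by
  have hr : ∀ T T' : Set ℤ, T ⊆ Set.Iic j → T' ⊆ Set.Iic j →
      rightSet M w (tieOrient w T) j ⊆ rightSet M w (tieOrient w T') j := fun T T' hT hT' =>
    (rightSet_tieOrient hns hw hj fun i hi =>
      ⟨fun h => absurd (hT h) (not_le.2 hi), fun h => absurd (hT' h) (not_le.2 hi)⟩).2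
  induction n with
  | zero =>
    have ho : ∀ i, a < i → (tieOrient w ∅ i ↔ tieOrient w (Set.Iio (a + (0 : ℕ))) i) := by
      intro i hi
      have : ¬ i < a := by omega
      simp [tieOrient, this]
    exact ⟨LeftLe.of_subset (leftSetFrom_congr ho),
      LeftLe.of_subset (leftSetFrom_congr fun i hi => (ho i hi).symm)⟩
  | succ n ih =>
    obtain ⟨ih1, ih2⟩ := ih (by push_cast at hn; omega)
    have ht : a + n ≤ j := by push_cast at hn; omega
    have h1 : LeftLe M w a j (tieOrient w (Set.Iio (a + n)))
        (tieOrient w (Set.Iio (a + (n + 1 : ℕ)))) := by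
      refine leftLe_tieOrient (t := a + n) hns hw hj ht ?_ ?_ ?_ ?_ <;>
      · simp only [Set.mem_Iio]; push_cast; omega
    have h2 : LeftLe M w a j (tieOrient w (Set.Iio (a + (n + 1 : ℕ))))
        (tieOrient w (Set.Iio (a + n))) := by
      refine leftLe_tieOrient (t := a + n) hns hw hj ht ?_ ?_ ?_ ?_ <;>
      · simp only [Set.mem_Iio]; push_cast; omega
    have hs1 : Set.Iio (a + (n : ℤ)) ⊆ Set.Iic j := fun i hi => by
      simp only [Set.mem_Iio, Set.mem_Iic] at *; omega
    have hs2 : Set.Iio (a + ((n + 1 : ℕ) : ℤ)) ⊆ Set.Iic j := fun i hi => by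
      simp only [Set.mem_Iio, Set.mem_Iic] at *; push_cast at *; omega
    exact ⟨ih1.trans h1 (hr _ _ hs1 hs2), h2.trans ih2 (hr _ _ hs1 (Set.empty_subset _))⟩

end Canonical

/-! ### Comparison of the special-direct, canonical and special-inverse orientations -/

section Main

variable {K : Type u₁} {V : Type u₂} {A : Type u₃} [DivisionRing K] [Fintype V]
  {D : SemilinearClannishData K V A} {S : SignChoice D} {w : Strand S} {j : ℤ}

/-- The assumption 0 ≤ j places all the symmetries to be changed on the left of j. The left part of
`botSet` is then preserved only modulo its right part, which is enough for the sum. -/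
theorem sim_tieOrient (hns : D.NonSingularType) (hw : w.Adm) (hj : (w.vertex j).isSome)
    (hj0 : 0 ≤ j) : Sim.{v} w (tieOrient w ∅) j w (tieOrient w (Set.Iic 0)) j := by
  intro M _ _
  have hr : ∀ i, j < i → (i ∈ (∅ : Set ℤ) ↔ i ∈ Set.Iic (0 : ℤ)) := fun i hi => by
    simp only [Set.mem_empty_iff_false, Set.mem_Iic, false_iff]
    omega
  have h1 := rightSet_tieOrient (M := M) hns hw hj hr
  have h2 := rightSet_tieOrient (M := M) hns hw hj fun i hi => (hr i hi).symm
  have h3 : ∀ a : ℤ, ∃ a' ≤ a, LeftLe M w a' j (tieOrient w ∅) (tieOrient w (Set.Iic 0)) ∧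
      LeftLe M w a' j (tieOrient w (Set.Iic 0)) (tieOrient w ∅) := by
    intro a
    -- The threshold starts at min a 0 and must end at 1, just after the last symmetry to be
    -- changed.
    have h := leftLe_Iio (M := M) (a := min a 0) hns hw hj (1 - min a 0).toNat (by omega)
    have e : Set.Iio (min a 0 + ((1 - min a 0).toNat : ℤ)) = Set.Iic 0 := by
      ext i
      simp only [Set.mem_Iio, Set.mem_Iic]
      omega
    rw [e] at h
    exact ⟨_, min_le_left _ _, h⟩
  refine ⟨h1.1.antisymm h2.1, (botSet_subset (fun a => ?_) h1.2).antisymm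
    (botSet_subset (fun a => ?_) h2.2)⟩
  · obtain ⟨a', h, h'⟩ := h3 a
    exact ⟨a', h, h'.1⟩
  · obtain ⟨a', h, h'⟩ := h3 a
    exact ⟨a', h, h'.2⟩

theorem sim_of_rev {o o' : ℤ → Prop} (h : Sim.{v} w.rev o j w.rev o' j) :
    Sim.{v} w (orev o) (-j) w (orev o') (-j) := by
  have h1 := Sim.rev.{v} w.rev o j
  have h2 := Sim.rev.{v} w.rev o' j
  rw [rev_rev] at h1 h2
  exact h1.trans (h.trans h2.symm)

/-- The reversed word is compared depth by depth at the single index -j, which gives the natural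
orientation with all symmetries inverse; those up to 0 are then made direct. -/
theorem exists_depth_sim_inverse (hns : D.NonSingularType) (hw : w.Adm) (hr : Regular w) :
    ∃ N : ℕ, ∀ j, 0 ≤ j → (w.vertex j).isSome → (∀ n : ℕ, n < N → Halts n w.rev (-j)) →
      Sim.{v} w (fun _ => False) j w (tieOrient w (Set.Iic 0)) j := by
  obtain ⟨N, hN⟩ := exists_sim_natOrient.{v} hns hw.rev hr.rev
  refine ⟨N, fun j hj0 hj hs => ?_⟩
  have h := sim_of_rev (hN (-j) hs)
  rw [neg_neg] at h
  refine (Sim.of_congr fun _ _ _ _ => ?_).trans (h.trans ((Sim.of_congr fun i s hs hi => ?_).trans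
    (sim_tieOrient hns hw hj hj0)))
  · simp [orev]
  · exact orev_natOrient hw hi

theorem PeriodicBy.exists_sim_inverse (hns : D.NonSingularType) (hw : w.Adm) {p : ℤ}
    (hp : PeriodicBy w p) : ∃ N : ℕ, ∀ i, RightMin N w.rev i →
      ∃ j, (w.vertex j).isSome ∧ Sim.{v} w (fun _ => False) j w (tieOrient w (Set.Iic 0)) j := by
  obtain ⟨N, hN⟩ := exists_depth_sim_inverse.{v} hns hw (Or.inr ⟨p, hp⟩)
  refine ⟨N, fun i hi => ?_⟩
  -- Shifting the reversed word by |i| periods to the left makes the index in w itself non-negative,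
  -- without affecting the halting points.
  have hi0 : 0 ≤ -(i - 1 + (-(i.natAbs : ℤ)) * p) := by
    have := hp.pos
    have : (i.natAbs : ℤ) * 1 ≤ i.natAbs * p := by gcongr; omega
    rw [neg_mul]
    omega
  refine ⟨_, hp.vertex_isSome _, hN _ hi0 (hp.vertex_isSome _) fun n hn => ?_⟩
  rw [neg_neg]
  exact hp.rev.halts (hp.rev.halt_add ((hi.mono (by exact_mod_cast hn.le)).halt hw.rev) _)

/-- The reflection k ↦ 1 - k of letters exchanges k ≤ 0 with its complement, and reversal negates
orientations, so the canonical rule for symmetries is preserved. -/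
theorem sim_direct_of_rev (hw : w.Adm)
    (h : Sim.{v} w.rev (fun _ => False) j w.rev (tieOrient w.rev (Set.Iic 0)) j) :
    Sim.{v} w (fun _ => True) (-j) w (tieOrient w (Set.Iic 0)) (-j) := by
  refine (Sim.of_congr fun _ _ _ _ => ?_).trans ((sim_of_rev h).trans
    (Sim.of_congr fun i s hs hi => ?_))
  · simp [orev]
  · rw [← orev_tieOrient hw (Set.Iic 0) hi]
    have : {k : ℤ | 1 - k ∉ Set.Iic (0 : ℤ)} = Set.Iic 0 := by
      ext k
      simp only [Set.mem_Iic, Set.mem_ofPred_eq]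
      omega
    rw [this]

/-- The special-direct or the special-inverse orientation defines the same subfunctors as the
canonical one at some index. -/
theorem exists_sim_canonical (hns : D.NonSingularType) (hw : w.Adm)
    (h : (∃ a b, 0 ≤ b ∧ IndexedBy w a b) ∨ ∃ p, PeriodicBy w p) :
    ∃ j, (w.vertex j).isSome ∧
      (Sim.{v} w (fun _ => True) j w (tieOrient w (Set.Iic 0)) j ∨
        Sim.{v} w (fun _ => False) j w (tieOrient w (Set.Iic 0)) j) := by
  rcases h with ⟨a, b, hb, h⟩ | ⟨p, h⟩
  -- At an end of a finite word the halting points are the same for all depths.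
  · obtain ⟨N, hN⟩ := exists_depth_sim_inverse.{v} hns hw (Or.inl ⟨a, b, h⟩)
    have hb' : (w.vertex b).isSome := (h.2 b).2 ⟨h.1, le_rfl⟩
    exact ⟨b, hb', Or.inr (hN b hb hb' fun n _ => h.rev.halts)⟩
  · by_cases hst : ∃ i s hs, w.rev.letter i = some (.star s hs)
    · obtain ⟨i, s, hs, hi⟩ := hst
      obtain ⟨N, hN⟩ := h.exists_sim_inverse.{v} hns hw
      obtain ⟨N', hN'⟩ := h.rev.exists_sim_inverse.{v} hns hw.rev
      rw [rev_rev] at hN'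
      -- One position must be minimal at every depth below the bound. Minima taken at the larger of
      -- the two bounds remain minimal at smaller depths, and if the right sides do not win in the
      -- reversed word, they do in w.
      have hmin : (∃ k, RightMin (max N N' : ℕ) w.rev k) ∨ ∃ k, RightMin (max N N' : ℕ) w k := by
        rcases exists_rightMin (max N N') hi with hk | ⟨k, hk, hk1, hk2⟩
        · exact Or.inl hk
        · refine Or.inr ⟨1 - k, s, hs, rev_star hk, fun l hl => ⟨fun hlt => ?_, fun hlt => ?_⟩⟩
          · have h1 := hk2 (1 - l) (rev_star_iff.2 (by simpa using hl))
            rw [rev_readL, rev_readL, show -(k - 1) = 1 - k by ring,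
              show -(1 - l - 1) = l by ring] at h1
            exact absurd hlt.lexCode_lt (not_lt.2 h1)
          · have h1 := hk1 (1 - l) (rev_star_iff.2 (by simpa using hl))
            rw [rev_readL, rev_read, show -(k - 1) = 1 - k by ring,
              show -(1 - l) = l - 1 by ring] at h1
            exact absurd hlt.lexCode_lt (not_lt.2 h1.le)
      rcases hmin with ⟨k, hk⟩ | ⟨k, hk⟩
      · obtain ⟨j, hj, hs⟩ := hN k (hk.mono (by exact_mod_cast le_max_left N N'))
        exact ⟨j, hj, Or.inr hs⟩
      · obtain ⟨j, hj, hs⟩ := hN' k (hk.mono (by exact_mod_cast le_max_right N N'))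
        exact ⟨-j, hj, Or.inl (sim_direct_of_rev hw hs)⟩
    · exact ⟨0, h.vertex_isSome 0, Or.inl (Sim.of_congr fun i s hs hi => absurd
        ⟨1 - i, s, hs, rev_star_iff.2 (by simpa using hi)⟩ hst)⟩

/-- An equivalence relation on orientations containing the relations `Sim` identifies the
special-direct, the canonical and the special-inverse orientations. -/
theorem orientations_rel (hns : D.NonSingularType) (hw : w.Adm)
    (h : (∃ a b, 0 ≤ b ∧ IndexedBy w a b) ∨ ∃ p, PeriodicBy w p)
    {r : (ℤ → Prop) → (ℤ → Prop) → Prop} (hsymm : ∀ o o', r o o' → r o' o)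
    (htrans : ∀ o o' o'', r o o' → r o' o'' → r o o'')
    (hsim : ∀ o o' j j', (w.vertex j).isSome → (w.vertex j').isSome →
      Sim.{v} w o j w o' j' → r o o') :
    r (fun _ => True) (tieOrient w (Set.Iic 0)) ∧
      r (tieOrient w (Set.Iic 0)) (fun _ => False) := by
  obtain ⟨j, hj, hc⟩ := exists_sim_canonical.{v} hns hw h
  have hr : Regular w := h.imp (fun ⟨a, b, _, h⟩ => ⟨a, b, h⟩) id
  suffices hr : r (fun _ => True) (fun _ => False) by
    rcases hc with hc | hc
    · have := hsim _ _ _ _ hj hj hc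
      exact ⟨this, htrans _ _ _ (hsymm _ _ this) hr⟩
    · have := hsim _ _ _ _ hj hj hc
      exact ⟨htrans _ _ _ hr this, hsymm _ _ this⟩
  -- A symmetry reflects one special walk to the other; without symmetries both lead to the same
  -- natural orientation.
  by_cases hs : ∃ k, SymmAt w k
  · obtain ⟨k, hk⟩ := hs
    obtain ⟨v, hv⟩ := Option.isSome_iff_exists.1 hj
    have h1 := hk.sim.{v} (fun _ => True) j
    simp only [not_true_eq_false] at h1
    exact hsim _ _ _ _ hj (by rw [(hk.vertex hv).1]; rfl) h1
  · have h1 := natOrient_rel.{v} hns hw hr htrans fun o o' j hj h => hsim o o' j j hj hj h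
    have h2 := natOrient_rel.{v} (r := fun o o' => r (orev o) (orev o')) hns hw.rev hr.rev
      (fun _ _ _ => htrans _ _ _) fun o o' j hj h =>
        hsim _ _ (-j) (-j) hj hj (sim_of_rev h)
    have h3 : r (natOrient ⊤ w) (orev (natOrient ⊤ w.rev)) := by
      refine hsim _ _ j j hj hj (Sim.of_congr fun i s hs' hi => ?_)
      rw [orev_natOrient hw hi, natOrient_top_iff hw hi]
      have : ¬ EqUpTo ⊤ (w.readL (i - 1)) (w.read i) := fun h => hs ⟨i, ⟨s, hs', hi⟩, h⟩
      simp [tieOrient, this]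
    have h4 : orev (fun _ => True) = fun _ => False := by
      funext i
      simp [orev]
    rw [h4] at h2
    exact htrans _ _ _ h1 (htrans _ _ _ h3 (hsymm _ _ h2))

end Main

end Strand

/-! ## Words as strands -/

open SemilinearClannishData

section Bridge

variable {K V A : Type*} [DivisionRing K] {D : SemilinearClannishData K V A} {S : SignChoice D}

theorem IsIndexSet.ordConnected {I : Set ℤ} (h : IsIndexSet I) : I.OrdConnected := by
  rcases h with ⟨n, rfl⟩ | rfl | rfl | rfl <;> infer_instance

theorem IsIndexSet.isLeast {I : Set ℤ} (h : IsIndexSet I) {i : ℤ} (hi : IsLeast I i) :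
    i = 0 := by
  rcases h with ⟨n, rfl⟩ | rfl | rfl | rfl
  · exact hi.unique (isLeast_Icc (by omega))
  · exact hi.unique isLeast_Ici
  · have := hi.2 (show i - 1 ∈ Set.Iic (0 : ℤ) from (sub_le_self i zero_le_one).trans hi.1)
    omega
  · have := hi.2 (Set.mem_univ (i - 1))
    omega

namespace Word

theorem mem_of_vertex (w : Word S) {i : ℤ} {v : V} (h : w.vertex i = some v) : i ∈ w.I :=
  (w.vertex_isSome i).1 (by rw [h]; rfl)

theorem letter_ne_none (w : Word S) {i j : ℤ} (hi : i ∈ w.I) (hj : j ∈ w.I) {k : ℤ} (hik : i < k)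
    (hkj : k ≤ j) : w.letter k ≠ none := by
  rw [← Option.isSome_iff_ne_none, w.letter_isSome]
  have := w.isIndexSet.ordConnected.out hi hj
  exact ⟨this ⟨by omega, hkj⟩, this ⟨by omega, by omega⟩⟩

theorem letter_eq_none (w : Word S) {k : ℤ} (h : ¬ (k ∈ w.I ∧ k - 1 ∈ w.I)) :
    w.letter k = none := by
  rwa [← Option.not_isSome_iff_eq_none, w.letter_isSome]

/-- A word, as a strand. -/
def toStrand (w : Word S) : Strand S where
  vertex := w.vertex
  letter := w.letter
  sgn := w.signAt
  head_letter := w.head_letter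
  tail_letter := w.tail_letter
  sgn_letter _ _ h := (w.signAt_of_succ h).symm
  sgn_inverse _ _ h := w.sgn_inverse_eq h
  right_none i v hv h j hj := w.letter_eq_none fun h' =>
    w.letter_ne_none (w.mem_of_vertex hv) h'.1 (lt_add_one i) hj h
  left_none i v hv h j hj := w.letter_eq_none fun h' =>
    w.letter_ne_none h'.2 (w.mem_of_vertex hv) (by omega) le_rfl h

theorem isGreatest_iff (w : Word S) {i : ℤ} :
    IsGreatest w.I i ↔ i ∈ w.I ∧ w.letter (i + 1) = none := by
  constructor
  · refine fun h => ⟨h.1, w.letter_eq_none fun h' => ?_⟩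
    have := h.2 h'.1
    omega
  · refine fun h => ⟨h.1, fun k hk => ?_⟩
    by_contra hcon
    exact w.letter_ne_none h.1 hk (lt_add_one i) (by omega) h.2

theorem isLeast_iff (w : Word S) {i : ℤ} :
    IsLeast w.I i ↔ i ∈ w.I ∧ w.letter i = none := by
  constructor
  · refine fun h => ⟨h.1, w.letter_eq_none fun h' => ?_⟩
    have := h.2 h'.2
    omega
  · refine fun h => ⟨h.1, fun k hk => ?_⟩
    by_contra hcon
    exact w.letter_ne_none hk h.1 (by omega) le_rfl h.2

theorem signAt_zero (w : Word S) : w.signAt 0 = w.sign := by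
  rcases h : w.letter (0 + 1) with _ | y
  · rcases h' : w.letter 0 with _ | x
    · simp only [signAt, h, h']
    · have h1 := w.sgn_inverse_eq h'
      rw [w.sign_zero _ h'] at h1
      exact neg_injective h1.symm
  · rw [w.signAt_of_succ h, w.sign_one _ (by simpa using h)]

theorem EndAdmissible.adm {w : Word S} (h : w.EndAdmissible) : w.toStrand.Adm := by
  constructor
  · intro i v hv hi s hs hd hsgn
    exact h.1 i (w.isGreatest_iff.2 ⟨w.mem_of_vertex hv, hi⟩) s hs
      ⟨hv.trans (congrArg some hd.symm), hsgn⟩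
  · intro i v hv hi s hs hd hsgn
    rw [Strand.rev_letter, Option.map_eq_none_iff, sub_add_cancel_right] at hi
    exact h.2 (-i) (w.isLeast_iff.2 ⟨w.mem_of_vertex hv, hi⟩) s hs
      ⟨hv.trans (congrArg some hd.symm), hsgn⟩

theorem IsFinite.indexedBy {w : Word S} (h : w.IsFinite) :
    ∃ a b, 0 ≤ b ∧ w.toStrand.IndexedBy a b := by
  obtain ⟨n, hn⟩ := h
  refine ⟨0, n, by omega, by omega, fun i => (w.vertex_isSome i).trans ?_⟩
  rw [hn]
  rfl

theorem IsPeriodic.periodicBy {w : Word S} (h : w.IsPeriodic) :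
    ∃ p, w.toStrand.PeriodicBy p := by
  obtain ⟨hI, p, hp, hper⟩ := h
  have hs : ∀ i, (w.letter i).isSome := fun i => by
    rw [w.letter_isSome, hI]
    exact ⟨trivial, trivial⟩
  have hl : ∀ i, w.letter (i + p) = w.letter i := fun i => by rw [add_comm, hper]
  refine ⟨p, hp, hs, fun i => ?_, hl, fun i => ?_⟩
  · obtain ⟨x, hx⟩ := Option.isSome_iff_exists.1 (hs i)
    exact (w.tail_letter _ _ ((hl i).trans hx)).trans (w.tail_letter _ _ hx).symm
  · obtain ⟨x, hx⟩ := Option.isSome_iff_exists.1 (hs (i + 1))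
    refine (w.signAt_of_succ ?_).trans (w.signAt_of_succ hx).symm
    rw [← hx, ← hl (i + 1)]
    congr 1; ring

theorem right_letter (w : Word S) {i : ℤ} (hi : i ∈ w.I) (n : ℕ) :
    (w.right i hi).letter (n + 1) = w.toStrand.read i n := by
  simp only [right, Strand.read, show (0 : ℤ) < n + 1 by omega, if_true]
  exact congrArg w.letter (by ring)

theorem leftInv_letter (w : Word S) {i : ℤ} (hi : i ∈ w.I) (n : ℕ) :
    (w.leftInv i hi).letter (n + 1) = w.toStrand.readL i n := by
  simp only [leftInv, Strand.readL_apply, show (0 : ℤ) < n + 1 by omega, if_true]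
  exact congrArg (fun k => (w.letter k).map Letter.inverse) (by ring)

end Word

/-- Where the words first differ, no `*`-letter occurs. -/
theorem Strand.SameAt.lexLT_cases {u w : Strand S} {l i : ℤ} (h : SameAt u l w i)
    (hu : u.RightAdm) (hw : w.RightAdm) {n : ℕ} (hn : ∀ k < n, u.read l k = w.read i k)
    (hlt : Letter.rank (u.read l n) < Letter.rank (w.read i n)) :
    (∃ y hy x hx, u.read l n = some (.dir y hy) ∧ w.read i n = some (.inv x hx)) ∨
      (∃ y hy, u.read l n = some (.dir y hy) ∧ w.read i n = none) ∨
      (∃ x hx, u.read l n = none ∧ w.read i n = some (.inv x hx)) := by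
  by_cases hs : ∀ k < n, (u.read l k).isSome
  · have h1 := h.add n hn hs
    have e1 : u.letter (l + n + 1) = u.read l n := by rw [read]; congr 1; ring
    have e2 : w.letter (i + n + 1) = w.read i n := by rw [read]; congr 1; ring
    have h2 : ∀ s hs, w.read i n = some (.star s hs) → u.read l n = some (.star s hs) := by
      intro s hs' h3
      rw [← e1]
      exact h1.eq_star hu (e2.trans h3)
    have h3 : ∀ s hs, u.read l n = some (.star s hs) → w.read i n = some (.star s hs) := by
      intro s hs' h3
      rw [← e2]
      exact h1.symm.eq_star hw (e1.trans h3)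
    rcases hx : u.read l n with _ | x <;> rcases hy : w.read i n with _ | y
    · rw [hx, hy] at hlt
      exact absurd hlt (lt_irrefl _)
    · cases y with
      | dir b hb => rw [hx, hy] at hlt; simp [Letter.rank] at hlt
      | inv b hb => exact Or.inr (Or.inr ⟨b, hb, rfl, rfl⟩)
      | star s hs' => rw [h2 s hs' hy] at hx; cases hx
    · cases x with
      | dir b hb => exact Or.inr (Or.inl ⟨b, hb, rfl, rfl⟩)
      | inv b hb => rw [hx, hy] at hlt; simp [Letter.rank] at hlt
      | star s hs' => rw [h3 s hs' hx] at hy; cases hy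
    · cases x with
      | dir b hb =>
        cases y with
        | dir c hc => rw [hx, hy] at hlt; simp [Letter.rank] at hlt
        | inv c hc => exact Or.inl ⟨b, hb, c, hc, rfl, rfl⟩
        | star s hs' => rw [h2 s hs' hy] at hx; cases hx
      | inv b hb =>
        rw [hx, hy] at hlt
        have := Letter.rank_le (some y)
        simp only [Letter.rank] at hlt this
        omega
      | star s hs' =>
        rw [hx, h3 s hs' hx] at hlt
        exact absurd hlt (lt_irrefl _)
  · exfalso
    push Not at hs
    obtain ⟨k, hk, hmin⟩ := exists_minimal_code (p := fun k => k < n ∧ ¬ (u.read l k).isSome)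
      id (by simpa using hs)
    have h1 : ∀ k' < k, (u.read l k').isSome := by
      intro k' hk'
      by_contra hcon
      have := hmin k' ⟨hk'.trans hk.1, hcon⟩
      simp only [id] at this
      omega
    have h2 : u.read l k = none := Option.not_isSome_iff_eq_none.1 hk.2
    rw [read_none h h1 h2 hk.1.le, read_none h.symm
      (fun k' hk' => by rw [← hn k' (hk'.trans hk.1)]; exact h1 k' hk')
      (by rw [← hn k hk.1]; exact h2) hk.1.le] at hlt
    exact lt_irrefl _ hlt

namespace Word

variable {w : Word S}

theorem mem_of_letter (w : Word S) {i : ℤ} {x : Letter D} (h : w.letter i = some x) :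
    i ∈ w.I ∧ i - 1 ∈ w.I := (w.letter_isSome i).1 (by rw [h]; rfl)

/-- The rank comparison agrees with the order on words since no *-letter is involved at the first
difference, by end-admissibility. -/
theorem isNaturallyDirect_iff (hw : w.EndAdmissible) {i : ℤ} {s : A} {hs : s ∈ D.Sp}
    (hi : w.letter i = some (.star s hs)) : w.IsNaturallyDirect i ↔
      LexLT ⊤ (w.toStrand.read i) (w.toStrand.readL (i - 1)) := by
  have hsame : Strand.SameAt w.toStrand i w.toStrand.rev (-(i - 1)) :=
    (Strand.sameAt_sides (w := w.toStrand) hi).symm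
  constructor
  · rintro ⟨h, h', -, -, -, n, hn, hlt⟩
    refine ⟨n, WithTop.coe_lt_top _, fun k hk => ?_, ?_⟩
    · rw [← right_letter w h, ← leftInv_letter w h']
      exact hn _ (by omega) (by omega)
    · rw [right_letter, leftInv_letter] at hlt
      rcases hlt with ⟨y, hy, x, hx, h1, h2⟩ | ⟨y, hy, h1, h2⟩ | ⟨x, hx, h1, h2⟩ <;>
      · rw [h1, h2]
        simp [Letter.rank]
  · rintro ⟨n, -, hn, hlt⟩
    obtain ⟨h, h'⟩ := w.mem_of_letter hi
    refine ⟨h, h', s, hs, hi, n, fun k h1 h2 => ?_, ?_⟩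
    · obtain ⟨k, rfl⟩ : ∃ k' : ℕ, k = k' + 1 := ⟨(k - 1).toNat, by omega⟩
      rw [right_letter, leftInv_letter]
      exact hn k (by omega)
    · rw [right_letter, leftInv_letter]
      exact hsame.lexLT_cases hw.adm.1 hw.adm.2 hn hlt

/-- Equality of words also concerns index sets, vertices and signs; all of these follow from
equality of letters by the reflection in i. -/
theorem isSymmetry_iff {i : ℤ} {s : A} {hs : s ∈ D.Sp}
    (hi : w.letter i = some (.star s hs)) : w.IsSymmetry i ↔
      EqUpTo ⊤ (w.toStrand.readL (i - 1)) (w.toStrand.read i) := by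
  constructor
  · rintro ⟨h, h', -, -, -, heq⟩ k -
    rw [← right_letter w h, ← leftInv_letter w h', heq]
  · intro heq
    obtain ⟨h, h'⟩ := w.mem_of_letter hi
    have hk : w.toStrand.SymmAt i := ⟨⟨s, hs, hi⟩, heq⟩
    have hv : ∀ k : ℤ, w.vertex (i - 1 - k) = w.vertex (i + k) := by
      intro k
      ext v
      constructor
      · intro h1
        have := (hk.vertex h1).1
        rwa [show 2 * i - 1 - (i - 1 - k) = i + k by ring] at this
      · intro h1
        have := (hk.vertex h1).1
        rwa [show 2 * i - 1 - (i + k) = i - 1 - k by ring] at this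
    refine ⟨h, h', s, hs, hi, Word.ext ?_ ?_ ?_ ?_⟩
    · ext k
      simp only [leftInv, right, Set.mem_ofPred_eq, ← w.vertex_isSome, hv]
    · funext k
      simp only [leftInv, right, hv]
    · funext k
      by_cases hk0 : 0 < k
      · have := leftInv_letter w h' (k - 1).toNat
        rw [heq _ (WithTop.coe_lt_top _), ← right_letter w h] at this
        rwa [show ((k - 1).toNat : ℤ) + 1 = k by omega] at this
      · simp only [leftInv, right, hk0, if_false]
    · obtain ⟨v, hv⟩ := Option.isSome_iff_exists.1 ((w.vertex_isSome i).2 h)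
      have := (hk.vertex hv).2
      rw [show 2 * i - 1 - i = i - 1 by ring] at this
      exact neg_eq_iff_eq_neg.2 this

/-- The orientation of the canonical walk. -/
theorem canonical_iff (hw : w.EndAdmissible) {i : ℤ} {s : A} {hs : s ∈ D.Sp}
    (hi : w.letter i = some (.star s hs)) :
    w.IsNaturallyDirect i ∨ (w.IsSymmetry i ∧ i ≤ 0) ↔
      Strand.tieOrient w.toStrand (Set.Iic 0) i := by
  rw [isNaturallyDirect_iff hw hi, isSymmetry_iff hi]
  rfl

theorem orient_letter (w : Word S) (p : ℤ → Prop) (i : ℤ) :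
    (w.orient p).letter i = (w.letter i).map fun x => x.orient (p i) := by
  simp only [orient]
  congr 1
  funext x
  cases x <;> rfl

end Word

end Bridge

open SemilinearClannishData

/-! ### The subfunctors defined by half-walks -/

section Halves

variable {K V A : Type*} [DivisionRing K] {D : SemilinearClannishData K V A} {S : SignChoice D}

namespace Strand

variable {w : Strand S} {i : ℤ}

/-- There are no gaps between the letters. -/
def Connected (w : Strand S) : Prop :=
  ∀ i j, (w.vertex i).isSome → (w.vertex j).isSome → i < j →
    w.letter (i + 1) ≠ none ∧ w.letter j ≠ none

theorem Connected.rev (h : Connected w) : Connected w.rev := by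
  intro i j hi hj hij
  obtain ⟨h1, h2⟩ := h (-j) (-i) hj hi (by omega)
  simp only [rev_letter, ne_eq, Option.map_eq_none_iff]
  refine ⟨?_, ?_⟩
  · rwa [show 1 - (i + 1) = -i by ring]
  · rwa [show 1 - j = -j + 1 by ring]

theorem glue_right (hw : Connected w) (hi : (w.vertex i).isSome) {α : Type*} {m m' : ℤ → α}
    {P : ℤ → V → α → Prop} (h : ∀ k v, i ≤ k → w.vertex k = some v → w.letter (k + 1) = none → P k v (m k)) :
    ∀ k v, w.vertex k = some v → w.letter (k + 1) = none →
      P k v (if i ≤ k then m k else m' (-k)) := by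
  intro k v hv hk
  have : i ≤ k := by
    by_contra hcon
    exact (hw k i (by rw [hv]; rfl) hi (by omega)).1 hk
  simpa only [this, if_true] using h k v this hv hk

theorem glue_left (hw : Connected w) (hi : (w.vertex i).isSome) {α : Type*} {m m' : ℤ → α}
    (he : m i = m' (-i))
    {P : ℤ → V → α → Prop}
    (h : ∀ k v, -i ≤ k → w.rev.vertex k = some v → w.rev.letter (k + 1) = none → P k v (m' k)) :
    ∀ k v, w.rev.vertex k = some v → w.rev.letter (k + 1) = none →
      P k v (if i ≤ -k then m (-k) else m' (- -k)) := by
  intro k v hv hk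
  have h1 : -i ≤ k := by
    by_contra hcon
    exact (hw.rev k (-i) (by rw [hv]; rfl) (by rwa [rev_vertex, neg_neg]) (by omega)).1 hk
  have h2 := h k v h1 hv hk
  by_cases h3 : i ≤ -k
  · obtain rfl : k = -i := by omega
    rwa [if_pos h3, neg_neg, he]
  · simpa only [h3, if_false, neg_neg] using h2

end Strand

/-- The walk `E` is the part of the strand `u` with orientation `o` to the right of `l`. -/
structure Walk.HalfOf (E : Walk S) (u : Strand S) (o : ℤ → Prop) (l : ℤ) : Prop where
  nonneg : ∀ k ∈ E.word.I, 0 ≤ k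
  vertex : ∀ k, 0 ≤ k → E.word.vertex k = u.vertex (l + k)
  letter : ∀ k, 0 < k → E.word.letter k = u.letter (l + k)
  orient : ∀ k, 0 < k → E.letter k = (u.letter (l + k)).map fun x => x.orient (o (l + k))
  sign : E.word.sign = u.sgn l

namespace Walk.HalfOf

variable {E : Walk S} {u : Strand S} {o : ℤ → Prop} {l : ℤ}

theorem signAt (h : E.HalfOf u o l) {k : ℤ} (hk : k ∈ E.word.I) :
    E.word.signAt k = u.sgn (l + k) := by
  have hk0 := h.nonneg k hk
  rcases eq_or_lt_of_le hk0 with rfl | hk0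
  · rw [Word.signAt_zero, h.sign, add_zero]
  · have h0 : (0 : ℤ) ∈ E.word.I := by
      obtain ⟨n, hn⟩ | hI | hI | hI := E.word.isIndexSet
      · rw [hn] at hk ⊢; exact ⟨le_rfl, hk0.le.trans hk.2⟩
      · rw [hI]; exact Set.self_mem_Ici
      · rw [hI] at hk; exact absurd hk (not_le.2 hk0)
      · rw [hI]; trivial
    obtain ⟨x, hx⟩ := Option.ne_none_iff_exists'.1
      (E.word.letter_ne_none h0 hk hk0 le_rfl)
    have h1 := E.word.sgn_inverse_eq hx
    rw [h.letter k hk0] at hx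
    rw [u.sgn_inverse _ _ hx] at h1
    exact (neg_injective h1).symm

theorem isGreatest_iff (h : E.HalfOf u o l) {k : ℤ} {v : V} (hv : E.word.vertex k = some v) :
    IsGreatest E.word.I k ↔ u.letter (l + k + 1) = none := by
  have hk := E.word.mem_of_vertex hv
  have hk0 := h.nonneg k hk
  rw [Word.isGreatest_iff, h.letter (k + 1) (by omega), ← add_assoc]
  exact and_iff_right hk

end Walk.HalfOf

namespace Word

variable {i : ℤ}

theorem connected (w : Word S) : w.toStrand.Connected := fun i j hi hj hij =>
  ⟨w.letter_ne_none ((w.vertex_isSome i).1 hi) ((w.vertex_isSome j).1 hj) (by omega) hij,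
    w.letter_ne_none ((w.vertex_isSome i).1 hi) ((w.vertex_isSome j).1 hj) hij le_rfl⟩

theorem halfOf_right (w : Word S) (p : ℤ → Prop) (hi : i ∈ w.I) :
    ((w.orient p).right i hi).HalfOf w.toStrand p i := by
  refine ⟨fun k hk => hk.1, fun k hk => ?_, fun k hk => ?_, fun k hk => ?_, rfl⟩
  · exact if_pos hk
  · exact if_pos hk
  · exact (if_pos hk).trans (w.orient_letter p _)

theorem halfOf_leftInv (w : Word S) (p : ℤ → Prop) (hi : i ∈ w.I) :
    ((w.orient p).leftInv i hi).HalfOf w.toStrand.rev (orev p) (-i) := by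
  have e : ∀ k : ℤ, 1 - (-i + k) = i + 1 - k := fun k => by ring
  refine ⟨fun k hk => hk.1, fun k hk => ?_, fun k hk => ?_, fun k hk => ?_, ?_⟩
  · refine (if_pos hk).trans ?_
    rw [Strand.rev_vertex, show -(-i + k) = i - k by ring]
    rfl
  · refine (if_pos hk).trans ?_
    rw [Strand.rev_letter, e]
    rfl
  · refine (if_pos hk).trans ?_
    rw [w.orient_letter, Strand.rev_letter, Option.map_map, Option.map_map, e]
    change _ = (w.letter (i + 1 - k)).map _
    congr 1
    funext x
    rw [Function.comp_apply, Function.comp_apply, ← Letter.orient_inverse, orev, e]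
  · rw [Strand.rev_sgn, neg_neg]
    rfl

end Word

end Halves

section HalfChains

variable {K V A : Type*} [DivisionRing K] [Fintype V] {D : SemilinearClannishData K V A}
  {S : SignChoice D} {M : Type*} [AddCommGroup M] [Module D.Alg M]

namespace Strand

variable {u w : Strand S} {o : ℤ → Prop} {l i : ℤ} {m m' : ℤ → Res D M}

/-- A chain on the part of `u` to the right of `l`. -/
structure HalfChain (u : Strand S) (o : ℤ → Prop) (l : ℤ) (m : ℤ → Res D M) : Prop where
  mem : ∀ i v, l ≤ i → u.vertex i = some v → m i ∈ vertexSpace D M v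
  rel : u.HalfRel o l m

variable (M) in
/-- The elements at `l` of the chains to the right of `l` which satisfy `1^+` at a right end. -/
def halfPlus (u : Strand S) (o : ℤ → Prop) (l : ℤ) : Set (Res D M) :=
  {x | ∃ m, u.HalfChain o l m ∧ (∀ i v, l ≤ i → u.vertex i = some v → u.letter (i + 1) = none →
    m i ∈ trivialPlus M S v (u.sgn i)) ∧ m l = x}

variable (M) in
/-- The elements at `l` of the chains to the right of `l` which satisfy `1^-` at a right end and
vanish far to the right. -/
def halfMinus (u : Strand S) (o : ℤ → Prop) (l : ℤ) : Set (Res D M) :=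
  {x | ∃ m, u.HalfChain o l m ∧ (∀ i v, l ≤ i → u.vertex i = some v → u.letter (i + 1) = none →
    m i ∈ trivialMinus M S v (u.sgn i)) ∧ (∃ a, ∀ i, a ≤ i → m i = 0) ∧ m l = x}

theorem Chain.half (h : w.Chain o m) (l : ℤ) : w.HalfChain o l m :=
  ⟨fun i v _ hv => h.mem i v hv, fun i _ z hz => by simpa using h.rel _ z hz⟩

/-- Chains on both sides of `i` form a chain. -/
theorem HalfChain.glue (h : w.HalfChain o i m) (h' : w.rev.HalfChain (orev o) (-i) m')
    (he : m i = m' (-i)) : w.Chain o (fun k => if i ≤ k then m k else m' (-k)) := by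
  refine ⟨fun k v hv => ?_, fun k x hx => ?_⟩
  · by_cases hk : i ≤ k
    · simpa only [hk, if_true] using h.mem k v hk hv
    · simp only [hk, if_false]
      exact h'.mem (-k) v (by omega) (by rwa [rev_vertex, neg_neg])
  · by_cases hk : i ≤ k - 1
    · simp only [hk, show i ≤ k by omega, if_true]
      simpa using h.rel (k - 1) hk x (by simpa using hx)
    · have h1 := h'.rel (-k) (by omega) x.inverse (by
        rw [rev_letter, sub_add_cancel_right, neg_neg, hx]; rfl)
      rw [show orev o (-k + 1) = ¬ o k by simp [orev], Letter.orient_inverse,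
        LetterRel.inverse] at h1
      simp only [hk, if_false]
      rw [show -(k - 1) = -k + 1 by ring]
      by_cases hk' : i ≤ k
      · obtain rfl : i = k := by omega
        simpa only [le_refl, if_true, he] using h1
      · simpa only [hk', if_false] using h1

theorem topSet_eq (hw : Connected w) (hi : (w.vertex i).isSome) :
    topSet M w o i = halfPlus M w o i ∩ halfPlus M w.rev (orev o) (-i) := by
  ext x
  constructor
  · rintro ⟨m, hm, rfl⟩
    exact ⟨⟨m, hm.chain.half i, fun k v _ => hm.right k v, rfl⟩,
      ⟨fun k => m (-k), hm.chain.rev.half (-i), fun k v _ => hm.left k v, by simp⟩⟩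
  · rintro ⟨⟨m, h1, h2, rfl⟩, ⟨m', h3, h4, h5⟩⟩
    exact ⟨_, ⟨h1.glue h3 h5.symm, glue_right hw hi h2, glue_left hw hi h5.symm h4⟩, by simp⟩

/-- In gluing two halves, 1^+ at the right end comes from 1^-, which admissibility makes the
stronger condition. -/
theorem rightSet_eq (hw : Connected w) (hadm : w.Adm) (hi : (w.vertex i).isSome) :
    rightSet M w o i = halfMinus M w o i ∩ halfPlus M w.rev (orev o) (-i) := by
  ext x
  constructor
  · rintro ⟨m, hm, hr, ha, rfl⟩
    exact ⟨⟨m, hm.chain.half i, fun k v _ => hr k v, ha, rfl⟩,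
      ⟨fun k => m (-k), hm.chain.rev.half (-i), fun k v _ => hm.left k v, by simp⟩⟩
  · rintro ⟨⟨m, h1, h2, ⟨a, ha⟩, rfl⟩, ⟨m', h3, h4, h5⟩⟩
    have hr : w.RightMinus (fun k => if i ≤ k then m k else m' (-k)) := glue_right hw hi h2
    refine ⟨_, ⟨h1.glue h3 h5.symm, hr.plus hadm.1, glue_left hw hi h5.symm h4⟩, hr,
      ⟨max a i, fun k hk => ?_⟩, by simp⟩
    simp only [(le_max_right a i).trans hk, if_true, ha k ((le_max_left a i).trans hk)]

theorem leftSet_eq (hw : Connected w) (hadm : w.Adm) (hi : (w.vertex i).isSome) :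
    leftSet M w o i = halfPlus M w o i ∩ halfMinus M w.rev (orev o) (-i) := by
  rw [← rightSet_rev, rightSet_eq hw.rev hadm.rev (by rwa [rev_vertex, neg_neg]), rev_rev,
    orev_orev, neg_neg, Set.inter_comm]

end Strand

namespace Walk.HalfOf

open Strand

variable {E : Walk S} {u : Strand S} {o : ℤ → Prop} {l : ℤ}

theorem halfChain (h : E.HalfOf u o l) {m : ℤ → Res D M} (hm : E.IsChain m) :
    u.HalfChain o l (fun k => m (k - l)) := by
  refine ⟨fun i v hi hv => hm.1 _ v ?_, fun i hi z hz => ?_⟩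
  · rw [h.vertex _ (by omega), add_sub_cancel, hv]
  · have := hm.2 (i + 1 - l) (z.orient (o (i + 1))) (by
      rw [h.orient _ (by omega), add_sub_cancel, hz]; rfl)
    convert this using 2
    ring

theorem isChain (h : E.HalfOf u o l) {m : ℤ → Res D M} (hm : u.HalfChain o l m) :
    E.IsChain (fun k => m (l + k)) := by
  refine ⟨fun k v hv => ?_, fun k x hx => ?_⟩
  · have hk := h.nonneg k (E.word.mem_of_vertex hv)
    exact hm.mem _ v (by omega) (by rwa [← h.vertex k hk])
  · have hk : k - 1 ∈ E.word.I := by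
      have h1 := E.star_letter k
      rw [hx] at h1
      exact (E.word.mem_of_letter h1.symm).2
    have hk0 := h.nonneg _ hk
    rw [h.orient k (by omega), Option.map_eq_some_iff] at hx
    obtain ⟨y, hy, rfl⟩ := hx
    have := hm.rel (l + k - 1) (by omega) y (by simpa using hy)
    rw [sub_add_cancel] at this
    convert this using 2
    ring

theorem mem_plus (h : E.HalfOf u o l) {x : Res D M} : x ∈ E.plus M ↔ x ∈ halfPlus M u o l := by
  constructor
  · rintro ⟨m, hm, rfl, he⟩
    refine ⟨_, h.halfChain hm, fun i v hi hv hl => ?_, by simp⟩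
    have hv' : E.word.vertex (i - l) = some v := by
      rw [h.vertex _ (by omega), add_sub_cancel, hv]
    have := he (i - l) v ((h.isGreatest_iff hv').2 (by rwa [add_sub_cancel])) hv'
    rwa [h.signAt (E.word.mem_of_vertex hv'), add_sub_cancel] at this
  · rintro ⟨m, hm, he, rfl⟩
    refine ⟨_, h.isChain hm, by simp, fun k v hk hv => ?_⟩
    have hk0 := h.nonneg k hk.1
    have := he (l + k) v (by omega) (by rwa [← h.vertex k hk0]) ((h.isGreatest_iff hv).1 hk)
    rwa [h.signAt hk.1]

theorem mem_minus (h : E.HalfOf u o l) {x : Res D M} :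
    x ∈ E.minus M ↔ x ∈ halfMinus M u o l := by
  constructor
  · rintro ⟨m, hm, rfl, he, hz⟩
    obtain ⟨n, hn⟩ | hI | hI | hI := E.word.isIndexSet
    · have hm' : E.IsChain (fun k => if k ≤ n then m k else 0) := by
        refine ⟨fun k v hv => ?_, fun k x hx => ?_⟩
        · by_cases hk : k ≤ n
          · simpa only [hk, if_true] using hm.1 k v hv
          · simp only [hk, if_false]; exact zero_mem _
        · have h1 := E.star_letter k
          rw [hx] at h1
          have hk := (E.word.mem_of_letter h1.symm).1
          rw [hn] at hk
          simp only [hk.2, show k - 1 ≤ n from by linarith [hk.2], if_true]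
          exact hm.2 k x hx
      refine ⟨_, h.halfChain hm', fun i v hi hv hl => ?_, ⟨l + n + 1, fun i hi => ?_⟩, ?_⟩
      · have hv' : E.word.vertex (i - l) = some v := by
          rw [h.vertex _ (by omega), add_sub_cancel, hv]
        have hmem := E.word.mem_of_vertex hv'
        have := he (i - l) v ((h.isGreatest_iff hv').2 (by rwa [add_sub_cancel])) hv'
        rw [h.signAt hmem, add_sub_cancel] at this
        rw [hn] at hmem
        simpa only [hmem.2, if_true] using this
      · simp only [show ¬ i - l ≤ n by omega, if_false]
      · simp
    all_goals
      obtain ⟨n, hn⟩ := hz (by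
        rw [hI]
        first
        | exact not_bddAbove_univ
        | exact not_bddAbove_Ici _
        | exact absurd (h.nonneg (-1) (by rw [hI]; exact Set.mem_Iic.2 (by norm_num)))
            (by omega))
      refine ⟨_, h.halfChain hm, fun i v hi hv hl => ?_, ⟨l + n, fun i hi => hn _ (by omega)⟩,
        by simp⟩
      have hv' : E.word.vertex (i - l) = some v := by
        rw [h.vertex _ (by omega), add_sub_cancel, hv]
      have := he (i - l) v ((h.isGreatest_iff hv').2 (by rwa [add_sub_cancel])) hv'
      rwa [h.signAt (E.word.mem_of_vertex hv'), add_sub_cancel] at this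
  · rintro ⟨m, hm, he, ⟨a, ha⟩, rfl⟩
    refine ⟨_, h.isChain hm, by simp, fun k v hk hv => ?_, fun _ => ⟨a - l, fun i hi =>
      ha _ (by omega)⟩⟩
    have hk0 := h.nonneg k hk.1
    have := he (l + k) v (by omega) (by rwa [← h.vertex k hk0]) ((h.isGreatest_iff hv).1 hk)
    rwa [h.signAt hk.1]

end Walk.HalfOf

namespace Word

variable {w : Word S} {p : ℤ → Prop} {i : ℤ}

theorem topAt_eq (w : Word S) (p : ℤ → Prop) (hi : i ∈ w.I) :
    ((w.orient p).topAt M i hi : Set (Res D M)) = Strand.topSet M w.toStrand p i := by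
  rw [Strand.topSet_eq w.connected ((w.vertex_isSome i).2 hi)]
  ext x
  exact and_congr (w.halfOf_right p hi).mem_plus (w.halfOf_leftInv p hi).mem_plus

theorem botAt_eq (hw : w.EndAdmissible) (p : ℤ → Prop) (hi : i ∈ w.I) :
    ((w.orient p).botAt M i hi : Set (Res D M)) = Strand.botSet M w.toStrand p i := by
  have hi' := (w.vertex_isSome i).2 hi
  ext x
  simp only [Strand.botSet, Strand.leftSet_eq w.connected hw.adm hi',
    Strand.rightSet_eq w.connected hw.adm hi', SetLike.mem_coe, Walk.botAt, Submodule.mem_sup,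
    Submodule.mem_inf, (w.halfOf_right p hi).mem_plus, (w.halfOf_leftInv p hi).mem_plus,
    (w.halfOf_right p hi).mem_minus, (w.halfOf_leftInv p hi).mem_minus]
  rfl

end Word

end HalfChains

theorem Strand.Sim.simAt {K : Type u₁} {V : Type u₂} {A : Type u₃} [DivisionRing K] [Fintype V]
    {D : SemilinearClannishData K V A} {S : SignChoice D} {w : Word S} (hw : w.EndAdmissible)
    {p p' : ℤ → Prop} {j : ℤ} (hj : j ∈ w.I)
    (h : Sim.{v} w.toStrand p j w.toStrand p' j) :
    Walk.SimAt.{v} (w.orient p) (w.orient p') j := by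
  refine ⟨rfl, hj, hj, fun M _ _ => ⟨SetLike.coe_injective ?_, SetLike.coe_injective ?_⟩⟩
  · rw [w.topAt_eq p hj, w.topAt_eq p' hj, (h M).1]
  · rw [Word.botAt_eq hw p hj, Word.botAt_eq hw p' hj, (h M).2]

/-! ## Homomorphisms from `M(C)` as chains -/

open SemilinearClannishData

namespace Walk

section Relations

variable {K V A : Type*} [DivisionRing K] [Fintype V] {D : SemilinearClannishData K V A}
  {S : SignChoice D} {M : Type*} [AddCommGroup M] [Module D.Alg M] {C : Walk S}

theorem mkQ_single (C : Walk S) (i : C.word.I) (r : D.Alg) :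
    C.relations.mkQ (Finsupp.single i r) = r • C.b i := by
  rw [b, ← map_smul, Finsupp.smul_single, smul_eq_mul, mul_one]

theorem mkQ_of_rel {x : C.word.I →₀ D.Alg} (h : C.ModuleRel x) : C.relations.mkQ x = 0 := by
  rw [Submodule.mkQ_apply, Submodule.Quotient.mk_eq_zero]
  exact Submodule.subset_span h

theorem e_smul_b (i : C.word.I) {v : V} (h : C.word.vertex i = some v) :
    D.e v • C.b i = C.b i := by
  have := mkQ_of_rel (.vertex i v h)
  rwa [map_sub, mkQ_single, mkQ_single, one_smul, sub_eq_zero] at this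

theorem arr_smul_b {i j : C.word.I} {a : A} (h : C.Arrow i j a) : D.arr a • C.b i = C.b j := by
  have := mkQ_of_rel (.arrow i j a h)
  rwa [map_sub, mkQ_single, mkQ_single, one_smul, sub_eq_zero] at this

theorem arr_smul_b_zero (i : C.word.I) {a : A} (ha : a ∉ D.Sp)
    (hv : C.word.vertex i = some (D.tl a)) (h : ¬ ∃ j, C.Arrow i j a) : D.arr a • C.b i = 0 := by
  have := mkQ_of_rel (.zero i a ha hv h)
  rwa [mkQ_single] at this

namespace Twisting

variable (T : C.Twisting)

theorem smul_ev (r : D.Alg) (θ : T.Top M) (i : C.word.I) :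
    r • T.ev θ i = (show C.Mod →ₗ[D.Alg] M from θ) (r • C.b i) :=
  ((show C.Mod →ₗ[D.Alg] M from θ).map_smul r (C.b i)).symm

open Classical in
/-- The elements `θ(b_i)`, extended by zero. -/
noncomputable def family (θ : T.Top M) (i : ℤ) : Res D M :=
  if h : i ∈ C.word.I then T.ev θ ⟨i, h⟩ else 0

theorem family_of_mem (θ : T.Top M) {i : ℤ} (h : i ∈ C.word.I) :
    T.family θ i = T.ev θ ⟨i, h⟩ := dif_pos h

theorem family_of_notMem (θ : T.Top M) {i : ℤ} (h : i ∉ C.word.I) : T.family θ i = 0 := dif_neg h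

theorem ev_mem (θ : T.Top M) (i : C.word.I) {v : V} (h : C.word.vertex i = some v) :
    T.ev θ i ∈ vertexSpace D M v := by
  change D.e v • T.ev θ i = T.ev θ i
  rw [smul_ev, e_smul_b i h]
  rfl

theorem arr_smul_ev (θ : T.Top M) {i j : C.word.I} {a : A} (h : C.Arrow i j a) :
    T.ev θ j = D.arr a • T.ev θ i := by
  rw [smul_ev, arr_smul_b h]
  rfl

theorem ext_ev {θ θ' : T.Top M} (h : ∀ i, T.ev θ i = T.ev θ' i) : θ = θ' :=
  mod_hom_ext h

/-- The homomorphism with given values `θ(b_i)`. -/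
theorem exists_of_family (m : ℤ → Res D M)
    (h1 : ∀ i v, C.word.vertex i = some v → m i ∈ vertexSpace D M v)
    (h2 : ∀ i j a, C.Arrow i j a → m j = D.arr a • m i)
    (h3 : ∀ i a, a ∉ D.Sp → C.word.vertex i = some (D.tl a) → (¬ ∃ j, C.Arrow i j a) →
      D.arr a • m i = 0) : ∃ θ : T.Top M, ∀ i : C.word.I, T.ev θ i = m i := by
  let f : (C.word.I →₀ D.Alg) →ₗ[D.Alg] M :=
    Finsupp.linearCombination D.Alg fun i : C.word.I => (show M from m i)
  have hf : ∀ i r, f (Finsupp.single i r) = (show M from r • m i) := fun i r =>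
    Finsupp.linearCombination_single D.Alg r i
  have hrel : C.relations ≤ LinearMap.ker f := by
    refine Submodule.span_le.2 ?_
    intro x hx
    simp only [SetLike.mem_coe, LinearMap.mem_ker]
    cases hx with
    | vertex i v h =>
      rw [map_sub, hf, hf, sub_eq_zero, one_smul]
      exact h1 i v h
    | arrow i j a h =>
      rw [map_sub, hf, hf, sub_eq_zero, one_smul]
      exact (h2 i j a h).symm
    | zero i a ha hv h =>
      rw [hf]
      exact h3 i a ha hv h
  refine ⟨C.relations.liftQ f hrel, fun i => ?_⟩
  change C.relations.liftQ f hrel (C.relations.mkQ (Finsupp.single i 1)) = _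
  rw [Submodule.mkQ_apply, Submodule.liftQ_apply, hf, one_smul]

end Twisting

end Relations

end Walk

theorem letter_orient_dir {K V A : Type*} [DivisionRing K] {D : SemilinearClannishData K V A}
    {x : Letter D} {o : Prop} {a : A} (h : x.orient o = .dir a) :
    (∃ ha, x = .dir a ha) ∨ ∃ hs, x = .star a hs := by
  cases x with
  | dir b hb => cases h; exact Or.inl ⟨hb, rfl⟩
  | inv b hb => cases h
  | star s hs =>
    by_cases ho : o
    · simp only [Letter.orient, ho, if_true, WalkLetter.dir.injEq] at h
      subst h
      exact Or.inr ⟨hs, rfl⟩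
    · simp [Letter.orient, ho] at h

theorem letter_orient_inv {K V A : Type*} [DivisionRing K] {D : SemilinearClannishData K V A}
    {x : Letter D} {o : Prop} {a : A} (h : x.orient o = .inv a) :
    (∃ ha, x = .inv a ha) ∨ ∃ hs, x = .star a hs := by
  cases x with
  | dir b hb => cases h
  | inv b hb => cases h; exact Or.inl ⟨hb, rfl⟩
  | star s hs =>
    by_cases ho : o
    · simp [Letter.orient, ho] at h
    · simp only [Letter.orient, ho, if_false, WalkLetter.inv.injEq] at h
      subst h
      exact Or.inr ⟨hs, rfl⟩

theorem Word.arrow_iff {K V A : Type*} [DivisionRing K] {D : SemilinearClannishData K V A}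
    {S : SignChoice D} {w : Word S} {p : ℤ → Prop} {i j : ℤ} {a : A} (ha : a ∉ D.Sp) :
    (w.orient p).Arrow i j a ↔ (w.letter i = some (.dir a ha) ∧ j = i - 1) ∨
      (w.letter j = some (.inv a ha) ∧ i = j - 1) := by
  simp only [Walk.Arrow, orient_letter, Option.map_eq_some_iff]
  constructor
  · rintro (⟨⟨x, hx, h⟩, rfl⟩ | ⟨⟨x, hx, h⟩, rfl⟩)
    · rcases letter_orient_dir h with ⟨h', rfl⟩ | ⟨hs, rfl⟩
      · exact Or.inl ⟨hx, rfl⟩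
      · exact absurd hs ha
    · rcases letter_orient_inv h with ⟨h', rfl⟩ | ⟨hs, rfl⟩
      · exact Or.inr ⟨hx, rfl⟩
      · exact absurd hs ha
  · rintro (⟨h, rfl⟩ | ⟨h, rfl⟩)
    · exact Or.inl ⟨⟨_, h, rfl⟩, rfl⟩
    · exact Or.inr ⟨⟨_, h, rfl⟩, rfl⟩

/-! ### Homomorphisms from M(C) are the chains satisfying 1^+ -/

section Chains

variable {K V A : Type*} [DivisionRing K] [Fintype V] {D : SemilinearClannishData K V A}
  {S : SignChoice D} {M : Type*} [AddCommGroup M] [Module D.Alg M]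

/-- An ordinary arrow `a` kills an element of a chain if `a⁻¹` has the sign of the next letter
without being equal to it. -/
theorem Strand.Good.arr_smul_eq_zero {w : Strand S} {o : ℤ → Prop} {m : ℤ → Res D M}
    (hm : w.Good o m) {i : ℤ} {a : A} (ha : a ∉ D.Sp) (hv : w.vertex i = some (D.tl a))
    (hs : S.sgn (.inv a ha) = w.sgn i) (hne : w.letter (i + 1) ≠ some (.inv a ha)) :
    D.arr a • m i = 0 := by
  rcases hy : w.letter (i + 1) with _ | y
  · have h := (hm.right i _ hv hy).2
    simp only [SetLike.mem_coe, Submodule.mem_iInf] at h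
    exact (h a ⟨rfl, by rwa [star_inv_of_notMem ha]⟩).2
  · have hyv := head_of_letter hy
    rw [hv] at hyv
    obtain ⟨a', b', ha', hb', hZ, ⟨h1, h2⟩ | ⟨h1, h2⟩⟩ := S.compat (.inv a ha) y
      (fun h => hne (by rw [hy, h])) (Option.some_injective _ hyv)
      (by rw [hs, w.sgn_letter _ _ hy])
    · cases h1
      subst h2
      have := hm.chain.rel _ _ hy
      rw [add_sub_cancel_right] at this
      rw [this.2, arr_arr_smul hZ]
    · cases h1

namespace Word

variable {w : Word S} {p : ℤ → Prop}

variable (T : (w.orient p).Twisting)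

/-- At a right end an arrow whose inverse has the outgoing sign is ordinary, by admissibility, and
labels no arrow of Q_C there, so a defining relation of M(C) makes it act as zero. -/
theorem family_rightPlus (hw : w.EndAdmissible) (θ : T.Top M) :
    w.toStrand.RightPlus (T.family θ) := by
  intro i v hv hi
  have hmem : i ∈ (w.orient p).word.I := w.mem_of_vertex hv
  rw [T.family_of_mem θ hmem]
  refine ⟨T.ev_mem θ _ hv, ?_⟩
  simp only [SetLike.mem_coe, Submodule.mem_iInf]
  rintro a ⟨rfl, hs⟩
  refine ⟨T.ev_mem θ _ hv, ?_⟩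
  have ha : a ∉ D.Sp := fun h => hw.adm.1 i _ hv hi a h (D.special_loop a h) (by
    rw [← hs]; simp [WalkLetter.star, h])
  rw [star_inv_of_notMem ha] at hs
  suffices h : ¬ ∃ j, (w.orient p).Arrow i j a by
    rw [T.smul_ev, Walk.arr_smul_b_zero ⟨i, hmem⟩ ha hv h, map_zero]
    rfl
  rintro ⟨j, hj⟩
  rcases (arrow_iff ha).1 hj with ⟨h, -⟩ | ⟨h, hij⟩
  · have h1 := w.toStrand.sgn_inverse i _ h
    rw [show (Letter.dir a ha).inverse = .inv a ha from rfl, hs] at h1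
    exact units_ne_neg_self _ h1
  · rw [show j = i + 1 by omega] at h
    exact Option.some_ne_none _ (h.symm.trans hi)

theorem family_leftPlus (hw : w.EndAdmissible) (θ : T.Top M) :
    w.toStrand.rev.RightPlus (fun i => T.family θ (-i)) := by
  intro i v hv hi
  have hv' : w.vertex (-i) = some v := hv
  have hi' : w.letter (-i) = none := by
    rw [Strand.rev_letter, Option.map_eq_none_iff, sub_add_cancel_right] at hi
    exact hi
  have hmem : -i ∈ (w.orient p).word.I := w.mem_of_vertex hv'
  change T.family θ (-i) ∈ _
  rw [T.family_of_mem θ hmem]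
  refine ⟨T.ev_mem θ _ hv', ?_⟩
  simp only [SetLike.mem_coe, Submodule.mem_iInf]
  rintro a ⟨rfl, hs⟩
  refine ⟨T.ev_mem θ _ hv', ?_⟩
  have ha : a ∉ D.Sp := fun h => hw.adm.2 i _ hv hi a h (D.special_loop a h) (by
    rw [← hs]; simp [WalkLetter.star, h])
  rw [star_inv_of_notMem ha] at hs
  suffices h : ¬ ∃ j, (w.orient p).Arrow (-i) j a by
    rw [T.smul_ev, Walk.arr_smul_b_zero ⟨-i, hmem⟩ ha hv' h, map_zero]
    rfl
  rintro ⟨j, hj⟩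
  rcases (arrow_iff ha).1 hj with ⟨h, -⟩ | ⟨h, hij⟩
  · exact Option.some_ne_none _ (h.symm.trans hi')
  · rw [show j = -i + 1 by omega] at h
    have h1 := w.toStrand.sgn_letter (-i) _ h
    rw [hs, Strand.rev_sgn] at h1
    exact units_ne_neg_self _ h1.symm

theorem family_good (hw : w.EndAdmissible) (θ : T.Top M) :
    w.toStrand.Good p (T.family θ) := by
  refine ⟨⟨fun i v hv => ?_, fun i x hx => ?_⟩, family_rightPlus T hw θ, family_leftPlus T hw θ⟩
  · rw [T.family_of_mem θ (show i ∈ (w.orient p).word.I from w.mem_of_vertex hv)]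
    exact T.ev_mem θ _ hv
  · obtain ⟨h1, h2⟩ := w.mem_of_letter hx
    have hl : (w.orient p).letter i = some (x.orient (p i)) := by
      rw [orient_letter, show w.letter i = some x from hx]
      rfl
    have hhead : w.vertex (i - 1) = some x.head := w.head_letter i x hx
    have htail : w.vertex i = some x.tail := w.tail_letter i x hx
    rw [T.family_of_mem θ (show i ∈ (w.orient p).word.I from h1),
      T.family_of_mem θ (show i - 1 ∈ (w.orient p).word.I from h2)]
    rcases ho : x.orient (p i) with a | a
    · rw [ho] at hl
      refine ⟨T.ev_mem θ _ ?_, T.arr_smul_ev θ (Or.inl ⟨hl, rfl⟩)⟩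
      rcases letter_orient_dir ho with ⟨h', rfl⟩ | ⟨hs, rfl⟩ <;> exact htail
    · rw [ho] at hl
      refine ⟨T.ev_mem θ _ ?_, T.arr_smul_ev θ (Or.inr ⟨hl, rfl⟩)⟩
      rcases letter_orient_inv ho with ⟨h', rfl⟩ | ⟨hs, rfl⟩
      · exact hhead
      · rw [← D.special_loop a hs]; exact hhead

/-- The inverse of an ordinary arrow starting at v_i has the sign required on the right of i or the
one required on the left. If it is not the adjacent letter on that side, the end condition or a
zero-relation kills m_i. -/
theorem exists_of_good {m : ℤ → Res D M} (hm : w.toStrand.Good p m) :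
    ∃ θ : T.Top M, ∀ i : (w.orient p).word.I, T.ev θ i = m i := by
  refine T.exists_of_family m hm.chain.mem ?_ ?_
  · rintro i j a (⟨h, rfl⟩ | ⟨h, rfl⟩)
    · rw [orient_letter, Option.map_eq_some_iff] at h
      obtain ⟨x, hx, h⟩ := h
      have := hm.chain.rel i x hx
      rw [h] at this
      exact this.2
    · rw [orient_letter, Option.map_eq_some_iff] at h
      obtain ⟨x, hx, h⟩ := h
      have := hm.chain.rel j x hx
      rw [h] at this
      exact this.2
  · intro i a ha hv hno
    have hv' : w.toStrand.vertex i = some (D.tl a) := hv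
    rcases eq_or_ne (S.sgn (.inv a ha)) (w.toStrand.sgn i) with h | h
    · exact hm.arr_smul_eq_zero ha hv' h fun h' => hno
        ⟨i + 1, (arrow_iff ha).2 (Or.inr ⟨h', by ring⟩)⟩
    · have := hm.rev.arr_smul_eq_zero (i := -i) ha (by rwa [Strand.rev_vertex, neg_neg])
        (by rw [Int.units_ne_iff_eq_neg.1 h, Strand.rev_sgn, neg_neg]) (fun h' => by
          obtain ⟨y, hy, hya⟩ := Option.map_eq_some_iff.1 h'
          rw [sub_add_cancel_right, neg_neg] at hy
          refine hno ⟨i - 1, (arrow_iff ha).2 (Or.inl ⟨?_, rfl⟩)⟩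
          rw [show w.letter i = some y from hy]
          cases y <;> simp_all [Letter.inverse])
      simpa using this

end Word

end Chains

open SemilinearClannishData

/-! ### F_C in terms of values at one index -/

section Bottom

variable {K V A : Type*} [DivisionRing K] [Fintype V] {D : SemilinearClannishData K V A}
  {S : SignChoice D} {M : Type*} [AddCommGroup M] [Module D.Alg M]

namespace Strand

variable {w : Strand S} {o : ℤ → Prop} {m : ℤ → Res D M} {j : ℤ}

theorem Good.zero (w : Strand S) (o : ℤ → Prop) : w.Good o (fun _ => (0 : Res D M)) :=
  ⟨⟨fun _ _ _ => zero_mem _, fun _ _ _ => LetterRel.zero _⟩, fun _ _ _ _ => zero_mem _,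
    fun _ _ _ _ => zero_mem _⟩

theorem LeftMinus.add {m' : ℤ → Res D M} (hm : w.LeftMinus m) (hm' : w.LeftMinus m') :
    w.LeftMinus fun i => m i + m' i :=
  RightMinus.add hm hm'

theorem Good.neg (hm : w.Good o m) : w.Good o (fun i => - m i) :=
  ⟨hm.chain.neg, fun i v hv hi => neg_mem (hm.right i v hv hi),
    fun i v hv hi => neg_mem (hm.left i v hv hi)⟩

/-- A chain with a zero can be cut there. -/
theorem Good.cut (hm : w.Good o m) (hw : w.Connected) (hj : (w.vertex j).isSome) (h0 : m j = 0) :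
    (w.Good o (fun i => if i ≤ j then m i else 0) ∧
      w.RightMinus (fun i => if i ≤ j then m i else 0)) ∧
    w.Good o (fun i => if i ≤ j then 0 else m i) ∧
      w.LeftMinus (fun i => if i ≤ j then 0 else m i) := by
  refine ⟨⟨⟨hm.chain.glue (Good.zero w o).chain h0 (fun _ _ => Iff.rfl) (fun _ _ => Iff.rfl),
    fun i v hv hi => ?_, fun i v hv hi => ?_⟩, fun i v hv hi => ?_⟩,
    ⟨(Good.zero w o).chain.glue hm.chain h0.symm (fun _ _ => Iff.rfl) (fun _ _ => Iff.rfl),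
    fun i v hv hi => ?_, fun i v hv hi => ?_⟩, fun i v hv hi => ?_⟩
  · by_cases h : i ≤ j
    · simpa only [h, if_true] using hm.right i v hv hi
    · simp only [h, if_false]; exact zero_mem _
  · by_cases h : -i ≤ j
    · simpa only [h, if_true] using hm.left i v hv hi
    · simp only [h, if_false]; exact zero_mem _
  · have : (if i ≤ j then m i else 0) = 0 := by
      rcases lt_trichotomy i j with h | rfl | h
      · exact absurd hi (hw i j (by rw [hv]; rfl) hj h).1
      · rw [if_pos le_rfl, h0]
      · rw [if_neg h.not_ge]
    change (if i ≤ j then m i else 0) ∈ _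
    rw [this]; exact zero_mem _
  · by_cases h : i ≤ j
    · simp only [h, if_true]; exact zero_mem _
    · simpa only [h, if_false] using hm.right i v hv hi
  · by_cases h : -i ≤ j
    · simp only [h, if_true]; exact zero_mem _
    · simpa only [h, if_false] using hm.left i v hv hi
  · have : -i ≤ j := by
      by_contra hcon
      rw [rev_letter, Option.map_eq_none_iff, sub_add_cancel_right] at hi
      rw [rev_vertex] at hv
      exact (hw j (-i) hj (by rw [hv]; rfl) (by omega)).2 hi
    simp only [this, if_true]; exact zero_mem _

end Strand

namespace Word

variable {w : Word S} {p : ℤ → Prop} (T : (w.orient p).Twisting) {j : ℤ}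

theorem family_left {θ : T.Top M} (hθ : θ ∈ T.botPlus M) :
    w.toStrand.LeftMinus (T.family θ) ∧ ∃ a, ∀ i ≤ a, T.family θ i = 0 := by
  obtain ⟨h1, h2⟩ := hθ
  constructor
  · intro i v hv hi
    rw [Strand.rev_letter, Option.map_eq_none_iff, sub_add_cancel_right] at hi
    have hv' : w.vertex (-i) = some v := hv
    have hl : IsLeast w.I (-i) := w.isLeast_iff.2 ⟨w.mem_of_vertex hv', hi⟩
    have h0 := w.isIndexSet.isLeast hl
    obtain rfl : i = 0 := by omega
    rw [neg_zero] at hl hv'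
    have := h2 hl v hv'
    rw [← T.family_of_mem] at this
    rw [Strand.rev_sgn, neg_zero]
    change T.family θ (-0) ∈ trivialMinus M S v (-w.signAt 0)
    rwa [w.signAt_zero, neg_zero]
  · by_cases hb : BddBelow (w.orient p).word.I
    · obtain ⟨b, hb⟩ := hb
      refine ⟨b - 1, fun i hi => T.family_of_notMem θ fun h => ?_⟩
      have := hb h
      omega
    · obtain ⟨n, hn⟩ := h1 hb
      refine ⟨n, fun i hi => ?_⟩
      by_cases h : i ∈ (w.orient p).word.I
      · rw [T.family_of_mem θ h]; exact hn ⟨i, h⟩ hi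
      · exact T.family_of_notMem θ h

theorem family_right {θ : T.Top M} (hθ : θ ∈ T.botMinus M) :
    w.toStrand.RightMinus (T.family θ) ∧ ∃ a, ∀ i, a ≤ i → T.family θ i = 0 := by
  obtain ⟨h1, h2⟩ := hθ
  constructor
  · intro i v hv hi
    have hv' : w.vertex i = some v := hv
    have hl : IsGreatest w.I i := w.isGreatest_iff.2 ⟨w.mem_of_vertex hv', hi⟩
    have := h2 i hl v hv'
    rwa [← T.family_of_mem] at this
  · by_cases hb : BddAbove (w.orient p).word.I
    · obtain ⟨b, hb⟩ := hb
      refine ⟨b + 1, fun i hi => T.family_of_notMem θ fun h => ?_⟩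
      have := hb h
      omega
    · obtain ⟨n, hn⟩ := h1 hb
      refine ⟨n, fun i hi => ?_⟩
      by_cases h : i ∈ (w.orient p).word.I
      · rw [T.family_of_mem θ h]; exact hn ⟨i, h⟩ hi
      · exact T.family_of_notMem θ h

theorem mem_botPlus {θ : T.Top M} {m : ℤ → Res D M}
    (hθ : ∀ i : (w.orient p).word.I, T.ev θ i = m i) (hm : w.toStrand.LeftMinus m)
    (ha : ∃ a, ∀ i ≤ a, m i = 0) : θ ∈ T.botPlus M := by
  obtain ⟨a, ha⟩ := ha
  refine ⟨fun _ => ⟨a, fun i hi => (hθ i).trans (ha _ hi)⟩, fun h v hv => ?_⟩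
  have := hm 0 v (by rw [Strand.rev_vertex, neg_zero]; exact hv) (by
    rw [Strand.rev_letter, zero_add, sub_self, Option.map_eq_none_iff]
    exact (w.isLeast_iff.1 h).2)
  rw [Strand.rev_sgn, neg_zero] at this
  rw [hθ]
  change m (-0) ∈ trivialMinus M S v (-w.signAt 0) at this
  rwa [w.signAt_zero, neg_zero] at this

theorem mem_botMinus {θ : T.Top M} {m : ℤ → Res D M}
    (hθ : ∀ i : (w.orient p).word.I, T.ev θ i = m i) (hm : w.toStrand.RightMinus m)
    (ha : ∃ a, ∀ i, a ≤ i → m i = 0) : θ ∈ T.botMinus M := by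
  obtain ⟨a, ha⟩ := ha
  refine ⟨fun _ => ⟨a, fun i hi => (hθ i).trans (ha _ hi)⟩, fun n h v hv => ?_⟩
  rw [hθ]
  exact hm n v hv (w.isGreatest_iff.1 h).2

/-- Membership can be tested at a single index: two chains with the same value at j differ by a
chain that is zero at j, and its two pieces are absorbed by `botPlus` and `botMinus`. -/
theorem mem_bot_iff (hw : w.EndAdmissible) (hj : j ∈ w.I) (θ : T.Top M) :
    θ ∈ T.bot M ↔ T.ev θ ⟨j, hj⟩ ∈ Strand.botSet M w.toStrand p j := by
  have hev : ∀ θ : T.Top M, T.ev θ ⟨j, hj⟩ = T.family θ j := fun θ =>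
    (T.family_of_mem θ (show j ∈ (w.orient p).word.I from hj)).symm
  constructor
  · intro h
    obtain ⟨θ₁, h1, θ₂, h2, rfl⟩ := Submodule.mem_sup.1 h
    obtain ⟨h3, h4⟩ := family_left T h1
    obtain ⟨h5, h6⟩ := family_right T h2
    refine ⟨_, ⟨_, family_good T hw θ₁, h3, h4, rfl⟩, _, ⟨_, family_good T hw θ₂, h5, h6, rfl⟩, ?_⟩
    rw [T.ev_add, hev, hev]
  · rintro ⟨_, ⟨m₁, g1, l1, ⟨a₁, ha₁⟩, rfl⟩, _, ⟨m₂, g2, r2, ⟨a₂, ha₂⟩, rfl⟩, he⟩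
    -- The difference between θ and the sum of the two given chains vanishes at j. Its part to the
    -- right of j joins the chain dying out on the left, and conversely.
    have hn := (family_good T hw θ).add (g1.add g2).neg
    obtain ⟨⟨c1, c2⟩, c3, c4⟩ := hn.cut w.connected ((w.vertex_isSome j).2 hj) (by
      rw [he, hev, add_neg_cancel])
    have s1 := g1.add c3
    have s2 := g2.add c1
    obtain ⟨θ₁, hθ₁⟩ := exists_of_good T s1
    obtain ⟨θ₂, hθ₂⟩ := exists_of_good T s2
    have b1 : θ₁ ∈ T.botPlus M := by
      refine mem_botPlus T ?_ (Strand.LeftMinus.add l1 c4) ⟨min a₁ j, fun i hi => ?_⟩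
      · exact hθ₁
      · simp only [hi.trans (min_le_right _ _), if_true, ha₁ i (hi.trans (min_le_left _ _)),
          add_zero]
    have b2 : θ₂ ∈ T.botMinus M := by
      refine mem_botMinus T ?_ (r2.add c2) ⟨max a₂ (j + 1), fun i hi => ?_⟩
      · exact hθ₂
      · have : ¬ i ≤ j := by have := (le_max_right a₂ (j + 1)).trans hi; omega
        simp only [this, if_false, ha₂ i ((le_max_left _ _).trans hi), add_zero]
    refine Submodule.mem_sup.2 ⟨θ₁, b1, θ₂, b2, T.ext_ev fun i => ?_⟩
    rw [T.ev_add, hθ₁, hθ₂, ← T.family_of_mem θ i.2]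
    by_cases h : (i : ℤ) ≤ j
    · simp only [h, if_true]; abel
    · simp only [h, if_false]; abel

theorem exists_ev_iff (hw : w.EndAdmissible) (hj : j ∈ w.I) (x : Res D M) :
    (∃ θ : T.Top M, T.ev θ ⟨j, hj⟩ = x) ↔ x ∈ Strand.topSet M w.toStrand p j := by
  constructor
  · rintro ⟨θ, rfl⟩
    exact ⟨_, family_good T hw θ, T.family_of_mem θ (show j ∈ (w.orient p).word.I from hj)⟩
  · rintro ⟨m, hm, rfl⟩
    obtain ⟨θ, hθ⟩ := exists_of_good T hm
    exact ⟨θ, hθ _⟩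

end Word

end Bottom

/-! ## Functors that are isomorphic up to twist -/

open SemilinearClannishData

section Twist

variable {R K : Type*} [Ring R] [DivisionRing K]

/-- The functors `F` and `G` are isomorphic up to twist. -/
def IsoUpToTwist (F G : ModuleCat.{v} R ⥤ ModuleCat.{u₁} K) : Prop :=
  ∃ σ : RingAut K, Nonempty (F ≅ G ⋙ ModuleCat.restrictScalars (σ : K →+* K))

variable {F G H : ModuleCat.{v} R ⥤ ModuleCat.{u₁} K}

theorem IsoUpToTwist.symm (h : IsoUpToTwist F G) : IsoUpToTwist G F := by
  obtain ⟨σ, ⟨i⟩⟩ := h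
  refine ⟨σ⁻¹, ⟨?_⟩⟩
  have hσ : RingHom.id K = (σ : K →+* K).comp ((σ⁻¹ : RingAut K) : K →+* K) := by
    ext x
    exact (RingEquiv.apply_symm_apply σ x).symm
  exact G.rightUnitor.symm ≪≫
    Functor.isoWhiskerLeft G ((ModuleCat.restrictScalarsId K).symm ≪≫
      ModuleCat.restrictScalarsComp' _ _ _ hσ) ≪≫
    (Functor.associator _ _ _).symm ≪≫ Functor.isoWhiskerRight i.symm _

theorem IsoUpToTwist.trans (h : IsoUpToTwist F G) (h' : IsoUpToTwist G H) :
    IsoUpToTwist F H := by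
  obtain ⟨σ, ⟨i⟩⟩ := h
  obtain ⟨τ, ⟨j⟩⟩ := h'
  refine ⟨τ * σ, ⟨?_⟩⟩
  have hσ : ((τ * σ : RingAut K) : K →+* K) = (τ : K →+* K).comp (σ : K →+* K) := rfl
  exact i ≪≫ Functor.isoWhiskerRight j _ ≪≫ Functor.associator _ _ _ ≪≫
    Functor.isoWhiskerLeft H (ModuleCat.restrictScalarsComp' _ _ _ hσ).symm

end Twist

/-! ### From equal value sets to isomorphic functors -/

section Functor

variable {K : Type u₁} {V : Type u₂} {A : Type u₃} [DivisionRing K] [Fintype V]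
  {D : SemilinearClannishData K V A} {S : SignChoice D} {w : Word S} {p p' : ℤ → Prop}
  {T : (w.orient p).Twisting} {T' : (w.orient p').Twisting} {j j' : ℤ}
  {M : Type v} [AddCommGroup M] [Module D.Alg M]

theorem mk_eq_of_ev (hw : w.EndAdmissible) (hj : j ∈ w.I) {θ θ' : T.Top M}
    (h : T.ev θ ⟨j, hj⟩ = T.ev θ' ⟨j, hj⟩) : (T.bot M).mkQ θ = (T.bot M).mkQ θ' := by
  rw [← sub_eq_zero, ← map_sub, Submodule.mkQ_apply, Submodule.Quotient.mk_eq_zero,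
    Word.mem_bot_iff T hw hj]
  have h0 := (Word.mem_bot_iff T hw hj (0 : T.Top M)).1 (zero_mem _)
  rw [T.ev_zero] at h0
  rwa [sub_eq_add_neg, T.ev_add, show T.ev (-θ') ⟨j, hj⟩ = - T.ev θ' ⟨j, hj⟩ from rfl, h,
    add_neg_cancel]

/-- A class is determined by the value at the chosen index. Scalars act on it through π_j on one
side and through π'_{j'} on the other, so the twist is (π'_{j'})⁻¹ π_j. -/
theorem Strand.Sim.isoUpToTwist (hw : w.EndAdmissible) (hj : j ∈ w.I) (hj' : j' ∈ w.I)
    (h : Strand.Sim.{v} w.toStrand p j w.toStrand p' j') (T : (w.orient p).Twisting)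
    (T' : (w.orient p').Twisting) :
    IsoUpToTwist (Walk.Twisting.functor.{v} T) (Walk.Twisting.functor.{v} T') := by
  have hex : ∀ (M : ModuleCat.{v} D.Alg) (θ : T.Top M),
      ∃ θ' : T'.Top M, T'.ev θ' ⟨j', hj'⟩ = T.ev θ ⟨j, hj⟩ := fun M θ => by
    rw [Word.exists_ev_iff T' hw hj', ← (h M).1, ← Word.exists_ev_iff T hw hj]
    exact ⟨θ, rfl⟩
  have hex' : ∀ (M : ModuleCat.{v} D.Alg) (θ' : T'.Top M),
      ∃ θ : T.Top M, T.ev θ ⟨j, hj⟩ = T'.ev θ' ⟨j', hj'⟩ := fun M θ => by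
    rw [Word.exists_ev_iff T hw hj, (h M).1, ← Word.exists_ev_iff T' hw hj']
    exact ⟨θ, rfl⟩
  choose f hf using hex
  let σ : RingAut K := (T'.π j')⁻¹ * T.π j
  have hσ : ∀ l, T'.π j' (σ l) = T.π j l := fun l => RingEquiv.apply_symm_apply (T'.π j') _
  -- A homomorphism with the same value is chosen; modulo `bot` the choice does not matter, which
  -- gives semilinearity here and naturality below.
  let φ : ∀ M : ModuleCat.{v} D.Alg, T.Top M →ₗ[K]
      ((ModuleCat.restrictScalars (σ : K →+* K)).obj ((Walk.Twisting.functor.{v} T').obj M)) :=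
    fun M =>
    { toFun := fun θ => (T'.bot M).mkQ (f M θ)
      map_add' := fun θ θ' => by
        refine Eq.trans ?_ (map_add (T'.bot M).mkQ (f M θ) (f M θ'))
        apply mk_eq_of_ev hw hj'
        rw [T'.ev_add, hf, hf, hf, T.ev_add]
      map_smul' := fun l θ => by
        refine Eq.trans ?_ (map_smul (T'.bot M).mkQ (σ l) (f M θ))
        apply mk_eq_of_ev hw hj'
        rw [T'.ev_smul, hf, hf, T.ev_smul]
        simp only [hσ] }
  have hφ : ∀ M θ, φ M θ = (T'.bot M).mkQ (f M θ) := fun _ _ => rfl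
  have hker : ∀ M, LinearMap.ker (φ M) = T.bot M := by
    intro M
    ext θ
    rw [LinearMap.mem_ker, hφ, Word.mem_bot_iff T hw hj, (h M).2, ← hf,
      ← Word.mem_bot_iff T' hw hj']
    exact Submodule.Quotient.mk_eq_zero _
  have hsurj : ∀ M, Function.Surjective (φ M) := by
    intro M y
    obtain ⟨θ', rfl⟩ := (T'.bot M).mkQ_surjective y
    obtain ⟨θ, hθ⟩ := hex' M θ'
    refine ⟨θ, ?_⟩
    rw [hφ]
    exact mk_eq_of_ev hw hj' ((hf M θ).trans hθ)
  refine ⟨σ, ⟨NatIso.ofComponents (fun M => LinearEquiv.toModuleIso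
    ((Submodule.quotEquivOfEq _ _ (hker M).symm).trans
      ((φ M).quotKerEquivOfSurjective (hsurj M)))) ?_⟩⟩
  intro M N g
  ext θ
  obtain ⟨θ, rfl⟩ := (T.bot M).mkQ_surjective θ
  change (T'.bot N).mkQ (f N (T.topMap g.hom θ)) = (T'.bot N).mkQ (T'.topMap g.hom (f M θ))
  apply mk_eq_of_ev hw hj'
  rw [hf, T'.ev_topMap, hf, T.ev_topMap]

end Functor

theorem mainTheorem5 {K : Type u₁} {V : Type u₂} {A : Type u₃} [DivisionRing K]
    [Fintype V] [Finite A] (D : SemilinearClannishData K V A)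
    (hnormal : D.NormallyBound) (hnonsing : D.NonSingularType) (S : SignChoice D)
    (w : Word S) (hw : w.EndAdmissible) (hfp : w.IsFinite ∨ w.IsPeriodic)
    (πD : w.specialDirect.Twisting) (πC : w.canonical.Twisting)
    (πD' : w.specialInverse.Twisting) :
    (∃ σ σ' : RingAut K,
      Nonempty (Walk.Twisting.functor.{v} πD ⋙ ModuleCat.restrictScalars (σ : K →+* K) ≅
        Walk.Twisting.functor.{v} πC) ∧
      Nonempty (Walk.Twisting.functor.{v} πC ≅
        Walk.Twisting.functor.{v} πD' ⋙ ModuleCat.restrictScalars (σ' : K →+* K))) ∧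
    ∃ j ∈ w.I, Walk.SimAt.{v} w.specialDirect w.canonical j ∨
      Walk.SimAt.{v} w.specialInverse w.canonical j := by
  have hreg := hfp.imp Word.IsFinite.indexedBy Word.IsPeriodic.periodicBy
  have hadm := hw.adm
  have hcan : ∀ j, Strand.Sim.{v} w.toStrand (Strand.tieOrient w.toStrand (Set.Iic 0)) j
      w.toStrand (fun i => w.IsNaturallyDirect i ∨ (w.IsSymmetry i ∧ i ≤ 0)) j := fun j =>
    Strand.Sim.of_congr fun i s hs hi => (Word.canonical_iff hw hi).symm
  obtain ⟨j, hj, hsim⟩ := Strand.exists_sim_canonical.{v} hnonsing hadm hreg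
  have hj' : j ∈ w.I := (w.vertex_isSome j).1 hj
  constructor
  · obtain ⟨h1, h2⟩ := Strand.orientations_rel.{v} (w := w.toStrand) hnonsing hadm hreg
      (r := fun o o' => ∀ (T : (w.orient o).Twisting) (T' : (w.orient o').Twisting),
        IsoUpToTwist (Walk.Twisting.functor.{v} T) (Walk.Twisting.functor.{v} T'))
      (fun _ _ h T T' => (h T' T).symm)
      (fun _ o' _ h h' T T'' => by
        obtain ⟨T', -⟩ := (w.orient o').exists_twisting
        exact (h T T').trans (h' T' T''))
      (fun _ _ j j' hj hj' h => h.isoUpToTwist hw ((w.vertex_isSome j).1 hj)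
        ((w.vertex_isSome j').1 hj'))
    -- The canonical walk is known to agree with `tieOrient` only at *-letters, so the two are
    -- linked by `hcan` instead of being identified.
    obtain ⟨T, -⟩ := (w.orient (Strand.tieOrient w.toStrand (Set.Iic 0))).exists_twisting
    have h3 : IsoUpToTwist (Walk.Twisting.functor.{v} T) (Walk.Twisting.functor.{v} πC) :=
      (hcan j).isoUpToTwist hw hj' hj' T πC
    obtain ⟨σ, ⟨i⟩⟩ := ((h1 πD T).trans h3).symm
    obtain ⟨σ', ⟨i'⟩⟩ := h3.symm.trans (h2 T πD')
    exact ⟨σ, σ', ⟨i.symm⟩, ⟨i'⟩⟩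
  · exact ⟨j, hj', hsim.imp (fun h => (h.trans (hcan j)).simAt hw hj')
      fun h => (h.trans (hcan j)).simAt hw hj'⟩
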